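/- Let $d\in\mathbb N$ and $s>1/2$. **Notation.** $\Sigma_s(\mathbb R^d)$ is the space of all $f\in C^\infty(\mathbb R^d)$ such that for every $h>0$ $$\|f\|_{\mathcal S_{s,h}}=\sup_{x\in\mathbb R^d,\ \alpha,\beta\in\mathbb N^d}\frac{|x^\alpha\partial^\beta f(x)|}{h^{|\alpha+\beta|}\,\alpha!^s\,\beta!^s}<\infty ,$$ topologized by these seminorms, and $\Sigma_s'(\mathbb R^d)$ is its topological dual with the strong topology. We write $(u,\varphi)$ for the action of $u\in\Sigma_s'(\mathbb R^d)$ on $\varphi\in\Sigma_s(\mathbb R^d)$, conjugate linear in $\varphi$ and consistent with $(f,\varphi)=\int f\,\overline{\varphi}\,dx$, by which $\Sigma_s(\mathbb R^d)\subseteq\Sigma_s'(\mathbb R^d)$. For $\varphi\in\Sigma_s(\mathbb R^d)\setminus\{0\}$ and $u\in\Sigma_s'(\mathbb R^d)$ let $$V_\varphi u(x,\xi)=(u,M_\xi T_x\varphi),\qquad M_\xi T_x\varphi(y)=e^{i\langle y,\xi\rangle}\varphi(y-x).$$ The wave front set $WF^s(u)\subseteq T^*\mathbb R^d\setminus 0$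 is defined as follows, where $T^*\mathbb R^d=\mathbb R^{2d}$ carries the Euclidean norm: a point $z_0\neq 0$ is not in $WF^s(u)$ if and only if there is an open conic set $\Gamma\subseteq T^*\mathbb R^d\setminus 0$ (invariant under multiplication by positive reals) containing $z_0$ such that $\sup_{z\in\Gamma}e^{A|z|^{1/s}}|V_\varphi u(z)|<\infty$ for every $A>0$. For $K\in\Sigma_s'(\mathbb R^{2d})$, with points of $T^*\mathbb R^{2d}$ written $(x,y,\xi,\eta)$, where $(x,y)$ is the position and $(\xi,\eta)$ the frequency, put $$WF^s_1(K)=\{(x,\xi):(x,0,\xi,0)\in WF^s(K)\},\qquad WF^s_2(K)=\{(y,\eta):(0,y,0,-\eta)\in WF^s(K)\},$$ $$WF^s(K)'\circ WF^s(u)=\{(x,\xi):\ \exists (y,\eta)\in WF^s(u):\ (x,y,\xi,-\eta)\in WF^s(K)\}.$$ **Theorem.** Let $K\in\Sigma_s'(\mathbb R^{2d})$ and let $\mathscr K:\Sigma_s(\mathbb R^d)\to\Sigma_s'(\mathbb R^d)$ be the linear operator with Schwartz kernel $K$, that is, $(\mathscr Kf,g)=(K,g\otimes\overline f)$ for $f,g\in\Sigma_s(\mathbb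 R^d)$. Suppose that $\mathscr K$ maps $\Sigma_s(\mathbb R^d)$ continuously into $\Sigma_s(\mathbb R^d)$ and extends (uniquely) to a continuous linear operator $\mathscr K:\Sigma_s'(\mathbb R^d)\to\Sigma_s'(\mathbb R^d)$. Suppose also that $WF^s_1(K)=WF^s_2(K)=\emptyset$. Then for every $u\in\Sigma_s'(\mathbb R^d)$ $$WF^s(\mathscr Ku)\subseteq WF^s(K)'\circ WF^s(u).$$ This holds whichever nonzero windows in $\Sigma_s(\mathbb R^{2d})$, $\Sigma_s(\mathbb R^d)$ and $\Sigma_s(\mathbb R^d)$ are used to define $WF^s(K)$, $WF^s(u)$ and $WF^s(\mathscr Ku)$, respectively. -/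

import Mathlib

open scoped ContDiff

noncomputable section

/-! ### Gelfand--Shilov spaces of Beurling type -/

/-- Euclidean space `ℝ^d`. -/
abbrev RSpace (d : ℕ) : Type := EuclideanSpace ℝ (Fin d)

/-- The mixed partial derivative `∂^β f (x)` of a smooth function for a multi-index `β`: the
iterated derivative of order `|β|` evaluated at the directions
`e_1, …, e_1, e_2, …, e_2, …, e_d, …, e_d`, in which `e_i` occurs `β i` times. -/
def mixedPartial {d : ℕ} (β : Fin d → ℕ) (f : RSpace d → ℂ) (x : RSpace d) : ℂ :=
  iteratedFDeriv ℝ (∑ i, β i) f x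
    (fun k => EuclideanSpace.single (finSigmaFinEquiv.symm k).1 (1 : ℝ))

/-- The factorial `α! = α_1! ⋯ α_d!` of a multi-index. -/
def multiFactorial {d : ℕ} (α : Fin d → ℕ) : ℕ := ∏ i, (α i).factorial

/-- The quotient `|x^α ∂^β f(x)| / (h^{|α+β|} α!^s β!^s)`, with `p = (α, β, x)`. -/
def gsQuotient {d : ℕ} (s h : ℝ) (f : RSpace d → ℂ)
    (p : (Fin d → ℕ) × (Fin d → ℕ) × RSpace d) : ℝ :=
  |∏ i, p.2.2 i ^ p.1 i| * ‖mixedPartial p.2.1 f p.2.2‖ /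
    (h ^ (∑ i, p.1 i + ∑ i, p.2.1 i) *
      ((multiFactorial p.1 : ℝ) ^ s * (multiFactorial p.2.1 : ℝ) ^ s))

/-- Membership in `Σ_s(ℝ^d) = ⋂_{h > 0} S_{s,h}(ℝ^d)`: `f` is smooth and for every `h > 0` the
quotients `|x^α ∂^β f(x)| / (h^{|α+β|} α!^s β!^s)` are bounded uniformly in `α, β, x`. -/
def IsGS {d : ℕ} (s : ℝ) (f : RSpace d → ℂ) : Prop :=
  ContDiff ℝ ∞ f ∧ ∀ h : ℝ, 0 < h → BddAbove (Set.range (gsQuotient s h f))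

theorem gsDen_pos {d : ℕ} (s : ℝ) {h : ℝ} (hh : 0 < h) (α β : Fin d → ℕ) :
    0 < h ^ (∑ i, α i + ∑ i, β i) *
      ((multiFactorial α : ℝ) ^ s * (multiFactorial β : ℝ) ^ s) := by
  have key : ∀ γ : Fin d → ℕ, (0 : ℝ) < multiFactorial γ := fun γ => by
    have : 0 < multiFactorial γ := Finset.prod_pos fun i _ => Nat.factorial_pos _
    exact_mod_cast this
  have := key α
  have := key β
  positivity

theorem gsQuotient_nonneg {d : ℕ} (s : ℝ) {h : ℝ} (hh : 0 < h) (f : RSpace d → ℂ)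
    (p : (Fin d → ℕ) × (Fin d → ℕ) × RSpace d) : 0 ≤ gsQuotient s h f p :=
  div_nonneg (by positivity) (gsDen_pos s hh _ _).le

theorem mixedPartial_add {d : ℕ} (β : Fin d → ℕ) {f g : RSpace d → ℂ} (hf : ContDiff ℝ ∞ f)
    (hg : ContDiff ℝ ∞ g) (x : RSpace d) :
    mixedPartial β (f + g) x = mixedPartial β f x + mixedPartial β g x := by
  simp only [mixedPartial]
  rw [iteratedFDeriv_add_apply (hf.of_le (by exact_mod_cast le_top)).contDiffAt
    (hg.of_le (by exact_mod_cast le_top)).contDiffAt]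
  rfl

theorem mixedPartial_smul {d : ℕ} (β : Fin d → ℕ) {f : RSpace d → ℂ} (hf : ContDiff ℝ ∞ f)
    (c : ℂ) (x : RSpace d) : mixedPartial β (c • f) x = c * mixedPartial β f x := by
  simp only [mixedPartial]
  rw [iteratedFDeriv_const_smul_apply (hf.of_le (by exact_mod_cast le_top)).contDiffAt]
  rfl

theorem gsQuotient_add_le {d : ℕ} (s : ℝ) {h : ℝ} (hh : 0 < h) {f g : RSpace d → ℂ}
    (hf : ContDiff ℝ ∞ f) (hg : ContDiff ℝ ∞ g)
    (p : (Fin d → ℕ) × (Fin d → ℕ) × RSpace d) :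
    gsQuotient s h (f + g) p ≤ gsQuotient s h f p + gsQuotient s h g p := by
  simp only [gsQuotient]
  rw [mixedPartial_add _ hf hg, ← add_div, ← mul_add]
  have := gsDen_pos s hh p.1 p.2.1
  gcongr
  exact norm_add_le _ _

theorem gsQuotient_smul {d : ℕ} (s h : ℝ) {f : RSpace d → ℂ} (hf : ContDiff ℝ ∞ f) (c : ℂ)
    (p : (Fin d → ℕ) × (Fin d → ℕ) × RSpace d) :
    gsQuotient s h (c • f) p = ‖c‖ * gsQuotient s h f p := by
  simp only [gsQuotient]
  rw [mixedPartial_smul _ hf, norm_mul]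
  ring

theorem IsGS.add {d : ℕ} {s : ℝ} {f g : RSpace d → ℂ} (hf : IsGS s f) (hg : IsGS s g) :
    IsGS s (f + g) := by
  refine ⟨hf.1.add hg.1, fun h hh => ?_⟩
  obtain ⟨A, hA⟩ := hf.2 h hh
  obtain ⟨B, hB⟩ := hg.2 h hh
  refine ⟨A + B, ?_⟩
  rintro _ ⟨p, rfl⟩
  exact (gsQuotient_add_le s hh hf.1 hg.1 p).trans
    (add_le_add (hA ⟨p, rfl⟩) (hB ⟨p, rfl⟩))

theorem IsGS.smul {d : ℕ} {s : ℝ} {f : RSpace d → ℂ} (hf : IsGS s f) (c : ℂ) :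
    IsGS s (c • f) := by
  refine ⟨hf.1.const_smul c, fun h hh => ?_⟩
  obtain ⟨A, hA⟩ := hf.2 h hh
  refine ⟨‖c‖ * A, ?_⟩
  rintro _ ⟨p, rfl⟩
  rw [gsQuotient_smul s h hf.1]
  exact mul_le_mul_of_nonneg_left (hA ⟨p, rfl⟩) (norm_nonneg _)

theorem IsGS.zero {d : ℕ} {s : ℝ} : IsGS s (0 : RSpace d → ℂ) := by
  refine ⟨contDiff_const, fun h hh => ⟨0, ?_⟩⟩
  rintro _ ⟨p, rfl⟩
  have : (0 : RSpace d → ℂ) = (0 : ℂ) • (0 : RSpace d → ℂ) := by simp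
  rw [this, gsQuotient_smul s h (f := 0) contDiff_const]
  simp

/-- The functions in `Σ_s(ℝ^d)` form a complex vector space. -/
def gsSubmodule (s : ℝ) (d : ℕ) : Submodule ℂ (RSpace d → ℂ) where
  carrier := {f | IsGS s f}
  add_mem' hf hg := IsGS.add hf hg
  zero_mem' := IsGS.zero
  smul_mem' c _ hf := IsGS.smul hf c

/-- The Gelfand--Shilov space `Σ_s(ℝ^d)` (its topology is defined below by the seminorms). -/
def GSSpace (s : ℝ) (d : ℕ) : Type := gsSubmodule s d

namespace GSSpace

variable {s : ℝ} {d : ℕ}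

instance : AddCommGroup (GSSpace s d) := inferInstanceAs (AddCommGroup (gsSubmodule s d))

instance : Module ℂ (GSSpace s d) := inferInstanceAs (Module ℂ (gsSubmodule s d))

instance : CoeFun (GSSpace s d) (fun _ => RSpace d → ℂ) := ⟨fun f => f.1⟩

theorem ext {f g : GSSpace s d} (h : ∀ x, f x = g x) : f = g := Subtype.ext (funext h)

/-- The norm `‖f‖_{S_{s,h}} = sup_{α, β, x} |x^α ∂^β f(x)| / (h^{|α+β|} α!^s β!^s)`, as a
seminorm on `Σ_s(ℝ^d)`. -/
def gsSeminorm (s : ℝ) (d : ℕ) (h : {h : ℝ // 0 < h}) : Seminorm ℂ (GSSpace s d) :=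
  Seminorm.of (fun f => ⨆ p, gsQuotient s h f.1 p)
    (fun f g => by
      refine ciSup_le fun p => ?_
      refine (gsQuotient_add_le s h.2 f.2.1 g.2.1 p).trans ?_
      exact add_le_add (le_ciSup (f.2.2 h h.2) p) (le_ciSup (g.2.2 h h.2) p))
    (fun c f => by
      have : ∀ p, gsQuotient s h (c • f : GSSpace s d).1 p = ‖c‖ * gsQuotient s h f.1 p :=
        fun p => gsQuotient_smul s h f.2.1 c p
      simp only [this]
      exact (Real.mul_iSup_of_nonneg (norm_nonneg c) _).symm)

/-- The topology of `Σ_s(ℝ^d)`: the locally convex topology of the seminorms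
`‖·‖_{S_{s,h}}`, `h > 0`, i.e. the projective limit topology. -/
instance : TopologicalSpace (GSSpace s d) :=
  haveI : Nonempty {h : ℝ // 0 < h} := ⟨⟨1, one_pos⟩⟩
  (SeminormFamily.moduleFilterBasis (𝕜 := ℂ) (gsSeminorm s d)).topology

instance nonempty_pos : Nonempty {h : ℝ // 0 < h} := ⟨⟨1, one_pos⟩⟩

theorem withSeminorms (s : ℝ) (d : ℕ) :
    WithSeminorms (𝕜 := ℂ) (E := GSSpace s d) (gsSeminorm s d) := ⟨rfl⟩

instance : IsTopologicalAddGroup (GSSpace s d) := (withSeminorms s d).topologicalAddGroup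

instance : ContinuousSMul ℂ (GSSpace s d) := (withSeminorms s d).continuousSMul

end GSSpace

/-- The distribution space `Σ_s'(ℝ^d)`: continuous functionals on `Σ_s(ℝ^d)`, given by their
conjugate linear action `φ ↦ (u, φ)`. It is a complex vector space by `(c u, φ) = c (u, φ)` and
carries the strong dual topology (uniform convergence on bounded sets). -/
abbrev GSDual (s : ℝ) (d : ℕ) : Type := GSSpace s d →SL[starRingEnd ℂ] ℂ

/-! ### Auxiliary facts: the definition in terms of the norms of the full derivatives -/

theorem iteratedFDeriv_adjacent_swap {E F : Type*} [NormedAddCommGroup E] [NormedSpace ℝ E]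
    [NormedAddCommGroup F] [NormedSpace ℝ F] {f : E → F} (hf : ContDiff ℝ ∞ f) :
    ∀ (n : ℕ) (k : Fin n) (v : Fin (n + 1) → E) (x : E),
      iteratedFDeriv ℝ (n + 1) f x (v ∘ Equiv.swap k.castSucc k.succ) =
        iteratedFDeriv ℝ (n + 1) f x v := by
  have hd : ∀ n, Differentiable ℝ (iteratedFDeriv ℝ n f) := fun n =>
    hf.differentiable_iteratedFDeriv (by exact_mod_cast WithTop.coe_lt_top _)
  have hstep : ∀ (n : ℕ) (v : Fin (n + 1) → E) (x : E),
      iteratedFDeriv ℝ (n + 1) f x v =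
        fderiv ℝ (fun y => iteratedFDeriv ℝ n f y (Fin.tail v)) x (v 0) := by
    intro n v x
    rw [iteratedFDeriv_succ_apply_left,
      fderiv_continuousMultilinear_apply_const_apply (hd n x)]
  intro n
  induction n with
  | zero => intro k; exact k.elim0
  | succ n ih =>
    intro k v x
    rcases Fin.eq_zero_or_eq_succ k with rfl | ⟨j, rfl⟩
    · set w : Fin n → E := Fin.tail (Fin.tail v) with hw
      set g : E → F := fun y => iteratedFDeriv ℝ n f y w with hg
      have hgs : ContDiff ℝ ∞ g := by
        have h1 : ContDiff ℝ ∞ (iteratedFDeriv ℝ n f) :=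
          hf.iteratedFDeriv_right (by exact_mod_cast le_top)
        exact (ContinuousMultilinearMap.apply ℝ (fun _ : Fin n => E) F w).contDiff.comp h1
      have hsymm : IsSymmSndFDerivAt ℝ g x := by
        refine hgs.contDiffAt.isSymmSndFDerivAt ?_
        simp only [minSmoothness_of_isRCLikeNormedField]
        exact WithTop.coe_le_coe.2 (le_top : ((2 : ℕ) : ℕ∞) ≤ ⊤)
      have hdg : Differentiable ℝ (fderiv ℝ g) :=
        (hgs.fderiv_right (m := ∞) (by exact_mod_cast le_top)).differentiable (by simp)
      have two : ∀ u : Fin (n + 2) → E, Fin.tail (Fin.tail u) = w →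
          iteratedFDeriv ℝ (n + 2) f x u = fderiv ℝ (fderiv ℝ g) x (u 0) (u 1) := by
        intro u hu
        rw [hstep (n + 1) u x]
        have : (fun y => iteratedFDeriv ℝ (n + 1) f y (Fin.tail u)) =
            fun y => fderiv ℝ g y (u 1) := by
          funext y
          rw [hstep n _ y, hu]
          rfl
        rw [this, fderiv_clm_apply (hdg x) (differentiableAt_const _)]
        simp
      have hsw0 : Equiv.swap (0 : Fin (n + 1)).castSucc (0 : Fin (n + 1)).succ =
          Equiv.swap (0 : Fin (n + 2)) 1 := rfl
      rw [hsw0, two v rfl, two]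
      · simp only [Function.comp, Equiv.swap_apply_left, Equiv.swap_apply_right]
        exact hsymm _ _
      · funext i
        simp only [hw, Fin.tail, Function.comp]
        rw [Equiv.swap_apply_of_ne_of_ne]
        · exact Fin.succ_ne_zero _
        · intro h
          have := congrArg Fin.val h
          simp at this
    · rw [hstep (n + 1), hstep (n + 1)]
      have h0 : (v ∘ Equiv.swap j.succ.castSucc j.succ.succ) 0 = v 0 := by
        simp only [Function.comp]
        rw [Equiv.swap_apply_of_ne_of_ne]
        · intro h
          have := congrArg Fin.val h
          simp at this
        · exact (Fin.succ_ne_zero _).symm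
      have ht : Fin.tail (v ∘ Equiv.swap j.succ.castSucc j.succ.succ) =
          Fin.tail v ∘ Equiv.swap j.castSucc j.succ := by
        funext i
        simp only [Fin.tail, Function.comp]
        congr 1
        have : j.succ.castSucc = j.castSucc.succ := rfl
        rw [this, Equiv.swap_apply_def, Equiv.swap_apply_def]
        simp only [Fin.succ_inj]
        split_ifs <;> rfl
      rw [h0, ht]
      congr 2
      funext y
      exact ih j _ y

theorem iteratedFDeriv_comp_perm_of_smooth {E F : Type*} [NormedAddCommGroup E]
    [NormedSpace ℝ E] [NormedAddCommGroup F] [NormedSpace ℝ F] {f : E → F}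
    (hf : ContDiff ℝ ∞ f) (n : ℕ) (σ : Equiv.Perm (Fin n)) (v : Fin n → E) (x : E) :
    iteratedFDeriv ℝ n f x (v ∘ σ) = iteratedFDeriv ℝ n f x v := by
  cases n with
  | zero => congr 1; funext i; exact i.elim0
  | succ n =>
    have hσ : σ ∈ Submonoid.closure
        (Set.range fun i : Fin n => Equiv.swap i.castSucc i.succ) := by
      rw [Equiv.Perm.mclosure_swap_castSucc_succ]; trivial
    induction hσ using Submonoid.closure_induction generalizing v with
    | mem τ hτ =>
      obtain ⟨k, rfl⟩ := hτ
      exact iteratedFDeriv_adjacent_swap hf n k v x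
    | one => rfl
    | mul τ τ' _ _ h1 h2 =>
      have : v ∘ (τ * τ' : Equiv.Perm (Fin (n + 1))) = (v ∘ τ) ∘ τ' := rfl
      rw [this, h2, h1]

theorem iteratedFDeriv_comp_equiv_of_smooth {E F : Type*} [NormedAddCommGroup E]
    [NormedSpace ℝ E] [NormedAddCommGroup F] [NormedSpace ℝ F] {f : E → F}
    (hf : ContDiff ℝ ∞ f) {m n : ℕ} (hmn : m = n) (σ : Fin m ≃ Fin n) (v : Fin n → E) (x : E) :
    iteratedFDeriv ℝ m f x (v ∘ σ) = iteratedFDeriv ℝ n f x v := by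
  subst hmn
  exact iteratedFDeriv_comp_perm_of_smooth hf m σ v x

/-- Every iterated partial derivative is one of the `∂^β f`. -/
theorem exists_mixedPartial_eq {d : ℕ} {f : RSpace d → ℂ} (hf : ContDiff ℝ ∞ f) {m : ℕ}
    (J : Fin m → Fin d) (x : RSpace d) :
    ∃ β : Fin d → ℕ, ∑ i, β i = m ∧
      iteratedFDeriv ℝ m f x (fun k => EuclideanSpace.single (J k) (1 : ℝ)) =
        mixedPartial β f x := by
  classical
  let β : Fin d → ℕ := fun i => Fintype.card {k // J k = i}
  let e : Fin m ≃ (i : Fin d) × Fin (β i) :=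
    (Equiv.sigmaFiberEquiv J).symm.trans
      (Equiv.sigmaCongrRight fun i => Fintype.equivFin {k // J k = i})
  let σ : Fin m ≃ Fin (∑ i, β i) := e.trans finSigmaFinEquiv
  have hm : m = ∑ i, β i := by simpa using Fintype.card_congr σ
  refine ⟨β, hm.symm, ?_⟩
  rw [mixedPartial, ← iteratedFDeriv_comp_equiv_of_smooth hf hm σ]
  congr 1
  funext k
  simp only [Function.comp, σ, Equiv.trans_apply, Equiv.symm_apply_apply]
  rfl

theorem multiFactorial_le {d : ℕ} (β : Fin d → ℕ) :
    multiFactorial β ≤ (∑ i, β i).factorial :=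
  Nat.le_of_dvd (Nat.factorial_pos _) (Nat.prod_factorial_dvd_factorial_sum _ _)

theorem multiFactorial_pos {d : ℕ} (β : Fin d → ℕ) : 0 < multiFactorial β :=
  Finset.prod_pos fun _ _ => Nat.factorial_pos _

theorem factorial_le_multiFactorial {d : ℕ} (β : Fin d → ℕ) :
    (∑ i, β i).factorial ≤ d ^ (∑ i, β i) * multiFactorial β := by
  classical
  rw [← Nat.multinomial_spec, mul_comm]
  refine Nat.mul_le_mul_right _ ?_
  have h := Finset.sum_pow_eq_sum_piAntidiag (Finset.univ : Finset (Fin d))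
    (fun _ => (1 : ℕ)) (∑ i, β i)
  simp only [Finset.sum_const, Finset.card_univ, Fintype.card_fin, smul_eq_mul, mul_one,
    one_pow, Finset.prod_const_one, Nat.cast_id] at h
  rw [h]
  exact Finset.single_le_sum (f := fun k => Nat.multinomial Finset.univ k)
    (fun _ _ => Nat.zero_le _) (by simp)

theorem norm_iteratedFDeriv_le_of_basis {d m : ℕ} {f : RSpace d → ℂ} {x : RSpace d} {M : ℝ}
    (hM : 0 ≤ M)
    (h : ∀ J : Fin m → Fin d,
      ‖iteratedFDeriv ℝ m f x (fun k => EuclideanSpace.single (J k) (1 : ℝ))‖ ≤ M) :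
    ‖iteratedFDeriv ℝ m f x‖ ≤ (d : ℝ) ^ m * M := by
  classical
  refine ContinuousMultilinearMap.opNorm_le_bound (by positivity) fun v => ?_
  have hv : v = fun k => ∑ j, v k j • EuclideanSpace.single j (1 : ℝ) := by
    funext k
    have := (EuclideanSpace.basisFun (Fin d) ℝ).sum_repr (v k)
    simpa using this.symm
  conv_lhs => rw [hv]
  rw [ContinuousMultilinearMap.map_sum]
  refine (norm_sum_le _ _).trans ?_
  have : ∀ J ∈ (Finset.univ : Finset (Fin m → Fin d)),
      ‖iteratedFDeriv ℝ m f x (fun k => v k (J k) • EuclideanSpace.single (J k) (1 : ℝ))‖ ≤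
        (∏ k, ‖v k‖) * M := by
    intro J _
    rw [ContinuousMultilinearMap.map_smul_univ, norm_smul, norm_prod]
    gcongr with k
    · exact PiLp.norm_apply_le _ _
    · exact h J
  refine (Finset.sum_le_sum this).trans ?_
  simp only [Finset.sum_const, Finset.card_univ, Fintype.card_pi, Fintype.card_fin,
    Finset.prod_const, nsmul_eq_mul]
  push_cast
  exact le_of_eq (by ring)

/-- Bounds on the norms of all derivatives that characterize `Σ_s`. -/
def GSBound {d : ℕ} (s : ℝ) (f : RSpace d → ℂ) : Prop :=
  ∀ h : ℝ, 0 < h → ∃ C : ℝ, 0 ≤ C ∧ ∀ (n m : ℕ) (x : RSpace d),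
    ‖x‖ ^ n * ‖iteratedFDeriv ℝ m f x‖ ≤
      C * (h ^ n * (n.factorial : ℝ) ^ s * (h ^ m * (m.factorial : ℝ) ^ s))

theorem IsGS.bound {d : ℕ} {s : ℝ} (hs : 0 ≤ s) {f : RSpace d → ℂ} (hf : IsGS s f) :
    GSBound s f := by
  intro h hh
  have hd1 : (0 : ℝ) < (d : ℝ) + 1 := by positivity
  set r : ℝ := h / ((d : ℝ) + 1) with hr
  have hr0 : 0 < r := by positivity
  obtain ⟨C, hC⟩ := hf.2 r hr0
  have hC0 : 0 ≤ max C 0 := le_max_right _ _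
  have hterm : ∀ (α β : Fin d → ℕ) (x : RSpace d),
      |∏ i, x i ^ α i| * ‖mixedPartial β f x‖ ≤
        max C 0 * (r ^ (∑ i, α i) * ((multiFactorial α : ℝ)) ^ s *
          (r ^ (∑ i, β i) * ((∑ i, β i).factorial : ℝ) ^ s)) := by
    intro α β x
    have h1 : gsQuotient s r f (α, β, x) ≤ max C 0 := (hC ⟨_, rfl⟩).trans (le_max_left _ _)
    rw [gsQuotient, div_le_iff₀ (gsDen_pos s hr0 _ _)] at h1
    refine h1.trans ?_
    rw [pow_add]
    have h2 : ((multiFactorial β : ℝ)) ^ s ≤ ((∑ i, β i).factorial : ℝ) ^ s :=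
      Real.rpow_le_rpow (by positivity) (by exact_mod_cast multiFactorial_le β) hs
    calc _ = max C 0 * (r ^ (∑ i, α i) * ((multiFactorial α : ℝ)) ^ s *
          (r ^ (∑ i, β i) * (multiFactorial β : ℝ) ^ s)) := by ring
      _ ≤ _ := by gcongr
  refine ⟨max C 0, hC0, fun n m x => ?_⟩
  -- the coordinate of largest modulus
  have hx : ∃ α : Fin d → ℕ, ∑ i, α i = n ∧ multiFactorial α ≤ n.factorial ∧
      ‖x‖ ^ n ≤ ((d : ℝ) + 1) ^ n * |∏ i, x i ^ α i| ∨ ‖x‖ ^ n = 0 := by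
    classical
    rcases Nat.eq_zero_or_pos d with hd | hd
    · subst hd
      rcases Nat.eq_zero_or_pos n with hn | hn
      · subst hn
        exact ⟨0, Or.inl ⟨by simp, by simp [multiFactorial], by simp⟩⟩
      · refine ⟨0, Or.inr ?_⟩
        have : x = 0 := Subsingleton.elim _ _
        simp [this, hn.ne']
    · obtain ⟨i, -, hi⟩ := Finset.exists_max_image (Finset.univ : Finset (Fin d))
        (fun j => |x j|) ⟨⟨0, hd⟩, Finset.mem_univ _⟩
      refine ⟨Pi.single i n, Or.inl ⟨by simp, ?_, ?_⟩⟩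
      · refine (multiFactorial_le _).trans ?_
        simp
      · have hprod : ∏ j, x j ^ (Pi.single i n : Fin d → ℕ) j = x i ^ n := by
          rw [Finset.prod_eq_single i]
          · simp
          · intro j _ hj; simp [hj]
          · simp
        rw [hprod, abs_pow, ← mul_pow]
        refine pow_le_pow_left₀ (norm_nonneg _) ?_ n
        have hx1 : ‖x‖ ≤ ∑ j, |x j| := by
          have := (EuclideanSpace.basisFun (Fin d) ℝ).sum_repr x
          calc ‖x‖ = ‖∑ j, x j • EuclideanSpace.single j (1 : ℝ)‖ := by
                conv_lhs => rw [← this]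
                simp
            _ ≤ ∑ j, ‖x j • EuclideanSpace.single j (1 : ℝ)‖ := norm_sum_le _ _
            _ = _ := by simp [norm_smul]
        refine hx1.trans ?_
        calc ∑ j, |x j| ≤ ∑ _j : Fin d, |x i| := Finset.sum_le_sum fun j hj => hi j hj
          _ = d * |x i| := by simp
          _ ≤ _ := by gcongr; linarith
  obtain ⟨α, hα | hα⟩ := hx
  swap
  · rw [hα, zero_mul]; positivity
  obtain ⟨hα1, hα2, hα3⟩ := hα
  have hD : |∏ i, x i ^ α i| * ‖iteratedFDeriv ℝ m f x‖ ≤ ((d : ℝ) + 1) ^ m *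
      (max C 0 * (r ^ n * (n.factorial : ℝ) ^ s * (r ^ m * (m.factorial : ℝ) ^ s))) := by
    have hfac : ((multiFactorial α : ℝ)) ^ s ≤ (n.factorial : ℝ) ^ s :=
      Real.rpow_le_rpow (by positivity) (by exact_mod_cast hα2) hs
    have hJ : ∀ J : Fin m → Fin d, |∏ i, x i ^ α i| *
        ‖iteratedFDeriv ℝ m f x (fun k => EuclideanSpace.single (J k) (1 : ℝ))‖ ≤
        max C 0 * (r ^ n * (n.factorial : ℝ) ^ s * (r ^ m * (m.factorial : ℝ) ^ s)) := by
      intro J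
      obtain ⟨β, hβ, hβ'⟩ := exists_mixedPartial_eq hf.1 J x
      rw [hβ']
      refine (hterm α β x).trans ?_
      rw [hβ, hα1]
      gcongr
    rcases (abs_nonneg (∏ i, x i ^ α i)).eq_or_lt with h0 | h0
    · rw [← h0, zero_mul]; positivity
    · have hb := norm_iteratedFDeriv_le_of_basis (f := f) (x := x) (m := m)
        (M := max C 0 * (r ^ n * (n.factorial : ℝ) ^ s * (r ^ m * (m.factorial : ℝ) ^ s)) /
          |∏ i, x i ^ α i|) (by positivity)
        (fun J => by rw [le_div_iff₀ h0, mul_comm]; exact hJ J)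
      have hb2 : ‖iteratedFDeriv ℝ m f x‖ * |∏ i, x i ^ α i| ≤ (d : ℝ) ^ m *
          (max C 0 * (r ^ n * (n.factorial : ℝ) ^ s * (r ^ m * (m.factorial : ℝ) ^ s))) := by
        rw [← le_div_iff₀ h0, ← mul_div_assoc']
        exact hb
      rw [mul_comm]
      refine hb2.trans ?_
      gcongr
      linarith
  calc ‖x‖ ^ n * ‖iteratedFDeriv ℝ m f x‖
      ≤ ((d : ℝ) + 1) ^ n * |∏ i, x i ^ α i| * ‖iteratedFDeriv ℝ m f x‖ := by gcongr
    _ = ((d : ℝ) + 1) ^ n * (|∏ i, x i ^ α i| * ‖iteratedFDeriv ℝ m f x‖) := by ring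
    _ ≤ ((d : ℝ) + 1) ^ n * (((d : ℝ) + 1) ^ m *
      (max C 0 * (r ^ n * (n.factorial : ℝ) ^ s * (r ^ m * (m.factorial : ℝ) ^ s)))) := by gcongr
    _ = max C 0 * ((((d : ℝ) + 1) * r) ^ n * (n.factorial : ℝ) ^ s *
          ((((d : ℝ) + 1) * r) ^ m * (m.factorial : ℝ) ^ s)) := by
        rw [mul_pow, mul_pow]; ring
    _ = _ := by
        have : ((d : ℝ) + 1) * r = h := by rw [hr]; field_simp
        rw [this]

theorem IsGS.of_bound {d : ℕ} {s : ℝ} (hs : 0 ≤ s) {f : RSpace d → ℂ} (hf : ContDiff ℝ ∞ f)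
    (hb : GSBound s f) : IsGS s f := by
  refine ⟨hf, fun h hh => ?_⟩
  set D : ℝ := ((d : ℝ) + 1) ^ s with hD
  have hD0 : 0 < D := by positivity
  obtain ⟨C, hC0, hC⟩ := hb (h / D) (by positivity)
  refine ⟨C, ?_⟩
  rintro _ ⟨⟨α, β, x⟩, rfl⟩
  rw [gsQuotient, div_le_iff₀ (gsDen_pos s hh _ _)]
  dsimp only
  have hfac : ∀ γ : Fin d → ℕ,
      ((∑ i, γ i).factorial : ℝ) ^ s ≤ D ^ (∑ i, γ i) * (multiFactorial γ : ℝ) ^ s := by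
    intro γ
    have h1 : ((∑ i, γ i).factorial : ℝ) ≤
        ((d : ℝ) + 1) ^ (∑ i, γ i) * (multiFactorial γ : ℝ) := by
      calc ((∑ i, γ i).factorial : ℝ) ≤ (d : ℝ) ^ (∑ i, γ i) * (multiFactorial γ : ℝ) := by
            exact_mod_cast factorial_le_multiFactorial γ
        _ ≤ _ := by gcongr; linarith
    calc ((∑ i, γ i).factorial : ℝ) ^ s
        ≤ (((d : ℝ) + 1) ^ (∑ i, γ i) * (multiFactorial γ : ℝ)) ^ s :=
          Real.rpow_le_rpow (by positivity) h1 hs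
      _ = _ := by
          rw [Real.mul_rpow (by positivity) (by positivity), hD,
            Real.rpow_pow_comm (by positivity)]
  have hx : |∏ i, x i ^ α i| ≤ ‖x‖ ^ (∑ i, α i) := by
    rw [Finset.abs_prod, ← Finset.prod_pow_eq_pow_sum]
    refine Finset.prod_le_prod (fun _ _ => abs_nonneg _) fun i _ => ?_
    rw [abs_pow]
    exact pow_le_pow_left₀ (abs_nonneg _) (PiLp.norm_apply_le x i) _
  have hp : ‖mixedPartial β f x‖ ≤ ‖iteratedFDeriv ℝ (∑ i, β i) f x‖ := by
    refine (ContinuousMultilinearMap.le_opNorm _ _).trans ?_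
    simp
  have hpow : ∀ k : ℕ, (h / D) ^ k * D ^ k = h ^ k := fun k => by
    rw [← mul_pow, div_mul_cancel₀ _ hD0.ne']
  calc |∏ i, x i ^ α i| * ‖mixedPartial β f x‖
      ≤ ‖x‖ ^ (∑ i, α i) * ‖iteratedFDeriv ℝ (∑ i, β i) f x‖ := by gcongr
    _ ≤ C * ((h / D) ^ (∑ i, α i) * ((∑ i, α i).factorial : ℝ) ^ s *
          ((h / D) ^ (∑ i, β i) * ((∑ i, β i).factorial : ℝ) ^ s)) := hC _ _ _
    _ ≤ C * ((h / D) ^ (∑ i, α i) * (D ^ (∑ i, α i) * (multiFactorial α : ℝ) ^ s) *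
          ((h / D) ^ (∑ i, β i) * (D ^ (∑ i, β i) * (multiFactorial β : ℝ) ^ s))) := by
        gcongr
        · exact hfac α
        · exact hfac β
    _ = C * (((h / D) ^ (∑ i, α i) * D ^ (∑ i, α i)) * (multiFactorial α : ℝ) ^ s *
          (((h / D) ^ (∑ i, β i) * D ^ (∑ i, β i)) * (multiFactorial β : ℝ) ^ s)) := by ring
    _ = C * (h ^ (∑ i, α i + ∑ i, β i) *
          ((multiFactorial α : ℝ) ^ s * (multiFactorial β : ℝ) ^ s)) := by
        rw [hpow, hpow, pow_add]; ring

/-- The binomial convolution of two sequences of Gelfand--Shilov growth has the same growth. -/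
theorem sum_choose_mul_le {s : ℝ} (hs : 0 ≤ s) {h A B : ℝ} (hh : 0 < h) (hA : 0 ≤ A)
    (hB : 0 ≤ B) {a b : ℕ → ℝ} (hb0 : ∀ k, 0 ≤ b k)
    (ha : ∀ k, a k ≤ A * (h ^ k * (k.factorial : ℝ) ^ s))
    (hb : ∀ k, b k ≤ B * (h ^ k * (k.factorial : ℝ) ^ s)) (n : ℕ) :
    ∑ k ∈ Finset.range (n + 1), (n.choose k : ℝ) * a k * b (n - k) ≤
      A * B * ((2 * h) ^ n * (n.factorial : ℝ) ^ s) := by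
  have hterm : ∀ k ∈ Finset.range (n + 1), (n.choose k : ℝ) * a k * b (n - k) ≤
      (n.choose k : ℝ) * (A * B * (h ^ n * (n.factorial : ℝ) ^ s)) := by
    intro k hk
    have hkn : k ≤ n := Nat.lt_succ_iff.1 (Finset.mem_range.1 hk)
    have hf : (k.factorial : ℝ) ^ s * ((n - k).factorial : ℝ) ^ s ≤ (n.factorial : ℝ) ^ s := by
      rw [← Real.mul_rpow (by positivity) (by positivity)]
      refine Real.rpow_le_rpow (by positivity) ?_ hs
      exact_mod_cast Nat.le_of_dvd (Nat.factorial_pos _)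
        (Nat.factorial_mul_factorial_dvd_factorial hkn)
    rw [mul_assoc]
    refine mul_le_mul_of_nonneg_left ?_ (by positivity)
    calc a k * b (n - k) ≤ (A * (h ^ k * (k.factorial : ℝ) ^ s)) *
          (B * (h ^ (n - k) * ((n - k).factorial : ℝ) ^ s)) :=
          mul_le_mul (ha k) (hb _) (hb0 _) (by positivity)
      _ = A * B * ((h ^ k * h ^ (n - k)) *
          ((k.factorial : ℝ) ^ s * ((n - k).factorial : ℝ) ^ s)) := by ring
      _ ≤ _ := by
          rw [← pow_add, Nat.add_sub_cancel' hkn]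
          gcongr
  refine (Finset.sum_le_sum hterm).trans (le_of_eq ?_)
  rw [← Finset.sum_mul, ← Nat.cast_sum, Nat.sum_range_choose]
  push_cast
  rw [mul_pow]
  ring

theorem exists_pow_le_factorial {s : ℝ} (hs : 0 < s) {h : ℝ} (hh : 0 < h) {R : ℝ}
    (hR : 0 ≤ R) : ∃ C : ℝ, 0 ≤ C ∧ ∀ k : ℕ, R ^ k ≤ C * (h ^ k * (k.factorial : ℝ) ^ s) := by
  set t : ℝ := (R / h) ^ s⁻¹ with ht
  have ht0 : 0 ≤ t := by positivity
  refine ⟨Real.exp t ^ s, by positivity, fun k => ?_⟩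
  have h1 : t ^ k / (k.factorial : ℝ) ≤ Real.exp t := Real.pow_div_factorial_le_exp t ht0 k
  have hk : (0 : ℝ) < k.factorial := by exact_mod_cast Nat.factorial_pos k
  rw [div_le_iff₀ hk] at h1
  have h2 := Real.rpow_le_rpow (by positivity) h1 hs.le
  rw [Real.mul_rpow (by positivity) hk.le, ← Real.rpow_pow_comm ht0, ht,
    ← Real.rpow_mul (by positivity), inv_mul_cancel₀ hs.ne', Real.rpow_one, div_pow,
    div_le_iff₀ (by positivity)] at h2
  linarith

theorem norm_add_pow_le {E : Type*} [NormedAddCommGroup E] (x y : E) (n : ℕ) :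
    ‖x + y‖ ^ n ≤ ∑ k ∈ Finset.range (n + 1), (n.choose k : ℝ) * ‖x‖ ^ k * ‖y‖ ^ (n - k) := by
  calc ‖x + y‖ ^ n ≤ (‖x‖ + ‖y‖) ^ n := pow_le_pow_left₀ (norm_nonneg _) (norm_add_le x y) n
    _ = _ := by
      rw [add_pow]
      exact Finset.sum_congr rfl fun k _ => by ring

theorem IsGS.translate {d : ℕ} {s : ℝ} (hs : 0 < s) {f : RSpace d → ℂ} (hf : IsGS s f)
    (a : RSpace d) : IsGS s (fun y => f (y - a)) := by
  refine IsGS.of_bound hs.le (hf.1.comp (contDiff_id.sub contDiff_const)) fun h hh => ?_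
  obtain ⟨C, hC0, hC⟩ := hf.bound hs.le (h / 2) (by positivity)
  obtain ⟨B, hB0, hB⟩ := exists_pow_le_factorial hs (half_pos hh) (norm_nonneg a)
  refine ⟨C * B, by positivity, fun n m x => ?_⟩
  rw [iteratedFDeriv_comp_sub]
  have h1 := norm_add_pow_le (x - a) a n
  rw [sub_add_cancel] at h1
  have h2 := sum_choose_mul_le hs.le (half_pos hh)
    (A := C * ((h / 2) ^ m * (m.factorial : ℝ) ^ s)) (B := B)
    (a := fun k => ‖x - a‖ ^ k * ‖iteratedFDeriv ℝ m f (x - a)‖) (b := fun k => ‖a‖ ^ k)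
    (by positivity) hB0 (fun k => by positivity)
    (fun k => (hC k m (x - a)).trans (le_of_eq (by ring))) hB n
  calc ‖x‖ ^ n * ‖iteratedFDeriv ℝ m f (x - a)‖
      ≤ _ := mul_le_mul_of_nonneg_right h1 (norm_nonneg _)
    _ = ∑ k ∈ Finset.range (n + 1), (n.choose k : ℝ) *
          (‖x - a‖ ^ k * ‖iteratedFDeriv ℝ m f (x - a)‖) * ‖a‖ ^ (n - k) := by
        rw [Finset.sum_mul]
        exact Finset.sum_congr rfl fun k _ => by ring
    _ ≤ _ := h2
    _ = (C * B) * ((2 * (h / 2)) ^ n * (n.factorial : ℝ) ^ s *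
          ((h / 2) ^ m * (m.factorial : ℝ) ^ s)) := by ring
    _ ≤ _ := by
        have e1 : 2 * (h / 2) = h := by ring
        rw [e1]
        gcongr
        linarith

theorem norm_iteratedFDeriv_character_le {E : Type*} [NormedAddCommGroup E]
    [InnerProductSpace ℝ E] (ξ : E) (k : ℕ) (x : E) :
    ‖iteratedFDeriv ℝ k (fun y : E => Complex.exp (Complex.I * (inner ℝ y ξ : ℝ))) x‖ ≤
      ‖ξ‖ ^ k := by
  have hsm : ContDiff ℝ ∞ (fun t : ℝ => Complex.exp (Complex.I * (t : ℂ))) :=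
    (contDiff_const.mul Complex.ofRealCLM.contDiff).cexp
  have hit : ∀ n : ℕ, iteratedDeriv n (fun t : ℝ => Complex.exp (Complex.I * (t : ℂ))) =
      fun t : ℝ => Complex.I ^ n * Complex.exp (Complex.I * (t : ℂ)) := by
    intro n
    induction n with
    | zero => funext t; simp
    | succ n ih =>
      rw [iteratedDeriv_succ, ih]
      funext t
      have h1 : HasDerivAt (fun t : ℝ => Complex.I * (t : ℂ)) (Complex.I * 1) t :=
        (Complex.ofRealCLM.hasDerivAt (x := t)).const_mul _
      have h2 := (h1.cexp.const_mul (Complex.I ^ n)).deriv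
      rw [h2]
      ring
  have hE : (fun y : E => Complex.exp (Complex.I * (inner ℝ y ξ : ℝ))) =
      (fun t : ℝ => Complex.exp (Complex.I * (t : ℂ))) ∘ (innerSL ℝ ξ) := by
    funext y
    simp [real_inner_comm]
  rw [hE, ContinuousLinearMap.iteratedFDeriv_comp_right _ hsm _ (i := k)
    (by exact_mod_cast le_top)]
  refine (ContinuousMultilinearMap.norm_compContinuousLinearMap_le _ _).trans ?_
  rw [norm_iteratedFDeriv_eq_norm_iteratedDeriv, hit]
  simp [Complex.norm_exp]

theorem IsGS.modulate {d : ℕ} {s : ℝ} (hs : 0 < s) {f : RSpace d → ℂ} (hf : IsGS s f)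
    (ξ : RSpace d) :
    IsGS s (fun y => Complex.exp (Complex.I * (inner ℝ y ξ : ℝ)) * f y) := by
  have hsm : ContDiff ℝ ∞
      (fun y : RSpace d => Complex.exp (Complex.I * (inner ℝ y ξ : ℝ))) := by
    have : ContDiff ℝ ∞ (fun y : RSpace d => ((inner ℝ y ξ : ℝ) : ℂ)) :=
      Complex.ofRealCLM.contDiff.comp (contDiff_id.inner ℝ contDiff_const)
    exact (contDiff_const.mul this).cexp
  refine IsGS.of_bound hs.le (hsm.mul hf.1) fun h hh => ?_
  obtain ⟨C, hC0, hC⟩ := hf.bound hs.le (h / 2) (by positivity)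
  obtain ⟨B, hB0, hB⟩ := exists_pow_le_factorial hs (half_pos hh) (norm_nonneg ξ)
  refine ⟨B * C, by positivity, fun n m x => ?_⟩
  have h1 := norm_iteratedFDeriv_mul_le hsm hf.1 x (n := m) (by exact_mod_cast le_top)
  have h2 := sum_choose_mul_le hs.le (half_pos hh) (A := B)
    (B := C * ((h / 2) ^ n * (n.factorial : ℝ) ^ s))
    (a := fun k => ‖ξ‖ ^ k) (b := fun k => ‖x‖ ^ n * ‖iteratedFDeriv ℝ k f x‖)
    hB0 (by positivity) (fun k => by positivity) hB
    (fun k => (hC n k x).trans (le_of_eq (by ring))) m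
  calc _ ≤ ‖x‖ ^ n * _ := mul_le_mul_of_nonneg_left h1 (by positivity)
    _ ≤ ‖x‖ ^ n * ∑ k ∈ Finset.range (m + 1), (m.choose k : ℝ) * ‖ξ‖ ^ k *
          ‖iteratedFDeriv ℝ (m - k) f x‖ := by
        gcongr with k _
        exact norm_iteratedFDeriv_character_le ξ k x
    _ = ∑ k ∈ Finset.range (m + 1), (m.choose k : ℝ) * ‖ξ‖ ^ k *
          (‖x‖ ^ n * ‖iteratedFDeriv ℝ (m - k) f x‖) := by
        rw [Finset.mul_sum]
        exact Finset.sum_congr rfl fun k _ => by ring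
    _ ≤ _ := h2
    _ = (B * C) * ((h / 2) ^ n * (n.factorial : ℝ) ^ s *
          ((2 * (h / 2)) ^ m * (m.factorial : ℝ) ^ s)) := by ring
    _ ≤ _ := by
        have e1 : 2 * (h / 2) = h := by ring
        rw [e1]
        gcongr
        linarith

theorem IsGS.conj {d : ℕ} {s : ℝ} (hs : 0 ≤ s) {f : RSpace d → ℂ} (hf : IsGS s f) :
    IsGS s (fun y => starRingEnd ℂ (f y)) := by
  have hE : (fun y => starRingEnd ℂ (f y)) = Complex.conjLIE ∘ f := rfl
  rw [hE]
  refine IsGS.of_bound hs (Complex.conjLIE.contDiff.comp hf.1) fun h hh => ?_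
  obtain ⟨C, hC0, hC⟩ := hf.bound hs h hh
  refine ⟨C, hC0, fun n m x => ?_⟩
  rw [LinearIsometryEquiv.norm_iteratedFDeriv_comp_left]
  exact hC n m x

/-- The projection `ℝ^{m+n} → ℝ^m` onto the first `m` coordinates. -/
def projFst (m n : ℕ) : RSpace (m + n) →L[ℝ] RSpace m :=
  LinearMap.toContinuousLinearMap
    { toFun := fun z => WithLp.toLp 2 (fun i => z (Fin.castAdd n i))
      map_add' := fun _ _ => rfl
      map_smul' := fun _ _ => rfl }

/-- The projection `ℝ^{m+n} → ℝ^n` onto the last `n` coordinates. -/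
def projSnd (m n : ℕ) : RSpace (m + n) →L[ℝ] RSpace n :=
  LinearMap.toContinuousLinearMap
    { toFun := fun z => WithLp.toLp 2 (fun i => z (Fin.natAdd m i))
      map_add' := fun _ _ => rfl
      map_smul' := fun _ _ => rfl }

/-- The point `(x, y) ∈ ℝ^{m+n}` with `x ∈ ℝ^m` and `y ∈ ℝ^n`. -/
def joinPt {m n : ℕ} (x : RSpace m) (y : RSpace n) : RSpace (m + n) :=
  WithLp.toLp 2 (Fin.append x y)

theorem projFst_joinPt {m n : ℕ} (x : RSpace m) (y : RSpace n) :
    projFst m n (joinPt x y) = x := by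
  ext i
  change Fin.append x y (Fin.castAdd n i) = x i
  simp

theorem projSnd_joinPt {m n : ℕ} (x : RSpace m) (y : RSpace n) :
    projSnd m n (joinPt x y) = y := by
  ext i
  change Fin.append x y (Fin.natAdd m i) = y i
  simp

theorem norm_sq_proj (m n : ℕ) (z : RSpace (m + n)) :
    ‖z‖ ^ 2 = ‖projFst m n z‖ ^ 2 + ‖projSnd m n z‖ ^ 2 := by
  simp only [EuclideanSpace.norm_sq_eq, Fin.sum_univ_add]
  rfl

theorem IsGS.tensor {m n : ℕ} {s : ℝ} (hs : 0 ≤ s) {g : RSpace m → ℂ} {f : RSpace n → ℂ}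
    (hg : IsGS s g) (hf : IsGS s f) :
    IsGS s (fun z : RSpace (m + n) => g (projFst m n z) * f (projSnd m n z)) := by
  have hP : ∀ z, ‖projFst m n z‖ ≤ 1 * ‖z‖ := fun z => by
    have := norm_sq_proj m n z
    rw [one_mul]
    exact abs_le_of_sq_le_sq' (by nlinarith [sq_nonneg ‖projSnd m n z‖]) (norm_nonneg _) |>.2
  have hQ : ∀ z, ‖projSnd m n z‖ ≤ 1 * ‖z‖ := fun z => by
    have := norm_sq_proj m n z
    rw [one_mul]
    exact abs_le_of_sq_le_sq' (by nlinarith [sq_nonneg ‖projFst m n z‖]) (norm_nonneg _) |>.2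
  have hP1 := ContinuousLinearMap.opNorm_le_bound _ zero_le_one hP
  have hQ1 := ContinuousLinearMap.opNorm_le_bound _ zero_le_one hQ
  have hPQ : ∀ z, ‖z‖ ≤ ‖projFst m n z‖ + ‖projSnd m n z‖ := fun z => by
    have := norm_sq_proj m n z
    have h1 := norm_nonneg (projFst m n z)
    have h2 := norm_nonneg (projSnd m n z)
    exact abs_le_of_sq_le_sq' (by nlinarith) (by positivity) |>.2
  have hg1 : ContDiff ℝ ∞ (g ∘ projFst m n) := hg.1.comp (projFst m n).contDiff
  have hf1 : ContDiff ℝ ∞ (f ∘ projSnd m n) := hf.1.comp (projSnd m n).contDiff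
  have hDg : ∀ (k : ℕ) z, ‖iteratedFDeriv ℝ k (g ∘ projFst m n) z‖ ≤
      ‖iteratedFDeriv ℝ k g (projFst m n z)‖ := fun k z => by
    rw [ContinuousLinearMap.iteratedFDeriv_comp_right _ hg.1 _ (i := k)
      (by exact_mod_cast le_top)]
    refine (ContinuousMultilinearMap.norm_compContinuousLinearMap_le _ _).trans ?_
    refine mul_le_of_le_one_right (norm_nonneg _) ?_
    exact Finset.prod_le_one (fun _ _ => norm_nonneg _) fun _ _ => hP1
  have hDf : ∀ (k : ℕ) z, ‖iteratedFDeriv ℝ k (f ∘ projSnd m n) z‖ ≤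
      ‖iteratedFDeriv ℝ k f (projSnd m n z)‖ := fun k z => by
    rw [ContinuousLinearMap.iteratedFDeriv_comp_right _ hf.1 _ (i := k)
      (by exact_mod_cast le_top)]
    refine (ContinuousMultilinearMap.norm_compContinuousLinearMap_le _ _).trans ?_
    refine mul_le_of_le_one_right (norm_nonneg _) ?_
    exact Finset.prod_le_one (fun _ _ => norm_nonneg _) fun _ _ => hQ1
  refine IsGS.of_bound hs (hg1.mul hf1) fun h hh => ?_
  obtain ⟨A, hA0, hA⟩ := hg.bound hs (h / 2) (by positivity)
  obtain ⟨B, hB0, hB⟩ := hf.bound hs (h / 2) (by positivity)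
  refine ⟨A * B, by positivity, fun N M z => ?_⟩
  set p := ‖projFst m n z‖ with hp
  set q := ‖projSnd m n z‖ with hq
  have h1 := norm_iteratedFDeriv_mul_le hg1 hf1 z (n := M) (by exact_mod_cast le_top)
  -- for a fixed splitting of the power of the norm, sum over the splittings of the derivative
  have h2 : ∀ j ∈ Finset.range (N + 1),
      p ^ j * q ^ (N - j) * ‖iteratedFDeriv ℝ M
        (fun z : RSpace (m + n) => g (projFst m n z) * f (projSnd m n z)) z‖ ≤
      A * B * (h ^ M * (M.factorial : ℝ) ^ s) * ((h / 2) ^ N * (N.factorial : ℝ) ^ s) := by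
    intro j hj
    have hjN : j ≤ N := Nat.lt_succ_iff.1 (Finset.mem_range.1 hj)
    have hfac : (j.factorial : ℝ) ^ s * ((N - j).factorial : ℝ) ^ s ≤
        (N.factorial : ℝ) ^ s := by
      rw [← Real.mul_rpow (by positivity) (by positivity)]
      refine Real.rpow_le_rpow (by positivity) ?_ hs
      exact_mod_cast Nat.le_of_dvd (Nat.factorial_pos _)
        (Nat.factorial_mul_factorial_dvd_factorial hjN)
    have h3 := sum_choose_mul_le hs (half_pos hh)
      (A := A * ((h / 2) ^ j * (j.factorial : ℝ) ^ s))
      (B := B * ((h / 2) ^ (N - j) * ((N - j).factorial : ℝ) ^ s))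
      (a := fun k => p ^ j * ‖iteratedFDeriv ℝ k g (projFst m n z)‖)
      (b := fun k => q ^ (N - j) * ‖iteratedFDeriv ℝ k f (projSnd m n z)‖)
      (by positivity) (by positivity) (fun k => by positivity)
      (fun k => (hA j k _).trans (le_of_eq (by ring)))
      (fun k => (hB (N - j) k _).trans (le_of_eq (by ring))) M
    calc _ ≤ p ^ j * q ^ (N - j) * ∑ k ∈ Finset.range (M + 1), (M.choose k : ℝ) *
            ‖iteratedFDeriv ℝ k g (projFst m n z)‖ *
            ‖iteratedFDeriv ℝ (M - k) f (projSnd m n z)‖ := by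
          refine mul_le_mul_of_nonneg_left (h1.trans ?_) (by positivity)
          refine Finset.sum_le_sum fun k _ => ?_
          have e1 := hDg k z
          have e2 := hDf (M - k) z
          gcongr
      _ = ∑ k ∈ Finset.range (M + 1), (M.choose k : ℝ) *
            (p ^ j * ‖iteratedFDeriv ℝ k g (projFst m n z)‖) *
            (q ^ (N - j) * ‖iteratedFDeriv ℝ (M - k) f (projSnd m n z)‖) := by
          rw [Finset.mul_sum]
          exact Finset.sum_congr rfl fun k _ => by ring
      _ ≤ _ := h3
      _ = A * B * ((2 * (h / 2)) ^ M * (M.factorial : ℝ) ^ s) *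
            (((h / 2) ^ j * (h / 2) ^ (N - j)) *
              ((j.factorial : ℝ) ^ s * ((N - j).factorial : ℝ) ^ s)) := by ring
      _ ≤ _ := by
          have e1 : 2 * (h / 2) = h := by ring
          rw [e1, ← pow_add, Nat.add_sub_cancel' hjN]
          gcongr
  calc _ ≤ (p + q) ^ N * ‖iteratedFDeriv ℝ M
        (fun z : RSpace (m + n) => g (projFst m n z) * f (projSnd m n z)) z‖ :=
        mul_le_mul_of_nonneg_right (pow_le_pow_left₀ (norm_nonneg _) (hPQ z) N)
          (norm_nonneg _)
    _ = ∑ j ∈ Finset.range (N + 1), (N.choose j : ℝ) * (p ^ j * q ^ (N - j) *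
        ‖iteratedFDeriv ℝ M
          (fun z : RSpace (m + n) => g (projFst m n z) * f (projSnd m n z)) z‖) := by
        rw [add_pow, Finset.sum_mul]
        exact Finset.sum_congr rfl fun k _ => by ring
    _ ≤ ∑ j ∈ Finset.range (N + 1), (N.choose j : ℝ) *
        (A * B * (h ^ M * (M.factorial : ℝ) ^ s) * ((h / 2) ^ N * (N.factorial : ℝ) ^ s)) :=
        Finset.sum_le_sum fun j hj => mul_le_mul_of_nonneg_left (h2 j hj) (by positivity)
    _ = A * B * ((2 * (h / 2)) ^ N * (N.factorial : ℝ) ^ s *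
        (h ^ M * (M.factorial : ℝ) ^ s)) := by
        rw [← Finset.sum_mul, ← Nat.cast_sum, Nat.sum_range_choose]
        push_cast
        rw [mul_pow]
        ring
    _ = _ := by
        have e1 : 2 * (h / 2) = h := by ring
        rw [e1]

/-! ### Operations on `Σ_s` -/

namespace GSSpace

variable {s : ℝ} {d : ℕ}

/-- Translation `T_x f(y) = f(y - x)`. -/
def translate (hs : 1 / 2 < s) (x : RSpace d) (f : GSSpace s d) : GSSpace s d :=
  ⟨fun y => f (y - x), IsGS.translate (by linarith) f.2 x⟩

/-- Modulation `M_ξ f(y) = e^{i⟨y, ξ⟩} f(y)`. -/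
def modulate (hs : 1 / 2 < s) (ξ : RSpace d) (f : GSSpace s d) : GSSpace s d :=
  ⟨fun y => Complex.exp (Complex.I * (inner ℝ y ξ : ℝ)) * f y,
    IsGS.modulate (by linarith) f.2 ξ⟩

/-- The complex conjugate function. -/
def conj (hs : 1 / 2 < s) (f : GSSpace s d) : GSSpace s d :=
  ⟨fun y => starRingEnd ℂ (f y), IsGS.conj (by linarith) f.2⟩

/-- The tensor product `(g ⊗ f)(x, y) = g(x) f(y)`. -/
def tensor {m n : ℕ} (hs : 1 / 2 < s) (g : GSSpace s m) (f : GSSpace s n) :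
    GSSpace s (m + n) :=
  ⟨fun z => g (projFst m n z) * f (projSnd m n z), IsGS.tensor (by linarith) g.2 f.2⟩

theorem tensor_joinPt {m n : ℕ} (hs : 1 / 2 < s) (g : GSSpace s m) (f : GSSpace s n)
    (x : RSpace m) (y : RSpace n) : tensor hs g f (joinPt x y) = g x * f y := by
  change g (projFst m n (joinPt x y)) * f (projSnd m n (joinPt x y)) = _
  rw [projFst_joinPt, projSnd_joinPt]

/-- Functions in `Σ_s` are Schwartz functions. -/
def toSchwartz (hs : 1 / 2 < s) (f : GSSpace s d) : SchwartzMap (RSpace d) ℂ where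
  toFun := f
  smooth' := f.2.1
  decay' k n := by
    obtain ⟨C, -, hC⟩ := f.2.bound (by linarith) 1 one_pos
    exact ⟨_, fun x => hC k n x⟩

theorem integrable (hs : 1 / 2 < s) (f : GSSpace s d) : MeasureTheory.Integrable f.1 :=
  (toSchwartz hs f).integrable

theorem norm_apply_le (f : GSSpace s d) (x : RSpace d) :
    ‖f x‖ ≤ gsSeminorm s d ⟨1, one_pos⟩ f := by
  refine le_trans (le_of_eq ?_) (le_ciSup (f.2.2 1 one_pos) (0, 0, x))
  have key : ∀ (n : ℕ) (_ : n = 0) (v : Fin n → RSpace d),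
      iteratedFDeriv ℝ n f.1 x v = f x := by
    rintro n rfl v
    simp
  simp only [gsQuotient, multiFactorial, mixedPartial, Pi.zero_apply]
  rw [key _ (by simp)]
  simp

theorem integrable_mul_conj (hs : 1 / 2 < s) (f g : GSSpace s d) :
    MeasureTheory.Integrable (fun x => f x * starRingEnd ℂ (g x)) := by
  refine (integrable hs f).mul_bdd (c := gsSeminorm s d ⟨1, one_pos⟩ g) ?_ ?_
  · exact (Complex.continuous_conj.comp g.2.1.continuous).aestronglyMeasurable
  · exact Filter.Eventually.of_forall fun x => by simpa using norm_apply_le g x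

/-- The conjugate linear functional `g ↦ ∫ f(x) conj(g(x)) dx`. -/
def pairing (hs : 1 / 2 < s) (f : GSSpace s d) : GSSpace s d →ₛₗ[starRingEnd ℂ] ℂ where
  toFun g := ∫ x, f x * starRingEnd ℂ (g x)
  map_add' g g' := by
    rw [← MeasureTheory.integral_add (integrable_mul_conj hs f g) (integrable_mul_conj hs f g')]
    refine MeasureTheory.integral_congr_ae (Filter.Eventually.of_forall fun x => ?_)
    change f x * starRingEnd ℂ (g x + g' x) = _
    rw [map_add, mul_add]
  map_smul' c g := by
    rw [smul_eq_mul, ← MeasureTheory.integral_const_mul]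
    refine MeasureTheory.integral_congr_ae (Filter.Eventually.of_forall fun x => ?_)
    change f x * starRingEnd ℂ (c * g x) = _
    rw [map_mul]
    ring

/-- The embedding `Σ_s ⊆ Σ_s'`: `(f, g) = ∫ f(x) conj(g(x)) dx`. -/
def toDual (hs : 1 / 2 < s) (f : GSSpace s d) : GSDual s d where
  toLinearMap := pairing hs f
  cont := by
    refine WithSeminorms.continuous_normedSpace_rng ℂ (withSeminorms s d) (pairing hs f) ?_
    refine ⟨{⟨1, one_pos⟩}, ⟨∫ x, ‖f x‖, by positivity⟩, fun g => ?_⟩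
    rw [Finset.sup_singleton]
    change ‖∫ x, f x * starRingEnd ℂ (g x)‖ ≤
      (∫ x, ‖f x‖) * gsSeminorm s d ⟨1, one_pos⟩ g
    refine (MeasureTheory.norm_integral_le_integral_norm _).trans ?_
    rw [← MeasureTheory.integral_mul_const]
    refine MeasureTheory.integral_mono (integrable_mul_conj hs f g).norm
      ((integrable hs f).norm.mul_const _) fun x => ?_
    simp only [norm_mul, RCLike.norm_conj]
    exact mul_le_mul_of_nonneg_left (norm_apply_le g x) (norm_nonneg _)

end GSSpace

/-! ### The short-time Fourier transform and the wave front set -/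

/-- Points `(x, ξ)` of phase space `T^*ℝ^d = ℝ^d × ℝ^d`. -/
abbrev PhaseSpace (d : ℕ) : Type := RSpace d × RSpace d

/-- The Euclidean norm `|z| = (|x|² + |ξ|²)^{1/2}` of `z = (x, ξ) ∈ T^*ℝ^d = ℝ^{2d}`. -/
def phaseNorm {d : ℕ} (z : PhaseSpace d) : ℝ := √(‖z.1‖ ^ 2 + ‖z.2‖ ^ 2)

/-- The short-time Fourier transform `V_φ u(x, ξ) = (u, M_ξ T_x φ)`. -/
def stft {s : ℝ} {d : ℕ} (hs : 1 / 2 < s) (φ : GSSpace s d) (u : GSDual s d)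
    (z : PhaseSpace d) : ℂ :=
  u ((φ.translate hs z.1).modulate hs z.2)

/-- A set `Γ ⊆ T^*ℝ^d` is conic if it is invariant under multiplication by positive reals. -/
def IsConic {d : ℕ} (Γ : Set (PhaseSpace d)) : Prop :=
  ∀ z ∈ Γ, ∀ t : ℝ, 0 < t → t • z ∈ Γ

/-- The `s`-Gelfand--Shilov wave front set `WF^s(u) ⊆ T^*ℝ^d ∖ 0`, defined by means of the
window `φ`: the point `z₀ ≠ 0` is not in `WF^s(u)` if there is an open conic set
`Γ ⊆ T^*ℝ^d ∖ 0` containing `z₀` such that `sup_{z ∈ Γ} e^{A |z|^{1/s}} |V_φ u(z)| < ∞` for every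
`A > 0`. -/
def gsWaveFront {s : ℝ} {d : ℕ} (hs : 1 / 2 < s) (φ : GSSpace s d) (u : GSDual s d) :
    Set (PhaseSpace d) :=
  {z₀ | z₀ ≠ 0 ∧ ¬ ∃ Γ : Set (PhaseSpace d), IsOpen Γ ∧ IsConic Γ ∧ Γ ⊆ {0}ᶜ ∧ z₀ ∈ Γ ∧
    ∀ A : ℝ, 0 < A → ∃ C : ℝ, ∀ z ∈ Γ,
      Real.exp (A * phaseNorm z ^ (1 / s)) * ‖stft hs φ u z‖ ≤ C}

/-- The point `(x, y, ξ, η) ∈ T^*ℝ^{2d}`, with position `(x, y)` and frequency `(ξ, η)`. -/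
def kernelPt {d : ℕ} (x y ξ η : RSpace d) : PhaseSpace (d + d) := (joinPt x y, joinPt ξ η)

/-- For `W = WF^s(K) ⊆ T^*ℝ^{2d}`, the set `WF_1^s(K) = {(x, ξ) : (x, 0, ξ, 0) ∈ W}`. -/
def waveFrontFst {d : ℕ} (W : Set (PhaseSpace (d + d))) : Set (PhaseSpace d) :=
  {z | kernelPt z.1 0 z.2 0 ∈ W}

/-- For `W = WF^s(K) ⊆ T^*ℝ^{2d}`, the set `WF_2^s(K) = {(y, η) : (0, y, 0, -η) ∈ W}`. -/
def waveFrontSnd {d : ℕ} (W : Set (PhaseSpace (d + d))) : Set (PhaseSpace d) :=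
  {z | kernelPt 0 z.1 0 (-z.2) ∈ W}

/-- The relation mapping `W' ∘ V = {(x, ξ) : ∃ (y, η) ∈ V, (x, y, ξ, -η) ∈ W}`. -/
def twistedComp {d : ℕ} (W : Set (PhaseSpace (d + d))) (V : Set (PhaseSpace d)) :
    Set (PhaseSpace d) :=
  {z | ∃ w ∈ V, kernelPt z.1 w.1 z.2 (-w.2) ∈ W}

/-- The operator `T : Σ_s(ℝ^d) → Σ_s(ℝ^d)` has the Schwartz kernel `K ∈ Σ_s'(ℝ^{2d})`:
`(T f, g) = (K, g ⊗ conj f)` for all `f, g ∈ Σ_s(ℝ^d)`. -/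
def HasKernel {s : ℝ} {d : ℕ} (hs : 1 / 2 < s) (K : GSDual s (d + d))
    (T : GSSpace s d → GSSpace s d) : Prop :=
  ∀ f g : GSSpace s d, (T f).toDual hs g = K (g.tensor hs (f.conj hs))

end

open MeasureTheory
set_option maxSynthPendingDepth 3

/-! ### Factorial powers and stretched exponentials -/

/-! The short-time Fourier transform (STFT) turns the operator into an integral operator on phase
space. Write `π(w)` for the time-frequency shift `M_η T_y`, `w = (y, η)`. Then `V_ψ(𝒦u)(z) = c̄ ∫
V_φ u(w) V_Ψ K(x, y, ξ, -η) dw` with `z = (x, ξ)` and `Ψ = ψ ⊗ φ̄` (`stft_operator`). Suppose `z₀`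
is not in the composed relation. Consider the integrand as a function of the pair `(z, w)` near a
nonzero direction `(a z₀, w)`, `a ≥ 0`. If `a = 0`, the kernel factor decays rapidly because
`WF₂(K)` is empty. If `a > 0`, scale to `a = 1`: for `w = 0` it decays because `WF₁(K)` is empty,
for `w ∈ WF(u)` because `z₀` is not related to `w`, and for the remaining `w` the factor `V_φ u`
decays. The other factor always grows at most like `exp(b |·|^{1/s})`, which rapid decay absorbs.
The unit directions `(a z₀, w)` form a compact set, so the decay is uniform on a neighbourhood of
all of them, and integrating in `w` gives rapid decay of `V_ψ(𝒦u)` in a cone around `z₀`. The window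
of `K` has to be changed from the given one to `Ψ`, which is harmless by `rapidNear_stft_of_window`.

The analytic work lies in the integral formula for arbitrary `u ∈ Σ_s'`. On `Σ_s` the inversion
formula `f = c ∫ V_φ f(z) π(z)φ dz` is Fourier inversion at fixed position (`exists_inversion`), and
it must be moved through continuous functionals, first on `Σ_s` and then on `Σ_s'`. Instead of
vector-valued integrals the proof uses domination: a functional bounded by a weighted `L¹` norm of
the STFT is, by Cauchy-Schwarz, Hahn-Banach and Riesz, integration of the STFT against a weighted
`L²` function (`exists_eq_integral_of_le_integral`), and Fubini then commutes it with the
superposition (`apply_eq_integral_of_eq_integral`). The bounds for this are `exists_norm_gsStft_le`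
(the STFT of `f` is below every `exp(-A |z|^{1/s})`, with one seminorm of `f`) and
`exists_gsSeminorm_le_integral` (each seminorm is below a weighted integral of the STFT). Used once,
this gives `dual_inversion`; used again for functionals on the strong dual, it gives
`functional_eq_integral`, which is applied to `v ↦ (𝒦v, π(z)ψ)`. -/

theorem pow_le_exp_mul_factorial {s : ℝ} (hs : 0 < s) {h : ℝ} (hh : 0 < h) {R : ℝ}
    (hR : 0 ≤ R) (k : ℕ) :
    R ^ k ≤ Real.exp (s * (R / h) ^ (1 / s)) * (h ^ k * (k.factorial : ℝ) ^ s) := by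
  set t : ℝ := (R / h) ^ (1 / s) with ht
  have ht0 : 0 ≤ t := by positivity
  have h1 : t ^ k / (k.factorial : ℝ) ≤ Real.exp t := Real.pow_div_factorial_le_exp t ht0 k
  have hk : (0 : ℝ) < k.factorial := by exact_mod_cast Nat.factorial_pos k
  rw [div_le_iff₀ hk] at h1
  -- The power `s` turns `t ^ k` into `(R / h) ^ k` and `exp t` into `exp (s t)`.
  have h2 := Real.rpow_le_rpow (by positivity) h1 hs.le
  rw [Real.mul_rpow (by positivity) hk.le, ← Real.rpow_pow_comm ht0, ht,
    ← Real.rpow_mul (by positivity), one_div, inv_mul_cancel₀ hs.ne', Real.rpow_one, div_pow,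
    div_le_iff₀ (by positivity), ← Real.exp_mul, mul_comm _ s] at h2
  rw [ht, one_div]
  linarith

/-- After taking `1/s`-th powers the hypothesis bounds `τ ^ n / n!` uniformly in `n`. Weighting by
`2 ^ (-n)` and summing compares the exponential series at `τ / 2` with a geometric series of sum 2;
this accounts for the constants `2 ^ s` and `s / 2`. It converts factorial bounds into stretched
exponential decay. -/
theorem le_exp_of_forall_pow_le {s : ℝ} (hs : 0 < s) {h : ℝ} (hh : 0 < h) {a t M : ℝ}
    (ha : 0 ≤ a) (ht : 0 ≤ t) (hM : 0 ≤ M)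
    (H : ∀ n : ℕ, a * t ^ n ≤ M * (h ^ n * (n.factorial : ℝ) ^ s)) :
    a ≤ 2 ^ s * M * Real.exp (-(s / 2 * (t / h) ^ (1 / s))) := by
  set τ : ℝ := (t / h) ^ (1 / s) with hτ
  have hτ0 : 0 ≤ τ := by positivity
  have hpow : ∀ n : ℕ, (a : ℝ) ^ (1 / s) * (τ / 2) ^ n / n.factorial ≤
      M ^ (1 / s) * (1 / 2) ^ n := by
    intro n
    have hk : (0 : ℝ) < n.factorial := by exact_mod_cast Nat.factorial_pos n
    have h1 : a * (t / h) ^ n ≤ M * (n.factorial : ℝ) ^ s := by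
      rw [div_pow, mul_div_assoc', div_le_iff₀ (by positivity)]
      linarith [H n]
    have h2 := Real.rpow_le_rpow (by positivity) h1 (by positivity : 0 ≤ 1 / s)
    rw [Real.mul_rpow ha (by positivity), Real.mul_rpow hM (by positivity),
      ← Real.rpow_mul hk.le, mul_one_div_cancel hs.ne', Real.rpow_one,
      ← Real.rpow_pow_comm (by positivity)] at h2
    rw [div_le_iff₀ hk, div_pow, one_div (2 : ℝ), inv_pow, ← div_eq_mul_inv]
    calc _ = (a ^ (1 / s) * τ ^ n) / 2 ^ n := by ring
      _ ≤ (M ^ (1 / s) * n.factorial) / 2 ^ n := by gcongr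
      _ = _ := by ring
  have hs1 := (NormedSpace.expSeries_div_hasSum_exp (τ / 2)).mul_left (a ^ (1 / s))
  have hs2 := hasSum_geometric_two.mul_left (M ^ (1 / s))
  have h3 := hasSum_le (fun n => by simpa [mul_div_assoc] using hpow n) hs1 hs2
  rw [← Real.exp_eq_exp_ℝ] at h3
  have h4 := Real.rpow_le_rpow (by positivity) h3 hs.le
  rw [Real.mul_rpow (by positivity) (by positivity), Real.mul_rpow (by positivity) (by positivity),
    ← Real.rpow_mul ha, ← Real.rpow_mul hM, one_div_mul_cancel hs.ne', Real.rpow_one,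
    Real.rpow_one, ← Real.exp_mul] at h4
  rw [Real.exp_neg, ← div_eq_mul_inv, le_div_iff₀ (Real.exp_pos _)]
  calc _ = a * Real.exp (τ / 2 * s) := by rw [show τ / 2 * s = s / 2 * τ by ring]
    _ ≤ _ := h4
    _ = _ := by ring

/-- The factor `2 ^ r` stands in for subadditivity, which fails when `r = 1 / s` exceeds 1. It is
why most weights below carry a factor `2 ^ (1 / s)`. -/
theorem norm_add_rpow_le {E : Type*} [SeminormedAddCommGroup E] {r : ℝ} (hr : 0 ≤ r) (x y : E) :
    ‖x + y‖ ^ r ≤ 2 ^ r * (‖x‖ ^ r + ‖y‖ ^ r) := by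
  have h1 : ‖x + y‖ ≤ 2 * max ‖x‖ ‖y‖ := by
    have := norm_add_le x y
    have := le_max_left ‖x‖ ‖y‖
    have := le_max_right ‖x‖ ‖y‖
    linarith
  have hx : 0 ≤ ‖x‖ ^ r := by positivity
  have hy : 0 ≤ ‖y‖ ^ r := by positivity
  calc ‖x + y‖ ^ r ≤ (2 * max ‖x‖ ‖y‖) ^ r := Real.rpow_le_rpow (norm_nonneg _) h1 hr
    _ = 2 ^ r * (max ‖x‖ ‖y‖) ^ r := Real.mul_rpow (by norm_num) (by positivity)
    _ ≤ _ := by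
      gcongr
      rcases max_choice ‖x‖ ‖y‖ with h | h <;> rw [h] <;> linarith

theorem norm_prod_rpow_le {E F : Type*} [SeminormedAddCommGroup E] [SeminormedAddCommGroup F]
    (r : ℝ) (z : E × F) : ‖z‖ ^ r ≤ ‖z.1‖ ^ r + ‖z.2‖ ^ r := by
  have hx : 0 ≤ ‖z.1‖ ^ r := by positivity
  have hy : 0 ≤ ‖z.2‖ ^ r := by positivity
  rw [Prod.norm_def]
  rcases max_choice ‖z.1‖ ‖z.2‖ with h | h <;> rw [h] <;> linarith

theorem exists_one_add_pow_le_exp {s : ℝ} (hs : 0 < s) {A : ℝ} (hA : 0 < A) (k : ℕ) :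
    ∃ C : ℝ, 0 < C ∧ ∀ t : ℝ, 0 ≤ t → (1 + t) ^ k ≤ C * Real.exp (A * t ^ (1 / s)) := by
  -- Chosen so that `s (t / h) ^ (1 / s) = A t ^ (1 / s)`.
  set h : ℝ := (s / A) ^ s with hh
  have hh0 : 0 < h := by positivity
  have hhr : h ^ (1 / s) = s / A := by
    rw [hh, ← Real.rpow_mul (by positivity), mul_one_div_cancel hs.ne', Real.rpow_one]
  have hk : (0 : ℝ) < k.factorial := by exact_mod_cast Nat.factorial_pos k
  refine ⟨2 ^ k * (1 + h ^ k * (k.factorial : ℝ) ^ s), by positivity, fun t ht => ?_⟩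
  have h1 := pow_le_exp_mul_factorial hs hh0 ht k
  have he : s * (t / h) ^ (1 / s) = A * t ^ (1 / s) := by
    rw [Real.div_rpow ht hh0.le, hhr]
    field_simp
  rw [he] at h1
  have he1 : 1 ≤ Real.exp (A * t ^ (1 / s)) := Real.one_le_exp (by positivity)
  have h2 : (1 + t) ^ k ≤ 2 ^ k * (1 + t ^ k) := by
    have : (1 + t) ^ k ≤ (2 * max 1 t) ^ k := by
      gcongr
      have := le_max_left 1 t
      have := le_max_right 1 t
      linarith
    refine this.trans ?_
    rw [mul_pow]
    gcongr
    rcases max_choice 1 t with h | h <;> rw [h]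
    · simp; positivity
    · linarith
  refine h2.trans ?_
  rw [mul_assoc]
  gcongr
  nlinarith

theorem integrable_exp_neg_norm_rpow {E : Type*} [NormedAddCommGroup E] [NormedSpace ℝ E]
    [FiniteDimensional ℝ E] [MeasurableSpace E] [BorelSpace E] (μ : Measure E)
    [μ.IsAddHaarMeasure] {s : ℝ} (hs : 0 < s) {A : ℝ} (hA : 0 < A) :
    Integrable (fun x : E => Real.exp (-(A * ‖x‖ ^ (1 / s)))) μ := by
  obtain ⟨C, hC0, hC⟩ := exists_one_add_pow_le_exp hs hA (Module.finrank ℝ E + 1)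
  have hint := (integrable_one_add_norm (E := E) (μ := μ)
    (r := ((Module.finrank ℝ E + 1 : ℕ) : ℝ)) (by push_cast; linarith)).const_mul C
  refine hint.mono' ?_ (Filter.Eventually.of_forall fun x => ?_)
  · refine Continuous.aestronglyMeasurable ?_
    have : Continuous fun x : E => ‖x‖ ^ (1 / s) :=
      continuous_norm.rpow_const fun _ => Or.inr (by positivity)
    fun_prop
  · rw [Real.norm_of_nonneg (Real.exp_pos _).le, Real.exp_neg, Real.rpow_neg (by positivity),
      Real.rpow_natCast, ← div_eq_mul_inv, le_div_iff₀ (by positivity), inv_mul_le_iff₀ (Real.exp_pos _)]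
    linarith [hC ‖x‖ (norm_nonneg x)]

theorem continuous_exp_norm_rpow {E : Type*} [SeminormedAddCommGroup E] {s : ℝ} (hs : 0 < s)
    (A : ℝ) : Continuous fun x : E => Real.exp (A * ‖x‖ ^ (1 / s)) := by
  have : Continuous fun x : E => ‖x‖ ^ (1 / s) :=
    continuous_norm.rpow_const fun _ => Or.inr (by positivity)
  fun_prop

/-! ### Exponential bounds for the derivatives of functions in `Σ_s` -/

theorem gsQuotient_le_gsSeminorm {s : ℝ} {d : ℕ} (h : {h : ℝ // 0 < h}) (f : GSSpace s d)
    (p : (Fin d → ℕ) × (Fin d → ℕ) × RSpace d) :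
    gsQuotient s h f p ≤ GSSpace.gsSeminorm s d h f :=
  le_ciSup (f.2.2 h h.2) p

/-- The coordinate of largest modulus supplies the monomial. The first alternative only serves `d =
0`, where no coordinate exists. -/
theorem exists_monomial_ge {d : ℕ} (n : ℕ) (x : RSpace d) :
    ‖x‖ ^ n = 0 ∨ ∃ α : Fin d → ℕ, ∑ i, α i = n ∧
      ‖x‖ ^ n ≤ ((d : ℝ) + 1) ^ n * |∏ i, x i ^ α i| := by
  classical
  rcases Nat.eq_zero_or_pos d with hd | hd
  · subst hd
    rcases Nat.eq_zero_or_pos n with hn | hn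
    · subst hn
      exact Or.inr ⟨0, by simp, by simp⟩
    · refine Or.inl ?_
      have : x = 0 := Subsingleton.elim _ _
      simp [this, hn.ne']
  · obtain ⟨i, -, hi⟩ := Finset.exists_max_image (Finset.univ : Finset (Fin d))
      (fun j => |x j|) ⟨⟨0, hd⟩, Finset.mem_univ _⟩
    refine Or.inr ⟨Pi.single i n, by simp, ?_⟩
    have hprod : ∏ j, x j ^ (Pi.single i n : Fin d → ℕ) j = x i ^ n := by
      rw [Finset.prod_eq_single i]
      · simp
      · intro j _ hj; simp [hj]
      · simp
    rw [hprod, abs_pow, ← mul_pow]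
    refine pow_le_pow_left₀ (norm_nonneg _) ?_ n
    have hx1 : ‖x‖ ≤ ∑ j, |x j| := by
      have := (EuclideanSpace.basisFun (Fin d) ℝ).sum_repr x
      calc ‖x‖ = ‖∑ j, x j • EuclideanSpace.single j (1 : ℝ)‖ := by
            conv_lhs => rw [← this]
            simp
        _ ≤ ∑ j, ‖x j • EuclideanSpace.single j (1 : ℝ)‖ := norm_sum_le _ _
        _ = _ := by simp [norm_smul]
    refine hx1.trans ?_
    calc ∑ j, |x j| ≤ ∑ _j : Fin d, |x i| := Finset.sum_le_sum fun j hj => hi j hj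
      _ = d * |x i| := by simp
      _ ≤ _ := by gcongr; linarith

/-- A quantitative form of `IsGS.bound`: the constant is a seminorm of `f`, so that later estimates
are uniform on bounded sets of `Σ_s`. -/
theorem pow_mul_norm_iteratedFDeriv_le_gsSeminorm {s : ℝ} (hs : 0 ≤ s) {d : ℕ}
    (f : GSSpace s d) (r : {h : ℝ // 0 < h}) (n m : ℕ) (x : RSpace d) :
    ‖x‖ ^ n * ‖iteratedFDeriv ℝ m f x‖ ≤ GSSpace.gsSeminorm s d r f *
      ((((d : ℝ) + 1) * r) ^ n * (n.factorial : ℝ) ^ s *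
        ((((d : ℝ) + 1) * r) ^ m * (m.factorial : ℝ) ^ s)) := by
  obtain ⟨r, hr0⟩ := r
  set S := GSSpace.gsSeminorm s d ⟨r, hr0⟩ f with hS
  have hS0 : 0 ≤ S := apply_nonneg _ _
  have hfac : ∀ γ : Fin d → ℕ, ((multiFactorial γ : ℝ)) ^ s ≤ ((∑ i, γ i).factorial : ℝ) ^ s :=
    fun γ => Real.rpow_le_rpow (by positivity) (by exact_mod_cast multiFactorial_le γ) hs
  have hterm : ∀ α β : Fin d → ℕ, |∏ i, x i ^ α i| * ‖mixedPartial β f x‖ ≤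
      S * (r ^ (∑ i, α i) * ((∑ i, α i).factorial : ℝ) ^ s *
        (r ^ (∑ i, β i) * ((∑ i, β i).factorial : ℝ) ^ s)) := by
    intro α β
    have h1 := gsQuotient_le_gsSeminorm ⟨r, hr0⟩ f (α, β, x)
    rw [gsQuotient, div_le_iff₀ (gsDen_pos s hr0 _ _)] at h1
    refine h1.trans ?_
    rw [pow_add]
    have h2 := hfac α
    have h3 := hfac β
    calc _ = S * (r ^ (∑ i, α i) * ((multiFactorial α : ℝ)) ^ s *
          (r ^ (∑ i, β i) * (multiFactorial β : ℝ) ^ s)) := by ring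
      _ ≤ _ := by gcongr
  dsimp only
  rcases exists_monomial_ge n x with hα | ⟨α, hα1, hα3⟩
  · rw [hα, zero_mul]; positivity
  set B := S * (r ^ n * (n.factorial : ℝ) ^ s * (r ^ m * (m.factorial : ℝ) ^ s)) with hB
  have hB0 : 0 ≤ B := by positivity
  have hJ : ∀ J : Fin m → Fin d, |∏ i, x i ^ α i| *
      ‖iteratedFDeriv ℝ m f x (fun k => EuclideanSpace.single (J k) (1 : ℝ))‖ ≤ B := by
    intro J
    obtain ⟨β, hβ, hβ'⟩ := exists_mixedPartial_eq f.2.1 J x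
    rw [hβ']
    refine (hterm α β).trans ?_
    rw [hβ, hα1]
  have hD : |∏ i, x i ^ α i| * ‖iteratedFDeriv ℝ m f x‖ ≤ ((d : ℝ) + 1) ^ m * B := by
    rcases (abs_nonneg (∏ i, x i ^ α i)).eq_or_lt with h0 | h0
    · rw [← h0, zero_mul]; positivity
    · have hb := norm_iteratedFDeriv_le_of_basis (f := f) (x := x) (m := m)
        (M := B / |∏ i, x i ^ α i|) (by positivity)
        (fun J => by rw [le_div_iff₀ h0, mul_comm]; exact hJ J)
      have hb2 : ‖iteratedFDeriv ℝ m f x‖ * |∏ i, x i ^ α i| ≤ (d : ℝ) ^ m * B := by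
        rw [← le_div_iff₀ h0, ← mul_div_assoc']
        exact hb
      rw [mul_comm]
      refine hb2.trans ?_
      gcongr
      linarith
  calc ‖x‖ ^ n * ‖iteratedFDeriv ℝ m f x‖
      ≤ ((d : ℝ) + 1) ^ n * |∏ i, x i ^ α i| * ‖iteratedFDeriv ℝ m f x‖ := by gcongr
    _ = ((d : ℝ) + 1) ^ n * (|∏ i, x i ^ α i| * ‖iteratedFDeriv ℝ m f x‖) := by ring
    _ ≤ ((d : ℝ) + 1) ^ n * (((d : ℝ) + 1) ^ m * B) := by gcongr
    _ = _ := by rw [hB, mul_pow, mul_pow]; ring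

/-- All derivatives of `f` satisfy `‖D^m f(y)‖ ≤ M h^m m!^s exp(-A |y|^{1/s})`. -/
def ExpBound {d : ℕ} (s : ℝ) (f : RSpace d → ℂ) (h A M : ℝ) : Prop :=
  ∀ (m : ℕ) (y : RSpace d), ‖iteratedFDeriv ℝ m f y‖ ≤
    M * (h ^ m * (m.factorial : ℝ) ^ s) * Real.exp (-(A * ‖y‖ ^ (1 / s)))

/-- With `exists_gsSeminorm_le_of_expBound` this shows that exponential bounds on all derivatives
define the topology of `Σ_s`. The powers `‖y‖ ^ n` in the seminorm become decay through
`le_exp_of_forall_pow_le`. -/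
theorem exists_expBound {s : ℝ} (hs : 0 < s) (d : ℕ) {h : ℝ} (hh : 0 < h) (A : ℝ) :
    ∃ (r : {h : ℝ // 0 < h}) (C : ℝ), 0 ≤ C ∧ ∀ f : GSSpace s d,
      ExpBound s f h A (C * GSSpace.gsSeminorm s d r f) := by
  set A' := max A 1 with hA'
  have hA0 : 0 < A' := by positivity
  -- The first entry keeps the derivative growth below `h`, the second makes the decay rate `s / 2 *
  -- (1 / η) ^ (1 / s)` at least `A'`.
  set η : ℝ := min h ((s / 2 / A') ^ s) with hη
  have hη0 : 0 < η := by positivity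
  have hηA : A' ≤ s / 2 * (1 / η) ^ (1 / s) := by
    have h1 : η ≤ (s / 2 / A') ^ s := min_le_right _ _
    have h2 := Real.rpow_le_rpow hη0.le h1 (by positivity : 0 ≤ 1 / s)
    rw [← Real.rpow_mul (by positivity), mul_one_div_cancel hs.ne', Real.rpow_one] at h2
    rw [Real.div_rpow zero_le_one hη0.le, Real.one_rpow, mul_one_div, le_div_iff₀ (by positivity)]
    rw [le_div_iff₀ hA0] at h2
    linarith
  refine ⟨⟨η / ((d : ℝ) + 1), by positivity⟩, 2 ^ s, by positivity, fun f m y => ?_⟩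
  set S := GSSpace.gsSeminorm s d ⟨η / ((d : ℝ) + 1), by positivity⟩ f
  have hS0 : 0 ≤ S := apply_nonneg _ _
  have hη1 : ((d : ℝ) + 1) * (η / ((d : ℝ) + 1)) = η := by field_simp
  have h1 := le_exp_of_forall_pow_le hs hη0 (norm_nonneg (iteratedFDeriv ℝ m f y))
    (norm_nonneg y) (M := S * (η ^ m * (m.factorial : ℝ) ^ s)) (by positivity) (fun n => by
      have := pow_mul_norm_iteratedFDeriv_le_gsSeminorm hs.le f ⟨η / ((d : ℝ) + 1), by positivity⟩
        n m y
      dsimp only at this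
      rw [hη1] at this
      linarith)
  refine h1.trans ?_
  rw [← mul_assoc (2 ^ s) S]
  have h2 : η ≤ h := min_le_left _ _
  have h3 : A * ‖y‖ ^ (1 / s) ≤ s / 2 * (‖y‖ / η) ^ (1 / s) := by
    rw [div_eq_mul_one_div ‖y‖, Real.mul_rpow (norm_nonneg _) (by positivity)]
    calc A * ‖y‖ ^ (1 / s) ≤ A' * ‖y‖ ^ (1 / s) := by gcongr; exact le_max_left _ _
      _ ≤ s / 2 * (1 / η) ^ (1 / s) * ‖y‖ ^ (1 / s) := by gcongr
      _ = _ := by ring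
  gcongr

theorem exists_gsSeminorm_le_of_expBound {s : ℝ} (hs : 0 < s) (d : ℕ) (h : {h : ℝ // 0 < h}) :
    ∃ η A : ℝ, 0 < η ∧ 0 < A ∧ ∀ (f : GSSpace s d) (M : ℝ), 0 ≤ M → ExpBound s f η A M →
      GSSpace.gsSeminorm s d h f ≤ M := by
  obtain ⟨h, hh⟩ := h
  -- `D ^ |γ|` pays for replacing `|γ|!` by the multi-index factorial `γ!` under the power `s`.
  set D : ℝ := ((d : ℝ) + 1) ^ s with hD
  have hD0 : 0 < D := by positivity
  set η : ℝ := h / D with hη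
  have hη0 : 0 < η := by positivity
  -- This rate is exactly the exponential growth that `pow_le_exp_mul_factorial` spends on `‖x‖ ^
  -- |α|`, so the two exponentials cancel.
  refine ⟨η, s * (1 / η) ^ (1 / s), hη0, by positivity, fun f M hM hf => ?_⟩
  refine ciSup_le fun p => ?_
  obtain ⟨α, β, x⟩ := p
  rw [gsQuotient, div_le_iff₀ (gsDen_pos s hh _ _)]
  dsimp only
  have hfac : ∀ γ : Fin d → ℕ,
      ((∑ i, γ i).factorial : ℝ) ^ s ≤ D ^ (∑ i, γ i) * (multiFactorial γ : ℝ) ^ s := by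
    intro γ
    have h1 : ((∑ i, γ i).factorial : ℝ) ≤
        ((d : ℝ) + 1) ^ (∑ i, γ i) * (multiFactorial γ : ℝ) := by
      calc ((∑ i, γ i).factorial : ℝ) ≤ (d : ℝ) ^ (∑ i, γ i) * (multiFactorial γ : ℝ) := by
            exact_mod_cast factorial_le_multiFactorial γ
        _ ≤ _ := by gcongr; linarith
    calc ((∑ i, γ i).factorial : ℝ) ^ s
        ≤ (((d : ℝ) + 1) ^ (∑ i, γ i) * (multiFactorial γ : ℝ)) ^ s :=
          Real.rpow_le_rpow (by positivity) h1 hs.le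
      _ = _ := by
          rw [Real.mul_rpow (by positivity) (by positivity), hD,
            Real.rpow_pow_comm (by positivity)]
  have hx : |∏ i, x i ^ α i| ≤ ‖x‖ ^ (∑ i, α i) := by
    rw [Finset.abs_prod, ← Finset.prod_pow_eq_pow_sum]
    refine Finset.prod_le_prod (fun _ _ => abs_nonneg _) fun i _ => ?_
    rw [abs_pow]
    exact pow_le_pow_left₀ (abs_nonneg _) (PiLp.norm_apply_le x i) _
  have hp : ‖mixedPartial β f x‖ ≤ ‖iteratedFDeriv ℝ (∑ i, β i) f x‖ := by
    refine (ContinuousMultilinearMap.le_opNorm _ _).trans ?_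
    simp
  have hpow : ∀ k : ℕ, η ^ k * D ^ k = h ^ k := fun k => by
    rw [← mul_pow, div_mul_cancel₀ _ hD0.ne']
  have hexp := pow_le_exp_mul_factorial hs hη0 (norm_nonneg x) (∑ i, α i)
  have he : s * (‖x‖ / η) ^ (1 / s) = s * (1 / η) ^ (1 / s) * ‖x‖ ^ (1 / s) := by
    rw [div_eq_mul_one_div, Real.mul_rpow (norm_nonneg _) (by positivity)]
    ring
  rw [he] at hexp
  set E := s * (1 / η) ^ (1 / s) * ‖x‖ ^ (1 / s)
  have hE : Real.exp E * Real.exp (-E) = 1 := by rw [← Real.exp_add]; simp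
  calc |∏ i, x i ^ α i| * ‖mixedPartial β f x‖
      ≤ ‖x‖ ^ (∑ i, α i) * ‖iteratedFDeriv ℝ (∑ i, β i) f x‖ := by gcongr
    _ ≤ (Real.exp E * (η ^ (∑ i, α i) * ((∑ i, α i).factorial : ℝ) ^ s)) *
        (M * (η ^ (∑ i, β i) * ((∑ i, β i).factorial : ℝ) ^ s) * Real.exp (-E)) := by
        gcongr
        exact hf _ _
    _ = (Real.exp E * Real.exp (-E)) * (M * (η ^ (∑ i, α i) * ((∑ i, α i).factorial : ℝ) ^ s *
          (η ^ (∑ i, β i) * ((∑ i, β i).factorial : ℝ) ^ s))) := by ring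
    _ ≤ M * (η ^ (∑ i, α i) * (D ^ (∑ i, α i) * (multiFactorial α : ℝ) ^ s) *
          (η ^ (∑ i, β i) * (D ^ (∑ i, β i) * (multiFactorial β : ℝ) ^ s))) := by
        rw [hE, one_mul]
        gcongr
        · exact hfac α
        · exact hfac β
    _ = M * ((η ^ (∑ i, α i) * D ^ (∑ i, α i)) * (multiFactorial α : ℝ) ^ s *
          ((η ^ (∑ i, β i) * D ^ (∑ i, β i)) * (multiFactorial β : ℝ) ^ s)) := by ring
    _ = M * (h ^ (∑ i, α i + ∑ i, β i) *
          ((multiFactorial α : ℝ) ^ s * (multiFactorial β : ℝ) ^ s)) := by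
        rw [hpow, hpow, pow_add]; ring

/-! ### Time-frequency shifts and their growth -/

namespace GSSpace

variable {s : ℝ} {d : ℕ}

/-- The time-frequency shift `M_ξ T_x f` with `z = (x, ξ)`. -/
noncomputable def tfShift (hs : 1 / 2 < s) (z : PhaseSpace d) (f : GSSpace s d) : GSSpace s d :=
  (f.translate hs z.1).modulate hs z.2

theorem tfShift_apply (hs : 1 / 2 < s) (z : PhaseSpace d) (f : GSSpace s d) (y : RSpace d) :
    tfShift hs z f y = Complex.exp (Complex.I * (inner ℝ y z.2 : ℝ)) * f (y - z.1) := rfl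

theorem norm_tfShift_apply (hs : 1 / 2 < s) (z : PhaseSpace d) (f : GSSpace s d) (y : RSpace d) :
    ‖tfShift hs z f y‖ = ‖f (y - z.1)‖ := by
  rw [tfShift_apply, norm_mul, Complex.norm_exp]
  simp

theorem contDiff_character (ξ : RSpace d) : ContDiff ℝ ∞
    (fun y : RSpace d => Complex.exp (Complex.I * (inner ℝ y ξ : ℝ))) := by
  have : ContDiff ℝ ∞ (fun y : RSpace d => ((inner ℝ y ξ : ℝ) : ℂ)) :=
    Complex.ofRealCLM.contDiff.comp (contDiff_id.inner ℝ contDiff_const)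
  exact (contDiff_const.mul this).cexp

end GSSpace

/-- By Leibniz: derivatives of the character contribute `‖ξ‖ ^ k`, hence a factor `exp (s (‖ξ‖ / h)
^ (1 / s))`, and the binomial sum doubles `h`. Recentring the weight from `y - x` to `y` costs `2 ^
(1 / s)` in the rate and an exponential in `‖x‖`. -/
theorem ExpBound.tfShift {s : ℝ} (hs : 1 / 2 < s) {d : ℕ} {f : GSSpace s d} {h A M : ℝ}
    (hh : 0 < h) (hA : 0 ≤ A) (hM : 0 ≤ M) (hf : ExpBound s f h (2 ^ (1 / s) * A) M) :
    ∀ z : PhaseSpace d, ExpBound s (f.tfShift hs z) (2 * h) A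
      (M * Real.exp ((s * (1 / h) ^ (1 / s) + 2 ^ (1 / s) * A) * ‖z‖ ^ (1 / s))) := by
  intro z m y
  have hs0 : 0 < s := by linarith
  have hr : 0 ≤ 1 / s := by positivity
  have hft : ContDiff ℝ ∞ (fun y => f (y - z.1)) := f.2.1.comp (contDiff_id.sub contDiff_const)
  have h1 := norm_iteratedFDeriv_mul_le (GSSpace.contDiff_character z.2) hft y (n := m)
    (by exact_mod_cast le_top)
  set X := Real.exp (s * (‖z.2‖ / h) ^ (1 / s)) with hX
  set Y := Real.exp (-(2 ^ (1 / s) * A * ‖y - z.1‖ ^ (1 / s))) with hY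
  have h2 := sum_choose_mul_le hs0.le hh (A := X) (B := M * Y)
    (a := fun k => ‖z.2‖ ^ k) (b := fun k => ‖iteratedFDeriv ℝ k f (y - z.1)‖)
    (by positivity) (by positivity) (fun k => by positivity)
    (fun k => pow_le_exp_mul_factorial hs0 hh (norm_nonneg _) k)
    (fun k => (hf k _).trans (le_of_eq (by ring))) m
  have hz1 : ‖z.1‖ ^ (1 / s) ≤ ‖z‖ ^ (1 / s) :=
    Real.rpow_le_rpow (norm_nonneg _) (norm_fst_le z) hr
  have hz2 : ‖z.2‖ ^ (1 / s) ≤ ‖z‖ ^ (1 / s) :=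
    Real.rpow_le_rpow (norm_nonneg _) (norm_snd_le z) hr
  have h3 := norm_add_rpow_le hr (y - z.1) z.1
  rw [sub_add_cancel] at h3
  have h4 : X * Y ≤ Real.exp ((s * (1 / h) ^ (1 / s) + 2 ^ (1 / s) * A) * ‖z‖ ^ (1 / s)) *
      Real.exp (-(A * ‖y‖ ^ (1 / s))) := by
    rw [hX, hY, ← Real.exp_add, ← Real.exp_add, Real.exp_le_exp, div_eq_mul_one_div,
      Real.mul_rpow (norm_nonneg _) (by positivity)]
    have e1 : s * (‖z.2‖ ^ (1 / s) * (1 / h) ^ (1 / s)) ≤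
        s * (‖z‖ ^ (1 / s) * (1 / h) ^ (1 / s)) := by gcongr
    have e2 : A * ‖y‖ ^ (1 / s) ≤ A * (2 ^ (1 / s) * (‖y - z.1‖ ^ (1 / s) + ‖z.1‖ ^ (1 / s))) := by
      gcongr
    have e3 : A * (2 ^ (1 / s) * ‖z.1‖ ^ (1 / s)) ≤ A * (2 ^ (1 / s) * ‖z‖ ^ (1 / s)) := by gcongr
    linarith
  calc _ ≤ ∑ k ∈ Finset.range (m + 1), (m.choose k : ℝ) * ‖z.2‖ ^ k *
          ‖iteratedFDeriv ℝ (m - k) f (y - z.1)‖ := by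
        refine h1.trans ?_
        gcongr with k _
        · exact norm_iteratedFDeriv_character_le z.2 k y
        · rw [iteratedFDeriv_comp_sub]
    _ ≤ _ := h2
    _ = M * ((2 * h) ^ m * (m.factorial : ℝ) ^ s) * (X * Y) := by ring
    _ ≤ M * ((2 * h) ^ m * (m.factorial : ℝ) ^ s) * _ :=
        mul_le_mul_of_nonneg_left h4 (by positivity)
    _ = _ := by ring

/-- Time-frequency shifts grow at most like `exp(b |z|^{1/s})` in each seminorm. -/
theorem exists_gsSeminorm_tfShift_le {s : ℝ} (hs : 1 / 2 < s) {d : ℕ} (φ : GSSpace s d)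
    {h A : ℝ} (hh : 0 < h) (hA : 0 < A) :
    ∃ M b : ℝ, 0 ≤ M ∧ 0 ≤ b ∧ ∀ z : PhaseSpace d,
      ExpBound s (φ.tfShift hs z) h A (M * Real.exp (b * ‖z‖ ^ (1 / s))) := by
  have hs0 : 0 < s := by linarith
  obtain ⟨r, C, hC, H⟩ := exists_expBound hs0 d (half_pos hh) (2 ^ (1 / s) * A)
  have h2 := (H φ).tfShift hs (half_pos hh) hA.le (by positivity)
  rw [show 2 * (h / 2) = h by ring] at h2
  exact ⟨_, _, by positivity, by positivity, h2⟩

/-! ### The short-time Fourier transform on `Σ_s` -/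

open scoped FourierTransform in
-- The transform of the `n`-th derivative is the multilinear form `∏ (2πi⟨w, v_j⟩)` times `𝓕 f w`.
-- Evaluating it on `(w, …, w)` gives `‖w‖ ^ (2 n)`, of which the operator norm takes back `‖w‖ ^
-- n`.
theorem two_pi_mul_norm_pow_mul_norm_fourier_le {V : Type*} [NormedAddCommGroup V]
    [InnerProductSpace ℝ V] [FiniteDimensional ℝ V] [MeasurableSpace V] [BorelSpace V]
    {f : V → ℂ} (hf : ContDiff ℝ ∞ f) (hi : ∀ n, Integrable (iteratedFDeriv ℝ n f)) (n : ℕ)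
    (w : V) : (2 * Real.pi * ‖w‖) ^ n * ‖𝓕 f w‖ ≤ ∫ v, ‖iteratedFDeriv ℝ n f v‖ := by
  have h1 := congrFun (Real.fourier_iteratedFDeriv (N := ⊤) hf (fun n _ => hi n) (n := n) le_top) w
  have h2 : ‖𝓕 (iteratedFDeriv ℝ n f) w‖ ≤ ∫ v, ‖iteratedFDeriv ℝ n f v‖ :=
    VectorFourier.norm_fourierIntegral_le_integral_norm _ _ _ _ _
  rw [h1] at h2
  have h3 := (VectorFourier.fourierPowSMulRight (-innerSL ℝ) (𝓕 f) w n).le_opNorm (fun _ => w)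
  have h4 : (2 * Real.pi * ‖w‖) ^ n * ‖𝓕 f w‖ * ‖w‖ ^ n ≤
      ‖VectorFourier.fourierPowSMulRight (-innerSL ℝ) (𝓕 f) w n‖ * ‖w‖ ^ n := by
    refine le_trans (le_of_eq ?_) (h3.trans (le_of_eq (by simp)))
    rw [VectorFourier.fourierPowSMulRight_apply]
    have hw : |innerSL ℝ w w| = ‖w‖ ^ 2 := by
      rw [innerSL_apply_apply, real_inner_self_eq_norm_sq, abs_of_nonneg (by positivity)]
    simp only [neg_apply]
    simp [abs_of_pos Real.pi_pos, hw]
    ring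
  rcases (norm_nonneg w).eq_or_lt with h0 | h0
  · rcases Nat.eq_zero_or_pos n with rfl | hn
    · simpa using h4.trans (mul_le_mul_of_nonneg_right h2 (by positivity))
    · rw [← h0, mul_zero, zero_pow hn.ne', zero_mul]
      positivity
  · exact (le_of_mul_le_mul_right h4 (by positivity)).trans h2

namespace GSSpace

variable {s : ℝ} {d : ℕ}

/-- The short-time Fourier transform of `f ∈ Σ_s`, as a linear map in `f`. -/
noncomputable def gsStft (hs : 1 / 2 < s) (φ : GSSpace s d) :
    GSSpace s d →ₗ[ℂ] PhaseSpace d → ℂ where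
  toFun f z := stft hs φ (f.toDual hs) z
  map_add' f g := by
    funext z
    change ∫ y, (f y + g y) * starRingEnd ℂ (tfShift hs z φ y) =
      (∫ y, f y * starRingEnd ℂ (tfShift hs z φ y)) + ∫ y, g y * starRingEnd ℂ (tfShift hs z φ y)
    rw [← integral_add (integrable_mul_conj hs f _) (integrable_mul_conj hs g _)]
    simp only [add_mul]
  map_smul' c f := by
    funext z
    change ∫ y, (c * f y) * starRingEnd ℂ (tfShift hs z φ y) =
      c * ∫ y, f y * starRingEnd ℂ (tfShift hs z φ y)
    rw [← integral_const_mul]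
    simp only [mul_assoc]

theorem gsStft_apply (hs : 1 / 2 < s) (φ f : GSSpace s d) (z : PhaseSpace d) :
    gsStft hs φ f z = ∫ y, f y * starRingEnd ℂ (tfShift hs z φ y) := rfl

theorem stft_toDual (hs : 1 / 2 < s) (φ f : GSSpace s d) (z : PhaseSpace d) :
    stft hs φ (f.toDual hs) z = gsStft hs φ f z := rfl

theorem continuous_coe (f : GSSpace s d) : Continuous f.1 := f.2.1.continuous

theorem continuous_gsStft (hs : 1 / 2 < s) (φ f : GSSpace s d) : Continuous (gsStft hs φ f) := by
  refine continuous_of_dominated (F := fun z y => f y * starRingEnd ℂ (tfShift hs z φ y))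
    (bound := fun y => ‖f y‖ * gsSeminorm s d ⟨1, one_pos⟩ φ) (fun z => ?_) (fun z => ?_) ?_ ?_
  · exact ((continuous_coe f).mul
      (Complex.continuous_conj.comp (continuous_coe (tfShift hs z φ)))).aestronglyMeasurable
  · refine Filter.Eventually.of_forall fun y => ?_
    rw [norm_mul, RCLike.norm_conj, norm_tfShift_apply]
    gcongr
    exact norm_apply_le φ _
  · exact (integrable hs f).norm.mul_const _
  · refine Filter.Eventually.of_forall fun y => ?_
    have h1 : Continuous fun z : PhaseSpace d => tfShift hs z φ y := by
      have h2 : Continuous fun z : PhaseSpace d => φ (y - z.1) :=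
        (continuous_coe φ).comp (by fun_prop)
      have h3 : Continuous fun z : PhaseSpace d =>
          Complex.exp (Complex.I * ((inner ℝ y z.2 : ℝ) : ℂ)) := by fun_prop
      exact h3.mul h2
    exact continuous_const.mul (Complex.continuous_conj.comp h1)

/-- The product of `f` with the conjugate of the translated window. -/
noncomputable def windowed (φ f : GSSpace s d) (x y : RSpace d) : ℂ :=
  f y * starRingEnd ℂ (φ (y - x))

theorem contDiff_windowed (hs : 1 / 2 < s) (φ f : GSSpace s d) (x : RSpace d) :
    ContDiff ℝ ∞ (windowed φ f x) :=
  f.2.1.mul (((φ.conj hs).2.1).comp (contDiff_id.sub contDiff_const))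

open scoped FourierTransform in
theorem gsStft_eq_fourier (hs : 1 / 2 < s) (φ f : GSSpace s d) (x w : RSpace d) :
    𝓕 (windowed φ f x) w = gsStft hs φ f (x, (2 * Real.pi) • w) := by
  rw [Real.fourier_eq', gsStft_apply]
  refine integral_congr_ae (Filter.Eventually.of_forall fun y => ?_)
  simp only [tfShift_apply, windowed, map_mul, ← Complex.exp_conj, Complex.conj_ofReal,
    Complex.conj_I, inner_smul_right, smul_eq_mul]
  rw [mul_left_comm]
  congr 2
  push_cast
  ring_nf

/-- Decay in frequency comes from the smoothness of `y ↦ f(y) conj φ(y - x)`: its `m`-th derivative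
bounds `‖ξ‖ ^ m` times the transform. Decay in position comes from the size of this product, since
`x = y + (x - y)` forces one factor to be small. The seminorm index depends only on `A`, and the
bound is linear in the seminorm of `f`. -/
theorem exists_norm_gsStft_le (hs : 1 / 2 < s) (φ : GSSpace s d) {A : ℝ} (hA : 0 < A) :
    ∃ (r : {h : ℝ // 0 < h}) (C : ℝ), 0 ≤ C ∧ ∀ (f : GSSpace s d) (z : PhaseSpace d),
      ‖gsStft hs φ f z‖ ≤ C * gsSeminorm s d r f * Real.exp (-(A * ‖z‖ ^ (1 / s))) := by
  have hs0 : 0 < s := by linarith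
  have hr : 0 ≤ 1 / s := by positivity
  -- Chosen so that `s / 2 * (t / h) ^ (1 / s) = A t ^ (1 / s)`, the rate produced by
  -- `le_exp_of_forall_pow_le`.
  set h : ℝ := (s / 2 / A) ^ s with hh
  have hh0 : 0 < h := by positivity
  have hhr : h ^ (1 / s) = s / 2 / A := by
    rw [hh, ← Real.rpow_mul (by positivity), mul_one_div_cancel hs0.ne', Real.rpow_one]
  -- The surplus 1 in the rate leaves a factor integrable in `y`.
  obtain ⟨r, C₁, hC₁, H₁⟩ := exists_expBound hs0 d (half_pos hh0) (2 ^ (1 / s) * A + 1)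
  obtain ⟨r₂, C₂, hC₂, H₂⟩ := exists_expBound hs0 d (half_pos hh0) (2 ^ (1 / s) * A)
  set M₂ := C₂ * gsSeminorm s d r₂ (φ.conj hs) with hM₂
  have hM₂0 : 0 ≤ M₂ := by positivity
  set J := ∫ y : RSpace d, Real.exp (-(1 * ‖y‖ ^ (1 / s))) with hJ
  have hJi := integrable_exp_neg_norm_rpow (volume : Measure (RSpace d)) hs0 one_pos
  have hJ0 : 0 ≤ J := integral_nonneg fun _ => (Real.exp_pos _).le
  refine ⟨r, 2 ^ s * (C₁ * M₂ * J), by positivity, fun f z => ?_⟩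
  obtain ⟨x, ξ⟩ := z
  set S := gsSeminorm s d r f
  have hS : 0 ≤ S := apply_nonneg _ _
  have hfc : ContDiff ℝ ∞ (fun y => φ.conj hs (y - x)) :=
    (φ.conj hs).2.1.comp (contDiff_id.sub contDiff_const)
  set X := Real.exp (-(A * ‖x‖ ^ (1 / s))) with hX
  have hD : ∀ (m : ℕ) (y : RSpace d), ‖iteratedFDeriv ℝ m (windowed φ f x) y‖ ≤
      (C₁ * S * M₂ * X * (h ^ m * (m.factorial : ℝ) ^ s)) *
        Real.exp (-(1 * ‖y‖ ^ (1 / s))) := by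
    intro m y
    have h1 := norm_iteratedFDeriv_mul_le f.2.1 hfc y (n := m) (by exact_mod_cast le_top)
    set Y₁ := Real.exp (-((2 ^ (1 / s) * A + 1) * ‖y‖ ^ (1 / s))) with hY₁
    set Y₂ := Real.exp (-(2 ^ (1 / s) * A * ‖y - x‖ ^ (1 / s))) with hY₂
    have h2 := sum_choose_mul_le hs0.le (half_pos hh0) (A := C₁ * S * Y₁) (B := M₂ * Y₂)
      (a := fun k => ‖iteratedFDeriv ℝ k f y‖)
      (b := fun k => ‖iteratedFDeriv ℝ k (φ.conj hs) (y - x)‖)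
      (by positivity) (by positivity) (fun k => by positivity)
      (fun k => (H₁ f k _).trans (le_of_eq (by ring)))
      (fun k => (H₂ (φ.conj hs) k _).trans (le_of_eq (by ring))) m
    have h3 : Y₁ * Y₂ ≤ X * Real.exp (-(1 * ‖y‖ ^ (1 / s))) := by
      rw [hX, hY₁, hY₂, ← Real.exp_add, ← Real.exp_add, Real.exp_le_exp]
      have h4 := norm_add_rpow_le hr y (x - y)
      rw [add_sub_cancel, norm_sub_rev x y] at h4
      have := mul_le_mul_of_nonneg_left h4 hA.le
      linarith
    calc _ ≤ _ := h1
      _ = ∑ k ∈ Finset.range (m + 1), (m.choose k : ℝ) * ‖iteratedFDeriv ℝ k f y‖ *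
          ‖iteratedFDeriv ℝ (m - k) (φ.conj hs) (y - x)‖ := by
        refine Finset.sum_congr rfl fun k _ => ?_
        rw [iteratedFDeriv_comp_sub]
      _ ≤ _ := h2
      _ = C₁ * S * M₂ * (h ^ m * (m.factorial : ℝ) ^ s) * (Y₁ * Y₂) := by
        rw [show 2 * (h / 2) = h by ring]
        ring
      _ ≤ C₁ * S * M₂ * (h ^ m * (m.factorial : ℝ) ^ s) *
          (X * Real.exp (-(1 * ‖y‖ ^ (1 / s)))) := mul_le_mul_of_nonneg_left h3 (by positivity)
      _ = _ := by ring
  have hsm := contDiff_windowed hs φ f x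
  have hDi : ∀ m, Integrable (iteratedFDeriv ℝ m (windowed φ f x)) := fun m =>
    (hJi.const_mul _).mono' (hsm.continuous_iteratedFDeriv
      (by exact_mod_cast le_top)).aestronglyMeasurable (Filter.Eventually.of_forall (hD m))
  have hpi : 0 < 2 * Real.pi := by positivity
  have hV : ∀ m : ℕ, ‖gsStft hs φ f (x, ξ)‖ * ‖ξ‖ ^ m ≤
      C₁ * S * M₂ * X * J * (h ^ m * (m.factorial : ℝ) ^ s) := by
    intro m
    have h1 := two_pi_mul_norm_pow_mul_norm_fourier_le hsm hDi m ((2 * Real.pi)⁻¹ • ξ)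
    rw [gsStft_eq_fourier hs, smul_inv_smul₀ hpi.ne', norm_smul, Real.norm_of_nonneg (by positivity),
      mul_inv_cancel_left₀ hpi.ne', mul_comm] at h1
    refine h1.trans ?_
    refine (integral_mono (hDi m).norm (hJi.const_mul _) (hD m)).trans ?_
    rw [integral_const_mul]
    exact le_of_eq (by ring)
  have h5 := le_exp_of_forall_pow_le hs0 hh0 (norm_nonneg _) (norm_nonneg ξ) (by positivity) hV
  rw [Real.div_rpow (norm_nonneg _) hh0.le, hhr,
    show s / 2 * (‖ξ‖ ^ (1 / s) / (s / 2 / A)) = A * ‖ξ‖ ^ (1 / s) by field_simp] at h5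
  refine h5.trans ?_
  have h6 : X * Real.exp (-(A * ‖ξ‖ ^ (1 / s))) ≤
      Real.exp (-(A * ‖((x, ξ) : PhaseSpace d)‖ ^ (1 / s))) := by
    rw [hX, ← Real.exp_add, Real.exp_le_exp]
    have := mul_le_mul_of_nonneg_left (norm_prod_rpow_le (1 / s) ((x, ξ) : PhaseSpace d)) hA.le
    simp only at this
    linarith
  calc _ = 2 ^ s * (C₁ * M₂ * J) * S * (X * Real.exp (-(A * ‖ξ‖ ^ (1 / s)))) := by ring
    _ ≤ _ := mul_le_mul_of_nonneg_left h6 (by positivity)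

theorem gsStft_tfShift (hs : 1 / 2 < s) (φ ψ : GSSpace s d) (z q : PhaseSpace d) :
    gsStft hs φ (tfShift hs q ψ) z =
      Complex.exp (Complex.I * (inner ℝ q.1 (q.2 - z.2) : ℝ)) * gsStft hs φ ψ (z - q) := by
  rw [gsStft_apply, gsStft_apply, ← integral_add_right_eq_self _ q.1, ← integral_const_mul]
  refine integral_congr_ae (Filter.Eventually.of_forall fun y => ?_)
  simp only [tfShift_apply, map_mul, ← Complex.exp_conj, Complex.conj_ofReal, Complex.conj_I,
    add_sub_cancel_right, Prod.fst_sub, Prod.snd_sub]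
  rw [show y + q.1 - z.1 = y - (z.1 - q.1) by abel]
  have : Complex.exp (Complex.I * (inner ℝ (y + q.1) q.2 : ℝ)) *
      Complex.exp (-Complex.I * (inner ℝ (y + q.1) z.2 : ℝ)) =
      Complex.exp (Complex.I * (inner ℝ q.1 (q.2 - z.2) : ℝ)) *
      Complex.exp (-Complex.I * (inner ℝ y (z.2 - q.2) : ℝ)) := by
    rw [← Complex.exp_add, ← Complex.exp_add]
    congr 1
    simp only [inner_add_left, inner_sub_right]
    push_cast
    ring
  linear_combination (ψ y * starRingEnd ℂ (φ (y - (z.1 - q.1)))) * this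

theorem norm_gsStft_tfShift (hs : 1 / 2 < s) (φ ψ : GSSpace s d) (z q : PhaseSpace d) :
    ‖gsStft hs φ (tfShift hs q ψ) z‖ = ‖gsStft hs φ ψ (z - q)‖ := by
  rw [gsStft_tfShift, norm_mul, Complex.norm_exp]
  simp

theorem exists_norm_gsStft_le_exp (hs : 1 / 2 < s) (φ f : GSSpace s d) {A : ℝ} (hA : 0 < A) :
    ∃ C : ℝ, 0 ≤ C ∧ ∀ z : PhaseSpace d,
      ‖gsStft hs φ f z‖ ≤ C * Real.exp (-(A * ‖z‖ ^ (1 / s))) := by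
  obtain ⟨r, C, hC, H⟩ := exists_norm_gsStft_le hs φ hA
  exact ⟨C * gsSeminorm s d r f, by positivity, H f⟩

end GSSpace

namespace GSSpace

variable {s : ℝ} {d : ℕ}

/-! ### Inversion and reproducing formulas on `Σ_s` -/

theorem integrable_exp_neg_phaseSpace (hs : 1 / 2 < s) (d : ℕ) {A : ℝ} (hA : 0 < A) :
    Integrable (fun z : PhaseSpace d => Real.exp (-(A * ‖z‖ ^ (1 / s)))) := by
  have : (volume : Measure (PhaseSpace d)).IsAddHaarMeasure :=
    Measure.prod.instIsAddHaarMeasure _ _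
  exact integrable_exp_neg_norm_rpow _ (by linarith) hA

theorem integrable_gsStft (hs : 1 / 2 < s) (φ f : GSSpace s d) : Integrable (gsStft hs φ f) := by
  obtain ⟨C, hC, H⟩ := exists_norm_gsStft_le_exp hs φ f one_pos
  exact ((integrable_exp_neg_phaseSpace hs d one_pos).const_mul C).mono' (continuous_gsStft hs φ f).aestronglyMeasurable
    (Filter.Eventually.of_forall H)

theorem continuous_windowed (φ f : GSSpace s d) (x : RSpace d) : Continuous (windowed φ f x) := by
  have h2 : Continuous fun y : RSpace d => φ (y - x) := (continuous_coe φ).comp (by fun_prop)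
  exact (continuous_coe f).mul (Complex.continuous_conj.comp h2)

theorem integrable_windowed (hs : 1 / 2 < s) (φ f : GSSpace s d) (x : RSpace d) :
    Integrable (windowed φ f x) := by
  refine (integrable hs f).mul_bdd (c := gsSeminorm s d ⟨1, one_pos⟩ φ) ?_ ?_
  · have h2 : Continuous fun y : RSpace d => φ (y - x) := (continuous_coe φ).comp (by fun_prop)
    exact (Complex.continuous_conj.comp h2).aestronglyMeasurable
  · exact Filter.Eventually.of_forall fun y => by
      rw [RCLike.norm_conj]
      exact norm_apply_le φ _

open scoped FourierTransform in
-- Fourier inversion for the windowed function at fixed `x`. The factor `(2π) ^ d` is the Jacobian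
-- of `ξ = 2π w`, which reconciles the two normalizations.
theorem integral_gsStft_frequency (hs : 1 / 2 < s) (φ f : GSSpace s d) (x y : RSpace d) :
    ∫ ξ : RSpace d, gsStft hs φ f (x, ξ) * Complex.exp (Complex.I * (inner ℝ y ξ : ℝ)) =
      (2 * Real.pi) ^ d * windowed φ f x y := by
  have hs0 : 0 < s := by linarith
  have hpi : 1 ≤ 2 * Real.pi := by linarith [Real.pi_gt_three]
  have hc : Continuous (𝓕 (windowed φ f x)) := by
    have : 𝓕 (windowed φ f x) = fun w => gsStft hs φ f (x, (2 * Real.pi) • w) :=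
      funext fun w => gsStft_eq_fourier hs φ f x w
    rw [this]
    exact (continuous_gsStft hs φ f).comp (by fun_prop)
  have hF : Integrable (𝓕 (windowed φ f x)) := by
    obtain ⟨C, hC, H⟩ := exists_norm_gsStft_le_exp hs φ f one_pos
    refine ((integrable_exp_neg_norm_rpow (volume : Measure (RSpace d)) hs0
      one_pos).const_mul C).mono' hc.aestronglyMeasurable
      (Filter.Eventually.of_forall fun w => ?_)
    rw [gsStft_eq_fourier hs]
    refine (H _).trans ?_
    have h1 : ‖w‖ ≤ ‖((x, (2 * Real.pi) • w) : PhaseSpace d)‖ := by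
      refine le_trans ?_ (norm_snd_le _)
      rw [norm_smul, Real.norm_of_nonneg (by positivity)]
      exact le_mul_of_one_le_left (norm_nonneg _) hpi
    gcongr
  have h1 := congrFun ((continuous_windowed φ f x).fourierInv_fourier_eq
    (integrable_windowed hs φ f x) hF) y
  rw [Real.fourierInv_eq'] at h1
  have h2 := Measure.integral_comp_smul (volume : Measure (RSpace d))
    (fun ξ => gsStft hs φ f (x, ξ) * Complex.exp (Complex.I * (inner ℝ y ξ : ℝ))) (2 * Real.pi)
  have h3 : ∫ w : RSpace d, gsStft hs φ f (x, (2 * Real.pi) • w) *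
      Complex.exp (Complex.I * (inner ℝ y ((2 * Real.pi) • w) : ℝ)) = windowed φ f x y := by
    rw [← h1]
    refine integral_congr_ae (Filter.Eventually.of_forall fun w => ?_)
    simp only [gsStft_eq_fourier hs, smul_eq_mul, inner_smul_right, real_inner_comm w y]
    rw [mul_comm, mul_comm Complex.I]
  rw [h3, finrank_euclideanSpace_fin] at h2
  rw [h2, abs_of_pos (by positivity), Complex.real_smul]
  have : (2 * Real.pi : ℂ) ^ d ≠ 0 := by
    have := Real.pi_ne_zero
    simp [this]
  push_cast
  rw [mul_inv_cancel_left₀ this]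

theorem integral_norm_sq_ne_zero (hs : 1 / 2 < s) {φ : GSSpace s d} (hφ : φ ≠ 0) :
    ∫ x, φ x * starRingEnd ℂ (φ x) ≠ 0 := by
  have h1 : ∀ x, φ x * starRingEnd ℂ (φ x) = ((‖φ x‖ ^ 2 : ℝ) : ℂ) := fun x => by
    rw [Complex.mul_conj']
    push_cast
    rfl
  have hi : Integrable fun x => ‖φ x‖ ^ 2 := by
    refine (integrable_mul_conj hs φ φ).norm.congr (Filter.Eventually.of_forall fun x => ?_)
    simp [sq]
  simp only [h1]
  rw [integral_complex_ofReal, Complex.ofReal_ne_zero]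
  intro h0
  rw [integral_eq_zero_iff_of_nonneg (fun x => by positivity) hi] at h0
  have hc : Continuous fun x => ‖φ x‖ ^ 2 := (continuous_coe φ).norm.pow 2
  rw [hc.ae_eq_iff_eq _ continuous_zero] at h0
  refine hφ (GSSpace.ext fun x => ?_)
  have h1 := congrFun h0 x
  simp only [Pi.zero_apply, ne_eq, OfNat.ofNat_ne_zero, not_false_eq_true, pow_eq_zero_iff,
    norm_eq_zero] at h1
  exact h1

/-- Integrating over frequency leaves `(2π) ^ d f(y) |φ(y - x)|²`, and integrating over position
then gives `(2π) ^ d ‖φ‖² f(y)`. Only the independence of `c` from `f` and `y` is needed later. -/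
theorem exists_inversion (hs : 1 / 2 < s) {φ : GSSpace s d} (hφ : φ ≠ 0) :
    ∃ c : ℂ, ∀ (f : GSSpace s d) (y : RSpace d),
      f y = c * ∫ z, gsStft hs φ f z * tfShift hs z φ y := by
  have hN := integral_norm_sq_ne_zero hs hφ
  set N := ∫ x, φ x * starRingEnd ℂ (φ x) with hNdef
  have hpi : (2 * Real.pi : ℂ) ^ d ≠ 0 := by
    have := Real.pi_ne_zero
    simp [this]
  refine ⟨((2 * Real.pi : ℂ) ^ d * N)⁻¹, fun f y => ?_⟩
  have hc : Continuous fun z : PhaseSpace d => tfShift hs z φ y := by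
    have h2 : Continuous fun z : PhaseSpace d => φ (y - z.1) :=
      (continuous_coe φ).comp (by fun_prop)
    have h3 : Continuous fun z : PhaseSpace d =>
        Complex.exp (Complex.I * ((inner ℝ y z.2 : ℝ) : ℂ)) := by fun_prop
    exact h3.mul h2
  have hi : Integrable fun z : PhaseSpace d => gsStft hs φ f z * tfShift hs z φ y := by
    refine (integrable_gsStft hs φ f).mul_bdd (c := gsSeminorm s d ⟨1, one_pos⟩ φ)
      hc.aestronglyMeasurable (Filter.Eventually.of_forall fun z => ?_)
    rw [norm_tfShift_apply]
    exact norm_apply_le φ _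
  rw [Measure.volume_eq_prod] at hi ⊢
  rw [integral_prod _ hi]
  have h1 : ∀ x : RSpace d, ∫ ξ, gsStft hs φ f (x, ξ) * tfShift hs (x, ξ) φ y =
      (2 * Real.pi) ^ d * f y * (φ (y - x) * starRingEnd ℂ (φ (y - x))) := by
    intro x
    have := integral_gsStft_frequency hs φ f x y
    simp only [tfShift_apply, ← mul_assoc]
    rw [integral_mul_const, this, windowed]
    ring
  simp only [h1]
  rw [integral_const_mul,
    integral_sub_left_eq_self (fun x => φ x * starRingEnd ℂ (φ x)) volume y, ← hNdef]
  field_simp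

/-- The inversion formula integrated against the conjugate of `π(w)ψ`, with Fubini. -/
theorem reproducing (hs : 1 / 2 < s) {φ : GSSpace s d} {c : ℂ}
    (hc : ∀ (f : GSSpace s d) (y : RSpace d), f y = c * ∫ z, gsStft hs φ f z * tfShift hs z φ y)
    (ψ f : GSSpace s d) (w : PhaseSpace d) :
    gsStft hs ψ f w = c * ∫ z, gsStft hs φ f z * gsStft hs ψ (tfShift hs z φ) w := by
  set g := tfShift hs w ψ with hg
  have h1 : gsStft hs ψ f w =
      ∫ y, c * ∫ z, gsStft hs φ f z * tfShift hs z φ y * starRingEnd ℂ (g y) := by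
    rw [gsStft_apply]
    refine integral_congr_ae (Filter.Eventually.of_forall fun y => ?_)
    dsimp only
    rw [integral_mul_const, ← mul_assoc, ← hc f y]
  rw [h1, integral_const_mul]
  congr 1
  rw [integral_integral_swap]
  · refine integral_congr_ae (Filter.Eventually.of_forall fun z => ?_)
    dsimp only
    rw [gsStft_apply hs ψ, ← integral_const_mul]
    simp only [mul_assoc, ← hg]
  · have hb := (((integrable hs g).norm.mul_prod (integrable_gsStft hs φ f).norm)).mul_const
      (gsSeminorm s d ⟨1, one_pos⟩ φ)
    refine hb.mono' ?_ (Filter.Eventually.of_forall fun p => ?_)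
    · refine Continuous.aestronglyMeasurable ?_
      have h2 : Continuous fun p : RSpace d × PhaseSpace d => φ (p.1 - p.2.1) :=
        (continuous_coe φ).comp (by fun_prop)
      have h3 : Continuous fun p : RSpace d × PhaseSpace d =>
          Complex.exp (Complex.I * ((inner ℝ p.1 p.2.2 : ℝ) : ℂ)) := by fun_prop
      exact (((continuous_gsStft hs φ f).comp continuous_snd).mul (h3.mul h2)).mul
        (Complex.continuous_conj.comp ((continuous_coe g).comp continuous_fst))
    · simp only [Function.uncurry_def, norm_mul, RCLike.norm_conj, norm_tfShift_apply]
      have := norm_apply_le φ (p.1 - p.2.1)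
      calc _ ≤ ‖gsStft hs φ f p.2‖ * gsSeminorm s d ⟨1, one_pos⟩ φ * ‖g p.1‖ := by gcongr
        _ = _ := by ring

end GSSpace

/-! ### Differentiation under the integral sign -/

theorem iteratedFDeriv_integral_eq {Z E F : Type*} [MeasurableSpace Z] {μ : Measure Z}
    [NormedAddCommGroup E] [NormedSpace ℝ E] [NormedAddCommGroup F] [NormedSpace ℝ F]
    [CompleteSpace F] {H : Z → E → F} (hH : ∀ z, ContDiff ℝ ∞ (H z))
    (hmeas : ∀ m y, AEStronglyMeasurable (fun z => iteratedFDeriv ℝ m (H z) y) μ)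
    {B : ℕ → Z → ℝ} (hB : ∀ m, Integrable (B m) μ)
    (hle : ∀ m z y, ‖iteratedFDeriv ℝ m (H z) y‖ ≤ B m z) (m : ℕ) :
    iteratedFDeriv ℝ m (fun y => ∫ z, H z y ∂μ) =
      fun y => ∫ z, iteratedFDeriv ℝ m (H z) y ∂μ := by
  induction m with
  | zero =>
    funext y
    simp only [iteratedFDeriv_zero_eq_comp, Function.comp]
    exact ((continuousMultilinearCurryFin0 ℝ E F).symm.toContinuousLinearEquiv.integral_comp_comm
      _).symm
  | succ m ih =>
    funext y
    have hd : ∀ z, HasFDerivAt (iteratedFDeriv ℝ m (H z))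
        (fderiv ℝ (iteratedFDeriv ℝ m (H z)) y) y := fun z =>
      ((hH z).differentiable_iteratedFDeriv (by exact_mod_cast WithTop.coe_lt_top _) y).hasFDerivAt
    have hd' : ∀ z x, HasFDerivAt (iteratedFDeriv ℝ m (H z))
        (fderiv ℝ (iteratedFDeriv ℝ m (H z)) x) x := fun z x =>
      ((hH z).differentiable_iteratedFDeriv (by exact_mod_cast WithTop.coe_lt_top _) x).hasFDerivAt
    -- The derivative of the `m`-th derivative is the `(m + 1)`-st one after currying. Currying is
    -- an isometry, so the bound `B (m + 1)` dominates it and the integral commutes with it.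
    set Φ := (continuousMultilinearCurryLeftEquiv ℝ (fun _ : Fin (m + 1) => E) F) with hΦ
    have hsucc : ∀ z x, fderiv ℝ (iteratedFDeriv ℝ m (H z)) x =
        Φ (iteratedFDeriv ℝ (m + 1) (H z) x) := fun z x => by
      rw [iteratedFDeriv_succ_eq_comp_left]
      simp [hΦ]
    have key := hasFDerivAt_integral_of_dominated_of_fderiv_le (𝕜 := ℝ) (μ := μ) (s := Set.univ)
      (F := fun y z => iteratedFDeriv ℝ m (H z) y)
      (F' := fun y z => fderiv ℝ (iteratedFDeriv ℝ m (H z)) y) (x₀ := y) (bound := B (m + 1))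
      Filter.univ_mem (Filter.Eventually.of_forall fun x => hmeas m x)
      ((hB m).mono' (hmeas m y) (Filter.Eventually.of_forall fun z => hle m z y))
      (by
        simp only [hsucc]
        exact Φ.continuous.comp_aestronglyMeasurable (hmeas (m + 1) y))
      (Filter.Eventually.of_forall fun z x _ => by
        rw [norm_fderiv_iteratedFDeriv]
        exact hle (m + 1) z x)
      (hB (m + 1)) (Filter.Eventually.of_forall fun z x _ => hd' z x)
    rw [iteratedFDeriv_succ_eq_comp_left, ih]
    simp only [Function.comp]
    rw [key.fderiv]
    simp only [hsucc]
    rw [show (∫ z, Φ (iteratedFDeriv ℝ (m + 1) (H z) y) ∂μ) =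
      Φ (∫ z, iteratedFDeriv ℝ (m + 1) (H z) y ∂μ) from
        Φ.toContinuousLinearEquiv.integral_comp_comm _]
    simp [hΦ]

/-- Gives continuity, hence measurability, in the parameter of derivatives taken in the other
variable. The induction treats the whole pair `(z, y)` as the parameter of the next derivative. -/
theorem contDiff_iteratedFDeriv_uncurry {Z E F : Type*} [NormedAddCommGroup Z] [NormedSpace ℝ Z]
    [NormedAddCommGroup E] [NormedSpace ℝ E] [NormedAddCommGroup F] [NormedSpace ℝ F]
    {G : Z → E → F} (hG : ContDiff ℝ ∞ (Function.uncurry G)) (m : ℕ) :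
    ContDiff ℝ ∞ (fun p : Z × E => iteratedFDeriv ℝ m (G p.1) p.2) := by
  induction m with
  | zero =>
    simp only [iteratedFDeriv_zero_eq_comp, Function.comp]
    exact (continuousMultilinearCurryFin0 ℝ E F).symm.contDiff.comp hG
  | succ m ih =>
    simp only [iteratedFDeriv_succ_eq_comp_left, Function.comp]
    refine (continuousMultilinearCurryLeftEquiv ℝ (fun _ => E) F).symm.contDiff.comp ?_
    have h1 : ContDiff ℝ ∞ (Function.uncurry fun (p : Z × E) (y : E) =>
        iteratedFDeriv ℝ m (G p.1) y) :=
      ih.comp (contDiff_fst.fst.prodMk contDiff_snd)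
    exact h1.fderiv contDiff_snd (by exact_mod_cast le_top)

theorem continuous_iteratedFDeriv_left {Z E F : Type*} [NormedAddCommGroup Z] [NormedSpace ℝ Z]
    [NormedAddCommGroup E] [NormedSpace ℝ E] [NormedAddCommGroup F] [NormedSpace ℝ F]
    {G : Z → E → F} (hG : ContDiff ℝ ∞ (Function.uncurry G)) (m : ℕ) (y : E) :
    Continuous fun z => iteratedFDeriv ℝ m (G z) y :=
  (contDiff_iteratedFDeriv_uncurry hG m).continuous.comp
    (Continuous.prodMk continuous_id continuous_const)

/-! ### Recovering the seminorms from the short-time Fourier transform -/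

namespace GSSpace

variable {s : ℝ} {d : ℕ}

theorem contDiff_tfShift_uncurry (hs : 1 / 2 < s) (φ : GSSpace s d) :
    ContDiff ℝ ∞ (Function.uncurry fun z : PhaseSpace d => (tfShift hs z φ).1) := by
  have h1 : ContDiff ℝ ∞ fun p : PhaseSpace d × RSpace d => φ (p.2 - p.1.1) :=
    φ.2.1.comp (contDiff_snd.sub contDiff_fst.fst)
  have h2 : ContDiff ℝ ∞ fun p : PhaseSpace d × RSpace d => ((inner ℝ p.2 p.1.2 : ℝ) : ℂ) :=
    Complex.ofRealCLM.contDiff.comp (contDiff_snd.inner ℝ contDiff_fst.snd)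
  exact (contDiff_const.mul h2).cexp.mul h1

theorem integrable_gsStft_mul_exp (hs : 1 / 2 < s) (φ f : GSSpace s d) (b : ℝ) :
    Integrable fun z => ‖gsStft hs φ f z‖ * Real.exp (b * ‖z‖ ^ (1 / s)) := by
  have hs0 : 0 < s := by linarith
  obtain ⟨C, hC, H⟩ := exists_norm_gsStft_le_exp hs φ f (A := |b| + 1) (by positivity)
  refine ((integrable_exp_neg_phaseSpace hs d one_pos).const_mul C).mono'
    ((continuous_gsStft hs φ f).norm.mul
      (continuous_exp_norm_rpow hs0 b)).aestronglyMeasurable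
    (Filter.Eventually.of_forall fun z => ?_)
  rw [Real.norm_of_nonneg (by positivity)]
  calc _ ≤ C * Real.exp (-((|b| + 1) * ‖z‖ ^ (1 / s))) * Real.exp (|b| * ‖z‖ ^ (1 / s)) := by
        gcongr
        · exact H z
        · exact le_abs_self b
    _ = _ := by
        rw [mul_assoc, ← Real.exp_add]
        ring_nf

/-- The seminorms of `Σ_s` are controlled by weighted integrals of the short-time Fourier
transform. -/
theorem exists_gsSeminorm_le_integral (hs : 1 / 2 < s) {φ : GSSpace s d} (hφ : φ ≠ 0)
    (h : {h : ℝ // 0 < h}) : ∃ M b : ℝ, 0 ≤ M ∧ 0 ≤ b ∧ ∀ f : GSSpace s d,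
      gsSeminorm s d h f ≤ M * ∫ z, ‖gsStft hs φ f z‖ * Real.exp (b * ‖z‖ ^ (1 / s)) := by
  have hs0 : 0 < s := by linarith
  obtain ⟨c, hc⟩ := exists_inversion hs hφ
  obtain ⟨η, A, hη, hA, H⟩ := exists_gsSeminorm_le_of_expBound hs0 d h
  obtain ⟨M, b, hM, hb, HM⟩ := exists_gsSeminorm_tfShift_le hs φ hη hA
  refine ⟨‖c‖ * M, b, by positivity, hb, fun f => H f _ (by positivity) fun m y => ?_⟩
  -- The inversion formula writes `f` as a superposition of shifts of `φ`, each with an exponential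
  -- bound growing like `exp(b |z|^{1/s})`. Differentiating under the integral transfers these
  -- bounds to `f`.
  set G : PhaseSpace d → RSpace d → ℂ := fun z => (c * gsStft hs φ f z) • (tfShift hs z φ).1
    with hG
  have hf : f.1 = fun y => ∫ z, G z y := by
    funext y
    have h1 := hc f y
    rw [← integral_const_mul] at h1
    refine h1.trans (integral_congr_ae (Filter.Eventually.of_forall fun z => ?_))
    simp only [hG, Pi.smul_apply, smul_eq_mul, mul_assoc]
  have hsm : ∀ z, ContDiff ℝ ∞ (tfShift hs z φ).1 := fun z => (tfShift hs z φ).2.1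
  have hit : ∀ m z y, iteratedFDeriv ℝ m (G z) y =
      (c * gsStft hs φ f z) • iteratedFDeriv ℝ m (tfShift hs z φ).1 y := fun m z y =>
    iteratedFDeriv_const_smul_apply ((hsm z).of_le (by exact_mod_cast le_top)).contDiffAt
  set B : ℕ → PhaseSpace d → ℝ := fun m z => ‖c‖ * M * (η ^ m * (m.factorial : ℝ) ^ s) *
    (‖gsStft hs φ f z‖ * Real.exp (b * ‖z‖ ^ (1 / s))) with hB
  have hBi : ∀ m, Integrable (B m) := fun m =>
    (integrable_gsStft_mul_exp hs φ f b).const_mul _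
  have hle : ∀ m z y, ‖iteratedFDeriv ℝ m (G z) y‖ ≤
      B m z * Real.exp (-(A * ‖y‖ ^ (1 / s))) := by
    intro m z y
    rw [hit, norm_smul, norm_mul]
    calc _ ≤ ‖c‖ * ‖gsStft hs φ f z‖ * _ := mul_le_mul_of_nonneg_left (HM z m y) (by positivity)
      _ = _ := by simp only [hB]; ring
  have hle' : ∀ m z y, ‖iteratedFDeriv ℝ m (G z) y‖ ≤ B m z := fun m z y => by
    refine (hle m z y).trans (mul_le_of_le_one_right (by positivity) ?_)
    rw [Real.exp_le_one_iff]
    have : 0 ≤ A * ‖y‖ ^ (1 / s) := by positivity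
    linarith
  have hmeas : ∀ m y, AEStronglyMeasurable (fun z => iteratedFDeriv ℝ m (G z) y) := by
    intro m y
    simp only [hit]
    refine Continuous.aestronglyMeasurable ?_
    have h2 := continuous_iteratedFDeriv_left (contDiff_tfShift_uncurry hs φ) m y
    exact (continuous_const.mul (continuous_gsStft hs φ f)).smul h2
  have hGs : ∀ z, ContDiff ℝ ∞ (G z) := fun z =>
    (hsm z).const_smul (c * gsStft hs φ f z)
  have hI : iteratedFDeriv ℝ m f.1 y = ∫ z, iteratedFDeriv ℝ m (G z) y :=
    (congrArg (fun g => iteratedFDeriv ℝ m g y) hf).trans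
      (congrFun (iteratedFDeriv_integral_eq hGs hmeas hBi hle' m) y)
  rw [hI]
  refine (norm_integral_le_of_norm_le ((hBi m).mul_const _)
    (Filter.Eventually.of_forall fun z => hle m z y)).trans (le_of_eq ?_)
  rw [integral_mul_const, integral_const_mul]
  ring

end GSSpace

/-! ### Functionals dominated by weighted integrals -/

section Representation

variable {E X Y : Type*} [AddCommGroup E] [Module ℂ E] [MeasurableSpace X] [MeasurableSpace Y]
  {μ : Measure X} {ν : Measure Y}

/-- The bound lets `l` factor through the range of `J` in `L²`; Hahn-Banach extends it to all of
`L²` and Riesz represents it. -/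
theorem exists_memLp_two_eq_integral (J : E →ₗ[ℂ] X → ℂ) (hJ : ∀ v, MemLp (J v) 2 μ)
    (l : E →ₗ[ℂ] ℂ) {C : ℝ} (hl : ∀ v, ‖l v‖ ≤ C * (eLpNorm (J v) 2 μ).toReal) :
    ∃ F : X → ℂ, MemLp F 2 μ ∧ ∀ v, l v = ∫ x, F x * J v x ∂μ := by
  let JL : E →ₗ[ℂ] Lp ℂ 2 μ :=
    { toFun := fun v => (hJ v).toLp (J v)
      map_add' := fun v w => by
        rw [← MemLp.toLp_add]
        congr 1
        exact map_add J v w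
      map_smul' := fun c v => by
        rw [RingHom.id_apply, ← MemLp.toLp_const_smul]
        congr 1
        exact map_smul J c v }
  have hl' : ∀ v, ‖l v‖ ≤ C * ‖JL v‖ := fun v => by
    refine (hl v).trans (le_of_eq ?_)
    rw [← Lp.norm_toLp (J v) (hJ v)]
    rfl
  -- A linear section of `J` over its range. The choice is immaterial: `l` vanishes on the kernel of
  -- `JL` by its bound.
  obtain ⟨σ, hσ⟩ := JL.rangeRestrict.exists_rightInverse_of_surjective JL.range_rangeRestrict
  have hσ' : ∀ w : LinearMap.range JL, JL (σ w) = w := fun w =>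
    congrArg Subtype.val (LinearMap.congr_fun hσ w)
  let f : LinearMap.range JL →L[ℂ] ℂ := (l ∘ₗ σ).mkContinuous C fun w => by
    refine (hl' (σ w)).trans (le_of_eq ?_)
    rw [hσ']
    rfl
  obtain ⟨G, hG, -⟩ := exists_extension_norm_eq (𝕜 := ℂ) (LinearMap.range JL) f
  set F := (InnerProductSpace.toDual ℂ (Lp ℂ 2 μ)).symm G with hF
  -- The inner product conjugates its first argument.
  refine ⟨fun x => starRingEnd ℂ (F x), ?_, fun v => ?_⟩
  · exact (memLp_congr_norm (Complex.continuous_conj.comp_aestronglyMeasurable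
      (Lp.memLp F).aestronglyMeasurable) (Lp.memLp F).aestronglyMeasurable
      (Filter.Eventually.of_forall fun x => by simp)).2 (Lp.memLp F)
  · have h1 : l v = G (JL v) := by
      have h2 := hG ⟨JL v, LinearMap.mem_range_self JL v⟩
      rw [h2]
      change l v = l (σ _)
      rw [← sub_eq_zero, ← map_sub, ← norm_eq_zero]
      refine le_antisymm ((hl' _).trans (le_of_eq ?_)) (norm_nonneg _)
      rw [map_sub, hσ']
      simp
    rw [h1, ← InnerProductSpace.toDual_symm_apply, ← hF, L2.inner_def]
    refine integral_congr_ae ?_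
    filter_upwards [(hJ v).coeFn_toLp] with x hx
    rw [RCLike.inner_apply, mul_comm]
    exact congrArg _ hx

/-- A linear functional dominated by a weighted `L¹` norm of a transform `V v` is an integral
against `V v`. -/
theorem exists_eq_integral_of_le_integral (V : E →ₗ[ℂ] X → ℂ) {g h : X → ℝ}
    (hg : ∀ x, 0 ≤ g x) (hh : ∀ x, 0 ≤ h x)
    (hV : ∀ v, MemLp (fun x => (g x : ℂ) * V v x) 2 μ) (hh2 : MemLp h 2 μ)
    (l : E →ₗ[ℂ] ℂ) {C : ℝ} (hC : 0 ≤ C)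
    (hl : ∀ v, ‖l v‖ ≤ C * ∫ x, ‖V v x‖ * (g x * h x) ∂μ) :
    ∃ F : X → ℂ, MemLp F 2 μ ∧ ∀ v, l v = ∫ x, F x * ((g x : ℂ) * V v x) ∂μ := by
  let J : E →ₗ[ℂ] X → ℂ :=
    { toFun := fun v x => (g x : ℂ) * V v x
      map_add' := fun v w => by funext x; simp [mul_add]
      map_smul' := fun c v => by funext x; simp [mul_left_comm] }
  -- Cauchy-Schwarz: splitting the weight as `g h` with `h ∈ L²` bounds the weighted `L¹` norm by
  -- the `L²` norm of `g V v`.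
  refine exists_memLp_two_eq_integral J hV l (C := C * (eLpNorm h 2 μ).toReal) fun v => ?_
  refine (hl v).trans ?_
  rw [mul_assoc]
  refine mul_le_mul_of_nonneg_left ?_ hC
  have h1 : ∫ x, ‖V v x‖ * (g x * h x) ∂μ = (eLpNorm (h • J v) 1 μ).toReal := by
    have hm : AEStronglyMeasurable (h • J v) μ :=
      hh2.aestronglyMeasurable.smul (hV v).aestronglyMeasurable
    rw [eLpNorm_one_eq_lintegral_enorm, ← integral_norm_eq_lintegral_enorm hm]
    refine integral_congr_ae (Filter.Eventually.of_forall fun x => ?_)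
    change _ = ‖h x • ((g x : ℂ) * V v x)‖
    rw [norm_smul, norm_mul, Complex.norm_real, Real.norm_of_nonneg (hg x),
      Real.norm_of_nonneg (hh x)]
    ring
  rw [h1, ← ENNReal.toReal_mul]
  refine ENNReal.toReal_mono (ENNReal.mul_ne_top hh2.2.ne (hV v).2.ne) ?_
  exact eLpNorm_smul_le_mul_eLpNorm (hV v).aestronglyMeasurable hh2.aestronglyMeasurable

/-- A replacement for vector-valued integration: `u` need only be the superposition `∫ c(y) e(y)`
after applying the transform `V`. Since `l` is itself an integral against `V`, Fubini moves it
inside, and `E` needs no topology. -/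
theorem apply_eq_integral_of_eq_integral [SFinite μ] [SFinite ν] {V : E →ₗ[ℂ] X → ℂ} {g : X → ℝ}
    {l : E →ₗ[ℂ] ℂ} {F : X → ℂ} (hF : MemLp F 2 μ)
    (hl : ∀ v, l v = ∫ x, F x * ((g x : ℂ) * V v x) ∂μ) {u : E} {e : Y → E} {c : Y → ℂ}
    (hu : ∀ x, V u x = ∫ y, c y * V (e y) x ∂ν)
    (hm : AEStronglyMeasurable (fun p : X × Y => (g p.1 : ℂ) * (c p.2 * V (e p.2) p.1))
      (μ.prod ν)) {h : X → ℝ} {k : Y → ℝ} (hh : MemLp h 2 μ) (hk : Integrable k ν)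
    (hle : ∀ x y, ‖(g x : ℂ) * (c y * V (e y) x)‖ ≤ h x * k y) :
    l u = ∫ y, c y * l (e y) ∂ν := by
  have hFh : Integrable (fun x => ‖F x‖ * h x) μ := hF.norm.integrable_mul hh
  have hint : Integrable (Function.uncurry fun x y => F x * ((g x : ℂ) * (c y * V (e y) x)))
      (μ.prod ν) := by
    refine (hFh.mul_prod hk).mono' (hF.aestronglyMeasurable.comp_fst.mul hm)
      (Filter.Eventually.of_forall fun p => ?_)
    rw [Function.uncurry_def, norm_mul, mul_assoc]
    exact mul_le_mul_of_nonneg_left (hle _ _) (norm_nonneg _)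
  calc l u = ∫ x, ∫ y, F x * ((g x : ℂ) * (c y * V (e y) x)) ∂ν ∂μ := by
        rw [hl]
        refine integral_congr_ae (Filter.Eventually.of_forall fun x => ?_)
        simp only [integral_const_mul, hu]
    _ = ∫ y, ∫ x, F x * ((g x : ℂ) * (c y * V (e y) x)) ∂μ ∂ν := integral_integral_swap hint
    _ = _ := by
        refine integral_congr_ae (Filter.Eventually.of_forall fun y => ?_)
        dsimp only
        rw [hl, ← integral_const_mul]
        refine integral_congr_ae (Filter.Eventually.of_forall fun x => ?_)
        dsimp only
        ring

end Representation

namespace GSSpace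

variable {s : ℝ} {d : ℕ}

/-! ### The short-time Fourier transform on `Σ_s'` -/

theorem stft_apply (hs : 1 / 2 < s) (φ : GSSpace s d) (u : GSDual s d) (z : PhaseSpace d) :
    stft hs φ u z = u (tfShift hs z φ) := rfl


theorem gsSeminorm_anti (s : ℝ) (d : ℕ) {h h' : {h : ℝ // 0 < h}} (hle : h ≤ h')
    (f : GSSpace s d) : gsSeminorm s d h' f ≤ gsSeminorm s d h f := by
  refine ciSup_le fun p => le_trans ?_ (gsQuotient_le_gsSeminorm h f p)
  have h1 := gsDen_pos s h.2 p.1 p.2.1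
  have h2 : (h : ℝ) ≤ h' := hle
  have h3 := h.2.le
  simp only [gsQuotient]
  gcongr

/-- The seminorms increase as `h` decreases, so the finite supremum given by continuity is below a
single one. -/
theorem exists_le_gsSeminorm (u : GSDual s d) : ∃ (h : {h : ℝ // 0 < h}) (C : ℝ), 0 ≤ C ∧
    ∀ f : GSSpace s d, ‖u f‖ ≤ C * gsSeminorm s d h f := by
  obtain ⟨t, C, -, H⟩ := Seminorm.bound_of_continuous (withSeminorms s d)
    ((normSeminorm ℂ ℂ).comp u.toLinearMap) (continuous_norm.comp u.cont)
  obtain ⟨h, hh⟩ : ∃ h : {h : ℝ // 0 < h}, ∀ i ∈ t, h ≤ i :=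
    Finset.exists_le (α := {h : ℝ // 0 < h}ᵒᵈ) t
  refine ⟨h, C, C.2, fun f => (H f).trans ?_⟩
  change (C : ℝ) * (t.sup (gsSeminorm s d)) f ≤ _
  refine mul_le_mul_of_nonneg_left ?_ C.2
  exact Seminorm.finset_sup_apply_le (apply_nonneg _ _) fun i hi => gsSeminorm_anti s d (hh i hi) f

theorem exists_norm_stft_le (hs : 1 / 2 < s) (φ : GSSpace s d) (u : GSDual s d) :
    ∃ M b : ℝ, 0 ≤ M ∧ 0 ≤ b ∧ ∀ z : PhaseSpace d,
      ‖stft hs φ u z‖ ≤ M * Real.exp (b * ‖z‖ ^ (1 / s)) := by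
  obtain ⟨h, C, hC, H⟩ := exists_le_gsSeminorm u
  obtain ⟨η, A, hη, hA, H₁⟩ := exists_gsSeminorm_le_of_expBound (by linarith : 0 < s) d h
  obtain ⟨M, b, hM, hb, H₂⟩ := exists_gsSeminorm_tfShift_le hs φ hη hA
  refine ⟨C * M, b, by positivity, hb, fun z => ?_⟩
  rw [stft_apply, mul_assoc]
  refine (H _).trans ?_
  exact mul_le_mul_of_nonneg_left (H₁ _ _ (by positivity) (H₂ z)) hC

theorem exists_norm_le_integral (hs : 1 / 2 < s) {φ : GSSpace s d} (hφ : φ ≠ 0)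
    (u : GSDual s d) : ∃ M b : ℝ, 0 ≤ M ∧ 0 ≤ b ∧ ∀ f : GSSpace s d,
      ‖u f‖ ≤ M * ∫ z, ‖gsStft hs φ f z‖ * Real.exp (b * ‖z‖ ^ (1 / s)) := by
  obtain ⟨h, C, hC, H⟩ := exists_le_gsSeminorm u
  obtain ⟨M, b, hM, hb, H₁⟩ := exists_gsSeminorm_le_integral hs hφ h
  refine ⟨C * M, b, by positivity, hb, fun f => (H _).trans ?_⟩
  rw [mul_assoc]
  exact mul_le_mul_of_nonneg_left (H₁ f) hC

theorem memLp_two_exp_neg (hs : 1 / 2 < s) (d : ℕ) {A : ℝ} (hA : 0 < A) :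
    MemLp (fun z : PhaseSpace d => Real.exp (-(A * ‖z‖ ^ (1 / s)))) 2 := by
  have hm : AEStronglyMeasurable (fun z : PhaseSpace d => Real.exp (-(A * ‖z‖ ^ (1 / s)))) :=
    (integrable_exp_neg_phaseSpace hs d hA).aestronglyMeasurable
  rw [memLp_two_iff_integrable_sq hm]
  refine (integrable_exp_neg_phaseSpace hs d (A := 2 * A) (by positivity)).congr
    (Filter.Eventually.of_forall fun z => ?_)
  simp only [sq, ← Real.exp_add]
  ring_nf

theorem continuous_gsStft_tfShift (hs : 1 / 2 < s) (φ ψ : GSSpace s d) :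
    Continuous fun p : PhaseSpace d × PhaseSpace d => gsStft hs φ (tfShift hs p.2 ψ) p.1 := by
  simp only [gsStft_tfShift]
  have h1 : Continuous fun p : PhaseSpace d × PhaseSpace d => gsStft hs φ ψ (p.1 - p.2) :=
    (continuous_gsStft hs φ ψ).comp (by fun_prop)
  have h2 : Continuous fun p : PhaseSpace d × PhaseSpace d =>
    Complex.exp (Complex.I * ((inner ℝ p.2.1 (p.2.2 - p.1.2) : ℝ) : ℂ)) := by fun_prop
  exact h2.mul h1

/-- The conjugate of an element of `Σ_s'`, as a linear functional. -/
noncomputable def conjFunctional (u : GSDual s d) : GSSpace s d →ₗ[ℂ] ℂ where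
  toFun f := starRingEnd ℂ (u f)
  map_add' f g := by simp
  map_smul' c f := by simp

/-- The conjugate makes the functional complex linear. The rate `b` of the domination is raised by
1, and the compensating `exp(-|z|^{1/s})` is the `L²` part of the weight. -/
theorem exists_conj_apply_eq_integral (hs : 1 / 2 < s) {φ : GSSpace s d} (hφ : φ ≠ 0)
    (u : GSDual s d) : ∃ (b : ℝ) (F : PhaseSpace d → ℂ), 0 ≤ b ∧ MemLp F 2 ∧
      ∀ f : GSSpace s d, conjFunctional u f =
        ∫ z, F z * ((Real.exp (b * ‖z‖ ^ (1 / s)) : ℝ) * gsStft hs φ f z) := by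
  have hs0 : 0 < s := by linarith
  obtain ⟨M, b, hM, hb, H⟩ := exists_norm_le_integral hs hφ u
  have hV : ∀ f : GSSpace s d, MemLp (fun z : PhaseSpace d =>
      ((Real.exp ((b + 1) * ‖z‖ ^ (1 / s)) : ℝ) : ℂ) * gsStft hs φ f z) 2 := by
    intro f
    obtain ⟨C, hC, hCf⟩ := exists_norm_gsStft_le_exp hs φ f (A := b + 2) (by positivity)
    refine ((memLp_two_exp_neg hs d one_pos).const_mul C).mono' ?_
      (Filter.Eventually.of_forall fun z => ?_)
    · exact ((Complex.continuous_ofReal.comp (continuous_exp_norm_rpow hs0 _)).mul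
        (continuous_gsStft hs φ f)).aestronglyMeasurable
    · rw [norm_mul, Complex.norm_real, Real.norm_of_nonneg (Real.exp_pos _).le]
      calc _ ≤ Real.exp ((b + 1) * ‖z‖ ^ (1 / s)) * (C * Real.exp (-((b + 2) * ‖z‖ ^ (1 / s)))) :=
            mul_le_mul_of_nonneg_left (hCf z) (Real.exp_pos _).le
        _ = _ := by
            rw [mul_left_comm, ← Real.exp_add]
            ring_nf
  have hl : ∀ f : GSSpace s d, ‖conjFunctional u f‖ ≤ M * ∫ z, ‖gsStft hs φ f z‖ *
      (Real.exp ((b + 1) * ‖z‖ ^ (1 / s)) * Real.exp (-(1 * ‖z‖ ^ (1 / s)))) := by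
    intro f
    refine le_trans (le_of_eq (RCLike.norm_conj _)) ((H f).trans (le_of_eq ?_))
    congr 2
    funext z
    rw [← Real.exp_add]
    ring_nf
  obtain ⟨F, hF, hF'⟩ := exists_eq_integral_of_le_integral (gsStft hs φ)
    (fun z => (Real.exp_pos _).le) (fun z => (Real.exp_pos _).le) hV
    (memLp_two_exp_neg hs d one_pos) (conjFunctional u) hM hl
  exact ⟨b + 1, F, by positivity, hF, hF'⟩

/-- The integral representation of `u` exhibits its transform as a parameter integral of a jointly
measurable function, which spares proving continuity of `q ↦ π(q)ψ` into `Σ_s`. -/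
theorem aestronglyMeasurable_stft (hs : 1 / 2 < s) {φ : GSSpace s d} (hφ : φ ≠ 0)
    (ψ : GSSpace s d) (u : GSDual s d) : AEStronglyMeasurable (stft hs ψ u) := by
  have hs0 : 0 < s := by linarith
  obtain ⟨b, F, hb, hF, H⟩ := exists_conj_apply_eq_integral hs hφ u
  have h1 : stft hs ψ u = fun q => starRingEnd ℂ
      (∫ z, F z * ((Real.exp (b * ‖z‖ ^ (1 / s)) : ℝ) * gsStft hs φ (tfShift hs q ψ) z)) := by
    funext q
    rw [stft_apply]
    exact (Complex.conj_conj _).symm.trans (congrArg (starRingEnd ℂ) (H (tfShift hs q ψ)))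
  rw [h1]
  refine Complex.continuous_conj.comp_aestronglyMeasurable ?_
  refine AEStronglyMeasurable.integral_prod_right' (f := fun p : PhaseSpace d × PhaseSpace d =>
    F p.2 * ((Real.exp (b * ‖p.2‖ ^ (1 / s)) : ℝ) * gsStft hs φ (tfShift hs p.1 ψ) p.2)) ?_
  have h2 : Continuous fun p : PhaseSpace d × PhaseSpace d =>
      gsStft hs φ (tfShift hs p.1 ψ) p.2 := by
    have h := (continuous_gsStft_tfShift hs φ ψ).comp
      (continuous_swap (X := PhaseSpace d) (Y := PhaseSpace d))
    exact h
  have h3 : Continuous fun p : PhaseSpace d × PhaseSpace d =>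
      ((Real.exp (b * ‖p.2‖ ^ (1 / s)) : ℝ) : ℂ) :=
    Complex.continuous_ofReal.comp ((continuous_exp_norm_rpow hs0 b).comp continuous_snd)
  exact hF.aestronglyMeasurable.comp_snd.mul (h3.mul h2).aestronglyMeasurable

/-- The inversion formula on `Σ_s'`. -/
theorem dual_inversion (hs : 1 / 2 < s) {φ : GSSpace s d} (hφ : φ ≠ 0) {c : ℂ}
    (hc : ∀ (f : GSSpace s d) (y : RSpace d), f y = c * ∫ z, gsStft hs φ f z * tfShift hs z φ y)
    (u : GSDual s d) (f : GSSpace s d) :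
    u f = starRingEnd ℂ c * ∫ q, stft hs φ u q * starRingEnd ℂ (gsStft hs φ f q) := by
  have hs0 : 0 < s := by linarith
  have hr : 0 ≤ 1 / s := by positivity
  obtain ⟨b, F, hb, hF, H⟩ := exists_conj_apply_eq_integral hs hφ u
  -- With this rate, decay in `q` and in `z - q` together beats the weight `exp(b |z|^{1/s})` and
  -- leaves `exp(-|z|^{1/s} - |q|^{1/s})` for Fubini.
  set A : ℝ := (b + 1) * 2 ^ (1 / s) + 1 with hA
  have hA0 : 0 < A := by positivity
  obtain ⟨C₁, hC₁, H₁⟩ := exists_norm_gsStft_le_exp hs φ f hA0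
  obtain ⟨C₂, hC₂, H₂⟩ := exists_norm_gsStft_le_exp hs φ φ hA0
  have key := apply_eq_integral_of_eq_integral (μ := volume) (ν := volume) hF H (u := f)
    (e := fun q => tfShift hs q φ) (c := fun q => c * gsStft hs φ f q)
    (h := fun z => Real.exp (-(1 * ‖z‖ ^ (1 / s))))
    (k := fun q => ‖c‖ * C₁ * C₂ * Real.exp (-(1 * ‖q‖ ^ (1 / s))))
    (fun z => ?_) ?_ (memLp_two_exp_neg hs d one_pos)
    ((integrable_exp_neg_phaseSpace hs d one_pos).const_mul _) (fun z q => ?_)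
  · have h1 : u f = starRingEnd ℂ (conjFunctional u f) := (Complex.conj_conj _).symm
    rw [h1, key, ← integral_conj, ← integral_const_mul]
    refine integral_congr_ae (Filter.Eventually.of_forall fun q => ?_)
    have h2 : starRingEnd ℂ (conjFunctional u (tfShift hs q φ)) = stft hs φ u q := by
      rw [stft_apply]
      exact Complex.conj_conj _
    simp only [map_mul, h2]
    ring
  · rw [reproducing hs hc φ f z, ← integral_const_mul]
    simp only [mul_assoc]
  · refine Continuous.aestronglyMeasurable ?_
    have h3 : Continuous fun p : PhaseSpace d × PhaseSpace d =>
        ((Real.exp (b * ‖p.1‖ ^ (1 / s)) : ℝ) : ℂ) :=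
      Complex.continuous_ofReal.comp ((continuous_exp_norm_rpow hs0 b).comp continuous_fst)
    exact h3.mul ((continuous_const.mul ((continuous_gsStft hs φ f).comp continuous_snd)).mul
      (continuous_gsStft_tfShift hs φ φ))
  · rw [norm_mul, norm_mul, norm_mul, norm_gsStft_tfShift, Complex.norm_real,
      Real.norm_of_nonneg (Real.exp_pos _).le]
    have h4 := H₁ q
    have h5 := H₂ (z - q)
    have h6 : Real.exp (b * ‖z‖ ^ (1 / s)) * (Real.exp (-(A * ‖q‖ ^ (1 / s))) *
        Real.exp (-(A * ‖z - q‖ ^ (1 / s)))) ≤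
        Real.exp (-(1 * ‖z‖ ^ (1 / s))) * Real.exp (-(1 * ‖q‖ ^ (1 / s))) := by
      rw [← Real.exp_add, ← Real.exp_add, ← Real.exp_add, Real.exp_le_exp]
      have h7 := norm_add_rpow_le hr (z - q) q
      rw [sub_add_cancel] at h7
      have h8 := mul_le_mul_of_nonneg_left h7 (by positivity : 0 ≤ b + 1)
      have h9 : 0 ≤ ‖z - q‖ ^ (1 / s) := by positivity
      rw [hA]
      linarith
    calc _ ≤ Real.exp (b * ‖z‖ ^ (1 / s)) * (‖c‖ * (C₁ * Real.exp (-(A * ‖q‖ ^ (1 / s)))) *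
          (C₂ * Real.exp (-(A * ‖z - q‖ ^ (1 / s))))) := by gcongr
      _ = ‖c‖ * C₁ * C₂ * (Real.exp (b * ‖z‖ ^ (1 / s)) * (Real.exp (-(A * ‖q‖ ^ (1 / s))) *
          Real.exp (-(A * ‖z - q‖ ^ (1 / s))))) := by ring
      _ ≤ _ := mul_le_mul_of_nonneg_left h6 (by positivity)
      _ = _ := by ring

end GSSpace

namespace GSSpace

variable {s : ℝ} {d : ℕ}

/-! ### Continuous functionals on `Σ_s'` -/

/-- Neighbourhoods of 0 in the strong topology are given by smallness on a bounded set `S`;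
homogeneity turns this into an estimate. -/
theorem exists_bounded_of_continuous (L : GSDual s d →ₗ[ℂ] ℂ) (hL : Continuous L) :
    ∃ (S : Set (GSSpace s d)) (C : ℝ), Bornology.IsVonNBounded ℂ S ∧ 0 ≤ C ∧
      ∀ (v : GSDual s d) (m : ℝ), 0 ≤ m → (∀ f ∈ S, ‖v f‖ ≤ m) → ‖L v‖ ≤ C * m := by
  have h1 : L ⁻¹' Metric.ball 0 1 ∈ nhds (0 : GSDual s d) :=
    hL.continuousAt.preimage_mem_nhds (by rw [map_zero]; exact Metric.ball_mem_nhds _ one_pos)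
  rw [(ContinuousLinearMap.hasBasis_nhds_zero_of_basis Metric.nhds_basis_ball).mem_iff] at h1
  obtain ⟨⟨S, ε⟩, ⟨hS, hε⟩, H⟩ := h1
  dsimp only at hS hε H
  have key : ∀ (v : GSDual s d) (m : ℝ), 0 < m → (∀ f ∈ S, ‖v f‖ ≤ m) → ‖L v‖ ≤ 2 / ε * m := by
    intro v m hm hv
    have h2 : (((ε / (2 * m) : ℝ) : ℂ) • v) ∈ L ⁻¹' Metric.ball 0 1 := by
      refine H fun f hf => ?_
      rw [mem_ball_zero_iff, smul_apply, norm_smul, Complex.norm_real,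
        Real.norm_of_nonneg (by positivity)]
      calc ε / (2 * m) * ‖v f‖ ≤ ε / (2 * m) * m := by gcongr; exact hv f hf
        _ = ε / 2 := by field_simp
        _ < ε := half_lt_self hε
    rw [Set.mem_preimage, mem_ball_zero_iff, map_smul, norm_smul, Complex.norm_real,
      Real.norm_of_nonneg (by positivity)] at h2
    have h3 : 2 / ε * m * (ε / (2 * m) * ‖L v‖) = ‖L v‖ := by field_simp
    rw [← h3]
    exact mul_le_of_le_one_right (by positivity) h2.le
  refine ⟨S, 2 / ε, hS, by positivity, fun v m hm hv => ?_⟩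
  refine le_of_forall_pos_le_add fun δ hδ => ?_
  -- The scaling argument needs a positive bound, so `m` is enlarged slightly to allow `m = 0`.
  have h4 := key v (m + ε / 2 * δ) (by positivity) fun f hf => (hv f hf).trans (by
    have : 0 ≤ ε / 2 * δ := by positivity
    linarith)
  have h5 : 2 / ε * (m + ε / 2 * δ) = 2 / ε * m + δ := by field_simp
  rwa [h5] at h4

/-- The elements of `Σ_s'` whose short-time Fourier transform is `O(exp(b |z|^{1/s}))`. -/
def growthSubmodule (hs : 1 / 2 < s) (φ : GSSpace s d) (b : ℝ) : Submodule ℂ (GSDual s d) where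
  carrier := {v | ∃ C : ℝ, 0 ≤ C ∧ ∀ z : PhaseSpace d,
    ‖stft hs φ v z‖ ≤ C * Real.exp (b * ‖z‖ ^ (1 / s))}
  zero_mem' := ⟨0, le_rfl, fun z => by simp [stft_apply]⟩
  add_mem' := by
    rintro v w ⟨C, hC, hv⟩ ⟨D, hD, hw⟩
    refine ⟨C + D, by positivity, fun z => ?_⟩
    have h1 := hv z
    have h2 := hw z
    rw [stft_apply] at h1 h2
    rw [stft_apply, add_apply, add_mul]
    exact (norm_add_le _ _).trans (add_le_add h1 h2)
  smul_mem' := by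
    rintro c v ⟨C, hC, hv⟩
    refine ⟨‖c‖ * C, by positivity, fun z => ?_⟩
    have h1 := hv z
    rw [stft_apply] at h1
    rw [stft_apply, smul_apply, norm_smul, mul_assoc]
    exact mul_le_mul_of_nonneg_left h1 (norm_nonneg _)

/-- The short-time Fourier transform as a linear map on `growthSubmodule`. -/
noncomputable def growthStft (hs : 1 / 2 < s) (φ : GSSpace s d) (b : ℝ) :
    growthSubmodule hs φ b →ₗ[ℂ] PhaseSpace d → ℂ where
  toFun v z := stft hs φ v.1 z
  map_add' v w := by
    funext z
    simp [stft_apply]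
  map_smul' c v := by
    funext z
    simp [stft_apply]

theorem conj_gsStft_tfShift (hs : 1 / 2 < s) (φ ψ : GSSpace s d) (z q : PhaseSpace d) :
    starRingEnd ℂ (gsStft hs φ (tfShift hs z ψ) q) = gsStft hs ψ (tfShift hs q φ) z := by
  rw [gsStft_apply, gsStft_apply, ← integral_conj]
  refine integral_congr_ae (Filter.Eventually.of_forall fun y => ?_)
  simp only [map_mul, Complex.conj_conj]
  rw [mul_comm]

/-- A continuous functional on `Σ_s'` commutes with the inversion formula. -/
theorem functional_eq_integral (hs : 1 / 2 < s) {φ : GSSpace s d} (hφ : φ ≠ 0) {c : ℂ}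
    (hc : ∀ (f : GSSpace s d) (y : RSpace d), f y = c * ∫ z, gsStft hs φ f z * tfShift hs z φ y)
    (L : GSDual s d →ₗ[ℂ] ℂ) (hL : Continuous L) (u : GSDual s d) :
    L u = starRingEnd ℂ c * ∫ q, stft hs φ u q * L ((tfShift hs q φ).toDual hs) := by
  have hs0 : 0 < s := by linarith
  have hr : 0 ≤ 1 / s := by positivity
  obtain ⟨M, b, hM, hb, Hu⟩ := exists_norm_stft_le hs φ u
  -- `a ≥ b + 1` puts transforms of growth `b` into `L²` after weighting by `exp(-a |z|^{1/s})`. The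
  -- factor `2 ^ (1 / s)` lets decay in `z` and `z - q` beat the growth `exp(b |q|^{1/s})` of `V_φ
  -- u`.
  set a : ℝ := (b + 1) * 2 ^ (1 / s) + 1 with ha
  have ha0 : 0 < a := by positivity
  have hba : b + 1 ≤ a := by
    have h1 : (1 : ℝ) ≤ 2 ^ (1 / s) := Real.one_le_rpow (by norm_num) hr
    nlinarith
  -- domination of the functional
  obtain ⟨S, C₀, hS, hC₀, HL⟩ := exists_bounded_of_continuous L hL
  obtain ⟨r, D, hD, HS⟩ := exists_norm_gsStft_le hs φ (A := a + 1) (by positivity)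
  obtain ⟨R, hR, HR⟩ := (withSeminorms s d).isVonNBounded_iff_seminorm_bounded.1 hS r
  have hmeas : ∀ v : GSDual s d, AEStronglyMeasurable (stft hs φ v) := fun v =>
    aestronglyMeasurable_stft hs hφ φ v
  have hgc : Continuous fun z : PhaseSpace d => Real.exp (-(a * ‖z‖ ^ (1 / s))) := by
    have := continuous_exp_norm_rpow (E := PhaseSpace d) hs0 (-a)
    simpa only [neg_mul] using this
  have hV : ∀ v : growthSubmodule hs φ b, MemLp (fun z : PhaseSpace d =>
      ((Real.exp (-(a * ‖z‖ ^ (1 / s))) : ℝ) : ℂ) * growthStft hs φ b v z) 2 := by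
    intro v
    obtain ⟨C, hC, hv⟩ := v.2
    refine ((memLp_two_exp_neg hs d one_pos).const_mul C).mono' ?_
      (Filter.Eventually.of_forall fun z => ?_)
    · exact (Complex.continuous_ofReal.comp hgc).aestronglyMeasurable.mul (hmeas v.1)
    · rw [norm_mul, Complex.norm_real, Real.norm_of_nonneg (Real.exp_pos _).le]
      calc _ ≤ Real.exp (-(a * ‖z‖ ^ (1 / s))) * (C * Real.exp (b * ‖z‖ ^ (1 / s))) :=
            mul_le_mul_of_nonneg_left (hv z) (Real.exp_pos _).le
        _ = C * Real.exp (-((a - b) * ‖z‖ ^ (1 / s))) := by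
            rw [mul_left_comm, ← Real.exp_add]
            ring_nf
        _ ≤ _ := by
            gcongr
            linarith
  -- `L v` is controlled by the values `v f`, `f ∈ S`, and these by `dual_inversion`. The decay of
  -- `V_φ f` is uniform over `S` because a bounded set has a bounded seminorm `r`.
  have hl : ∀ v : growthSubmodule hs φ b, ‖(L ∘ₗ (growthSubmodule hs φ b).subtype) v‖ ≤
      C₀ * (‖c‖ * (D * R)) * ∫ z, ‖growthStft hs φ b v z‖ *
        (Real.exp (-(a * ‖z‖ ^ (1 / s))) * Real.exp (-(1 * ‖z‖ ^ (1 / s)))) := by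
    intro v
    set I := ∫ z, ‖growthStft hs φ b v z‖ *
        (Real.exp (-(a * ‖z‖ ^ (1 / s))) * Real.exp (-(1 * ‖z‖ ^ (1 / s)))) with hI
    have hI0 : 0 ≤ I := integral_nonneg fun z => by positivity
    have hii : Integrable fun z => ‖growthStft hs φ b v z‖ *
        (Real.exp (-(a * ‖z‖ ^ (1 / s))) * Real.exp (-(1 * ‖z‖ ^ (1 / s)))) := by
      refine ((hV v).norm.integrable_mul (memLp_two_exp_neg hs d one_pos)).congr
        (Filter.Eventually.of_forall fun z => ?_)
      simp only [Pi.mul_apply, norm_mul, Complex.norm_real,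
        Real.norm_of_nonneg (Real.exp_pos _).le]
      ring
    refine (HL v.1 (‖c‖ * (D * R) * I) (by positivity) fun f hf => ?_).trans
      (le_of_eq (by ring))
    rw [dual_inversion hs hφ hc v.1 f, norm_mul, RCLike.norm_conj, mul_assoc]
    refine mul_le_mul_of_nonneg_left ?_ (norm_nonneg c)
    rw [hI, ← integral_const_mul]
    refine norm_integral_le_of_norm_le (hii.const_mul _) (Filter.Eventually.of_forall fun z => ?_)
    rw [norm_mul, RCLike.norm_conj]
    calc _ ≤ ‖stft hs φ v.1 z‖ * (D * R * Real.exp (-((a + 1) * ‖z‖ ^ (1 / s)))) := by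
          refine mul_le_mul_of_nonneg_left ((HS f z).trans ?_) (norm_nonneg _)
          have := (HR f hf).le
          gcongr
      _ = D * R * (‖stft hs φ v.1 z‖ * Real.exp (-((a + 1) * ‖z‖ ^ (1 / s)))) := by ring
      _ = _ := by
          rw [← Real.exp_add]
          congr 4
          ring
  obtain ⟨F, hF, hF'⟩ := exists_eq_integral_of_le_integral (growthStft hs φ b)
    (fun z => (Real.exp_pos _).le) (fun z => (Real.exp_pos _).le) hV
    (memLp_two_exp_neg hs d one_pos) (L ∘ₗ (growthSubmodule hs φ b).subtype)
    (by positivity) hl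
  -- the time-frequency shifts as elements of the submodule
  obtain ⟨C₂, hC₂, H₂⟩ := exists_norm_gsStft_le_exp hs φ φ (A := a) ha0
  have he : ∀ q, (tfShift hs q φ).toDual hs ∈ growthSubmodule hs φ b := by
    refine fun q => ⟨C₂, hC₂, fun z => ?_⟩
    rw [stft_toDual, norm_gsStft_tfShift]
    refine (H₂ _).trans (mul_le_mul_of_nonneg_left ?_ hC₂)
    rw [Real.exp_le_exp]
    have h1 : 0 ≤ a * ‖z - q‖ ^ (1 / s) := by positivity
    have h2 : 0 ≤ b * ‖z‖ ^ (1 / s) := by positivity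
    linarith
  have hstep : ∀ z q, growthStft hs φ b ⟨_, he q⟩ z = gsStft hs φ (tfShift hs q φ) z :=
    fun z q => stft_toDual hs φ _ z
  have key := apply_eq_integral_of_eq_integral (μ := volume) (ν := volume) hF hF'
    (u := ⟨u, M, hM, Hu⟩) (e := fun q => ⟨_, he q⟩)
    (c := fun q => starRingEnd ℂ c * stft hs φ u q)
    (h := fun z => Real.exp (-(1 * ‖z‖ ^ (1 / s))))
    (k := fun q => ‖c‖ * M * C₂ * Real.exp (-(1 * ‖q‖ ^ (1 / s))))
    (fun z => ?_) ?_ (memLp_two_exp_neg hs d one_pos)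
    ((integrable_exp_neg_phaseSpace hs d one_pos).const_mul _) (fun z q => ?_)
  · refine key.trans ?_
    rw [← integral_const_mul]
    refine integral_congr_ae (Filter.Eventually.of_forall fun q => ?_)
    exact mul_assoc _ _ _
  -- Testing the inversion formula on `π(z)φ` gives the reproducing formula for `V_φ u`, so `u` is
  -- the superposition required.
  · have h1 := dual_inversion hs hφ hc u (tfShift hs z φ)
    rw [← stft_apply, ← integral_const_mul] at h1
    refine Eq.trans h1 (integral_congr_ae (Filter.Eventually.of_forall fun q => ?_))
    dsimp only
    rw [hstep, conj_gsStft_tfShift, mul_assoc]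
  · simp only [hstep]
    have h3 : Continuous fun p : PhaseSpace d × PhaseSpace d =>
        ((Real.exp (-(a * ‖p.1‖ ^ (1 / s))) : ℝ) : ℂ) :=
      Complex.continuous_ofReal.comp (hgc.comp continuous_fst)
    exact h3.aestronglyMeasurable.mul (((hmeas u).comp_snd.const_mul _).mul
      (continuous_gsStft_tfShift hs φ φ).aestronglyMeasurable)
  · rw [hstep, norm_mul, norm_mul, norm_mul, norm_gsStft_tfShift, Complex.norm_real,
      Real.norm_of_nonneg (Real.exp_pos _).le, RCLike.norm_conj]
    have h4 := Hu q
    have h5 := H₂ (z - q)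
    have h6 : Real.exp (-(a * ‖z‖ ^ (1 / s))) * (Real.exp (b * ‖q‖ ^ (1 / s)) *
        Real.exp (-(a * ‖z - q‖ ^ (1 / s)))) ≤
        Real.exp (-(1 * ‖z‖ ^ (1 / s))) * Real.exp (-(1 * ‖q‖ ^ (1 / s))) := by
      rw [← Real.exp_add, ← Real.exp_add, ← Real.exp_add, Real.exp_le_exp]
      have h7 := norm_add_rpow_le hr z (q - z)
      rw [add_sub_cancel, norm_sub_rev q z] at h7
      have h8 := mul_le_mul_of_nonneg_left h7 (by positivity : 0 ≤ b + 1)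
      have h9 : 0 ≤ ‖z - q‖ ^ (1 / s) := by positivity
      rw [ha]
      linarith
    calc _ ≤ Real.exp (-(a * ‖z‖ ^ (1 / s))) * (‖c‖ * (M * Real.exp (b * ‖q‖ ^ (1 / s))) *
          (C₂ * Real.exp (-(a * ‖z - q‖ ^ (1 / s))))) := by gcongr
      _ = ‖c‖ * M * C₂ * (Real.exp (-(a * ‖z‖ ^ (1 / s))) * (Real.exp (b * ‖q‖ ^ (1 / s)) *
          Real.exp (-(a * ‖z - q‖ ^ (1 / s))))) := by ring
      _ ≤ _ := mul_le_mul_of_nonneg_left h6 (by positivity)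
      _ = _ := by ring

/-! ### The short-time Fourier transform of an operator with a kernel -/

theorem inner_joinPt {m n : ℕ} (y : RSpace (m + n)) (a : RSpace m) (b : RSpace n) :
    inner ℝ y (joinPt a b) = inner ℝ (projFst m n y) a + inner ℝ (projSnd m n y) b := by
  simp only [PiLp.inner_apply, Fin.sum_univ_add]
  congr 1 <;> refine Finset.sum_congr rfl fun i _ => ?_
  · have : joinPt a b (Fin.castAdd n i) = a i := Fin.append_left _ _ _
    rw [this]
    rfl
  · have : joinPt a b (Fin.natAdd m i) = b i := Fin.append_right _ _ _
    rw [this]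
    rfl

theorem tensor_apply {m n : ℕ} (hs : 1 / 2 < s) (g : GSSpace s m) (f : GSSpace s n)
    (y : RSpace (m + n)) : tensor hs g f y = g (projFst m n y) * f (projSnd m n y) := rfl

/-- Conjugation reverses the frequency of the second factor; this is the origin of the twist `-η`.
-/
theorem tensor_tfShift (hs : 1 / 2 < s) (ψ φ : GSSpace s d) (z w : PhaseSpace d) :
    (tfShift hs z ψ).tensor hs ((tfShift hs w φ).conj hs) =
      tfShift hs (kernelPt z.1 w.1 z.2 (-w.2)) (ψ.tensor hs (φ.conj hs)) := by
  refine GSSpace.ext fun y => ?_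
  have hcj : ∀ (f : GSSpace s d) (x : RSpace d), f.conj hs x = starRingEnd ℂ (f x) :=
    fun _ _ => rfl
  rw [tensor_apply, hcj, tfShift_apply, tfShift_apply, tfShift_apply, tensor_apply, hcj, map_sub,
    map_sub]
  simp only [kernelPt, projFst_joinPt, projSnd_joinPt, inner_joinPt, map_mul, ← Complex.exp_conj,
    Complex.conj_ofReal, Complex.conj_I, inner_neg_right]
  have : Complex.exp (Complex.I * ((inner ℝ (projFst d d y) z.2 +
      -inner ℝ (projSnd d d y) w.2 : ℝ) : ℂ)) =
      Complex.exp (Complex.I * (inner ℝ (projFst d d y) z.2 : ℝ)) *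
      Complex.exp (-Complex.I * (inner ℝ (projSnd d d y) w.2 : ℝ)) := by
    rw [← Complex.exp_add]
    congr 1
    push_cast
    ring
  rw [this]
  ring

/-- The functional `v ↦ (T' v, π(z)ψ)` is continuous on `Σ_s'`, so by `functional_eq_integral` only
its values on the shifts `π(w)φ ∈ Σ_s` matter. There `T'` is `T`, and the kernel gives the transform
of `K`. -/
theorem stft_operator (hs : 1 / 2 < s) {φ : GSSpace s d} (hφ : φ ≠ 0) {c : ℂ}
    (hc : ∀ (f : GSSpace s d) (y : RSpace d), f y = c * ∫ z, gsStft hs φ f z * tfShift hs z φ y)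
    {K : GSDual s (d + d)} {T : GSSpace s d → GSSpace s d} (hTK : HasKernel hs K T)
    (T' : GSDual s d →L[ℂ] GSDual s d) (hT' : ∀ f : GSSpace s d, T' (f.toDual hs) = (T f).toDual hs)
    (ψ : GSSpace s d) (u : GSDual s d) (z : PhaseSpace d) :
    stft hs ψ (T' u) z = starRingEnd ℂ c * ∫ w, stft hs φ u w *
      stft hs (ψ.tensor hs (φ.conj hs)) K (kernelPt z.1 w.1 z.2 (-w.2)) := by
  let L : GSDual s d →ₗ[ℂ] ℂ :=
    { toFun := fun v => T' v (tfShift hs z ψ)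
      map_add' := fun v w => by simp
      map_smul' := fun a v => by simp }
  have hL : Continuous L := (continuous_eval_const (tfShift hs z ψ)).comp T'.continuous
  rw [stft_apply]
  refine (functional_eq_integral hs hφ hc L hL u).trans ?_
  congr 2
  funext w
  congr 1
  change T' _ _ = _
  rw [hT', hTK, tensor_tfShift, stft_apply]

end GSSpace

/-! ### Rapid decay near a direction -/

/-- `f` decays faster than `exp(-A |z|^{1/s})`, for every `A`, in a conic neighbourhood of `z₀`. -/
def RapidNear {E : Type*} [SeminormedAddCommGroup E] [Module ℝ E] (s : ℝ) (f : E → ℂ) (z₀ : E) :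
    Prop :=
  ∃ δ : ℝ, 0 < δ ∧ ∀ A : ℝ, 0 < A → ∃ C : ℝ, 0 ≤ C ∧ ∀ p ∈ Metric.ball z₀ δ, ∀ t : ℝ, 0 < t →
    ‖f (t • p)‖ ≤ C * Real.exp (-(A * ‖t • p‖ ^ (1 / s)))

theorem RapidNear.smul {E : Type*} [SeminormedAddCommGroup E] [NormedSpace ℝ E] {s : ℝ}
    {f : E → ℂ} {z₀ : E} (hf : RapidNear s f z₀) {a : ℝ} (ha : 0 < a) :
    RapidNear s f (a • z₀) := by
  obtain ⟨δ, hδ, H⟩ := hf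
  refine ⟨a * δ, by positivity, fun A hA => ?_⟩
  obtain ⟨C, hC, HC⟩ := H A hA
  refine ⟨C, hC, fun p hp t ht => ?_⟩
  have h1 : a⁻¹ • p ∈ Metric.ball z₀ δ := by
    rw [mem_ball_iff_norm] at hp ⊢
    have h2 : a⁻¹ • p - z₀ = a⁻¹ • (p - a • z₀) := by
      rw [smul_sub, inv_smul_smul₀ ha.ne']
    rw [h2, norm_smul, Real.norm_of_nonneg (by positivity), inv_mul_lt_iff₀ ha]
    exact hp
  have h3 := HC _ h1 (t * a) (by positivity)
  rwa [mul_smul, smul_inv_smul₀ ha.ne'] at h3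

/-- Each radius in `RapidNear` is independent of `A`, so one finite subcover and one thickening
radius serve every `A`. The constants add up over the subcover. -/
theorem IsCompact.exists_uniform_of_rapidNear {E : Type*} [SeminormedAddCommGroup E]
    [NormedSpace ℝ E] {s : ℝ} {f : E → ℂ} {Q : Set E} (hQ : IsCompact Q)
    (hf : ∀ p ∈ Q, RapidNear s f p) :
    ∃ δ : ℝ, 0 < δ ∧ ∀ A : ℝ, 0 < A → ∃ C : ℝ, 0 ≤ C ∧ ∀ q ∈ Q, ∀ p, ‖p - q‖ < δ →
      ∀ t : ℝ, 0 < t → ‖f (t • p)‖ ≤ C * Real.exp (-(A * ‖t • p‖ ^ (1 / s))) := by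
  classical
  choose! δ hδ H using hf
  obtain ⟨F, hFQ, hF⟩ := hQ.elim_nhds_subcover (fun p => Metric.ball p (δ p))
    fun p hp => Metric.ball_mem_nhds p (hδ p hp)
  obtain ⟨ε, hε, hsub⟩ := hQ.exists_thickening_subset_open
    (isOpen_biUnion fun p (_ : p ∈ F) => Metric.isOpen_ball (x := p) (ε := δ p)) hF
  refine ⟨ε, hε, fun A hA => ?_⟩
  choose! C hC HC using fun p (hp : p ∈ Q) => H p hp A hA
  refine ⟨∑ p ∈ F, C p, Finset.sum_nonneg fun p hp => hC p (hFQ p hp), fun q hq p hp t ht => ?_⟩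
  have h1 : p ∈ ⋃ x ∈ F, Metric.ball x (δ x) :=
    hsub (Metric.mem_thickening_iff.2 ⟨q, hq, by rwa [dist_eq_norm]⟩)
  obtain ⟨x, hx, hpx⟩ := Set.mem_iUnion₂.1 h1
  refine (HC x (hFQ x hx) p hpx t ht).trans ?_
  gcongr
  exact Finset.single_le_sum (f := C) (fun y hy => hC y (hFQ y hy)) hx

/-! ### Wave front sets in terms of rapid decay -/

theorem norm_le_phaseNorm {d : ℕ} (z : PhaseSpace d) : ‖z‖ ≤ phaseNorm z := by
  rw [phaseNorm, Prod.norm_def]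
  refine max_le ?_ ?_ <;> refine Real.le_sqrt_of_sq_le ?_ <;>
    nlinarith [sq_nonneg ‖z.1‖, sq_nonneg ‖z.2‖]

theorem phaseNorm_le {d : ℕ} (z : PhaseSpace d) : phaseNorm z ≤ 2 * ‖z‖ := by
  rw [phaseNorm]
  have h1 := norm_fst_le z
  have h2 := norm_snd_le z
  have h3 := norm_nonneg z.1
  have h4 := norm_nonneg z.2
  exact Real.sqrt_le_iff.2 ⟨by positivity, by nlinarith⟩

theorem rapidNear_of_notMem_gsWaveFront {s : ℝ} {d : ℕ} (hs : 1 / 2 < s) {φ : GSSpace s d}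
    {u : GSDual s d} {z₀ : PhaseSpace d} (h0 : z₀ ≠ 0) (hz : z₀ ∉ gsWaveFront hs φ u) :
    RapidNear s (stft hs φ u) z₀ := by
  have hr : 0 ≤ 1 / s := by
    have : 0 < s := by linarith
    positivity
  obtain ⟨Γ, hΓo, hΓc, -, hzΓ, H⟩ : ∃ Γ : Set (PhaseSpace d), IsOpen Γ ∧ IsConic Γ ∧
      Γ ⊆ {0}ᶜ ∧ z₀ ∈ Γ ∧ ∀ A : ℝ, 0 < A → ∃ C : ℝ, ∀ z ∈ Γ,
        Real.exp (A * phaseNorm z ^ (1 / s)) * ‖stft hs φ u z‖ ≤ C := by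
    by_contra h
    exact hz ⟨h0, h⟩
  obtain ⟨δ, hδ, hball⟩ := Metric.isOpen_iff.1 hΓo z₀ hzΓ
  refine ⟨δ, hδ, fun A hA => ?_⟩
  obtain ⟨C, hC⟩ := H A hA
  have hC0 : 0 ≤ C := le_trans (by positivity) (hC z₀ hzΓ)
  refine ⟨C, hC0, fun p hp t ht => ?_⟩
  have h1 := hC _ (hΓc p (hball hp) t ht)
  rw [Real.exp_neg, ← div_eq_mul_inv, le_div_iff₀ (Real.exp_pos _), mul_comm]
  refine le_trans ?_ h1
  gcongr
  exact norm_le_phaseNorm _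

theorem notMem_gsWaveFront_of_rapidNear {s : ℝ} {d : ℕ} (hs : 1 / 2 < s) {φ : GSSpace s d}
    {u : GSDual s d} {z₀ : PhaseSpace d} (h0 : z₀ ≠ 0) (hz : RapidNear s (stft hs φ u) z₀) :
    z₀ ∉ gsWaveFront hs φ u := by
  have hr : 0 ≤ 1 / s := by
    have : 0 < s := by linarith
    positivity
  obtain ⟨δ, hδ, H⟩ := hz
  have hz0 : 0 < ‖z₀‖ := norm_pos_iff.2 h0
  -- Radius at most `‖z₀‖` keeps the origin out of the ball, hence out of the cone that it
  -- generates.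
  set ε := min δ ‖z₀‖ with hε
  have hε0 : 0 < ε := lt_min hδ hz0
  rintro ⟨-, hn⟩
  refine hn ⟨⋃ (t : ℝ) (_ : 0 < t), (fun z => t • z) ⁻¹' Metric.ball z₀ ε, ?_, ?_, ?_, ?_, ?_⟩
  · exact isOpen_biUnion fun t _ => Metric.isOpen_ball.preimage (continuous_const_smul t)
  · intro z hz t ht
    obtain ⟨r, hr, hzr⟩ := Set.mem_iUnion₂.1 hz
    refine Set.mem_iUnion₂.2 ⟨r * t⁻¹, by positivity, ?_⟩
    rw [Set.mem_preimage] at hzr ⊢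
    rwa [mul_smul, inv_smul_smul₀ ht.ne']
  · intro z hz hz'
    obtain ⟨r, hr, hzr⟩ := Set.mem_iUnion₂.1 hz
    rw [Set.mem_singleton_iff] at hz'
    rw [Set.mem_preimage, hz', smul_zero, mem_ball_iff_norm, zero_sub, norm_neg] at hzr
    exact absurd hzr (not_lt.2 (min_le_right _ _))
  · exact Set.mem_iUnion₂.2 ⟨1, one_pos, by simpa using hε0⟩
  · intro A hA
    -- The Euclidean norm is at most twice the sup norm of the pair; the larger rate absorbs this
    -- factor.
    obtain ⟨C, hC, HC⟩ := H (A * 2 ^ (1 / s)) (by positivity)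
    refine ⟨C, fun z hz => ?_⟩
    obtain ⟨r, hr0, hzr⟩ := Set.mem_iUnion₂.1 hz
    have h1 := HC (r • z) (Metric.ball_subset_ball (min_le_left _ _) hzr) r⁻¹ (by positivity)
    rw [inv_smul_smul₀ hr0.ne', Real.exp_neg, ← div_eq_mul_inv, le_div_iff₀ (Real.exp_pos _),
      mul_comm] at h1
    refine le_trans ?_ h1
    have h2 : phaseNorm z ^ (1 / s) ≤ (2 * ‖z‖) ^ (1 / s) :=
      Real.rpow_le_rpow (Real.sqrt_nonneg _) (phaseNorm_le z) hr
    rw [Real.mul_rpow (by norm_num) (norm_nonneg _)] at h2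
    refine mul_le_mul_of_nonneg_right (Real.exp_le_exp.2 ?_) (norm_nonneg _)
    rw [mul_assoc]
    exact mul_le_mul_of_nonneg_left h2 hA.le

/-! ### Independence of the window -/

namespace GSSpace

/-- Rapid decay in a conic neighbourhood does not depend on the window. -/
theorem rapidNear_stft_of_window {s : ℝ} {d : ℕ} (hs : 1 / 2 < s) {φ : GSSpace s d} (hφ : φ ≠ 0)
    (ψ : GSSpace s d) {u : GSDual s d} {z₀ : PhaseSpace d} (hz : RapidNear s (stft hs φ u) z₀) :
    RapidNear s (stft hs ψ u) z₀ := by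
  have hs0 : 0 < s := by linarith
  have hr : 0 ≤ 1 / s := by positivity
  obtain ⟨c, hc⟩ := exists_inversion hs hφ
  obtain ⟨M, b, hM, hb, Hu⟩ := exists_norm_stft_le hs φ u
  obtain ⟨δ, hδ, H⟩ := hz
  refine ⟨δ / 2, by positivity, fun A hA => ?_⟩
  set a : ℝ := 2 ^ (1 / s) with ha
  have ha0 : 0 ≤ a := by positivity
  -- If `P` lies in the cone of radius `δ / 2` and `q` outside that of radius `δ`, then `‖P‖ ^ (1 /
  -- s) ≤ κ ‖q - P‖ ^ (1 / s)`.
  set κ : ℝ := (2 * (‖z₀‖ + δ / 2) / δ) ^ (1 / s) with hκ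
  have hκ0 : 0 ≤ κ := by positivity
  obtain ⟨C₁, hC₁, H₁⟩ := H (A * a) (by positivity)
  -- One rate for both cases: `A a` serves `q` inside the cone, `(A + b a) κ + b a` serves `q`
  -- outside, and 1 remains for integrability.
  set B : ℝ := A * a + (A + b * a) * κ + 1 + b * a with hB
  have hB0 : 0 < B := by positivity
  obtain ⟨C₂, hC₂, H₂⟩ := exists_norm_gsStft_le_exp hs φ ψ hB0
  set J := ∫ q : PhaseSpace d, Real.exp (-(1 * ‖q‖ ^ (1 / s))) with hJ
  have hJi := integrable_exp_neg_phaseSpace hs d one_pos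
  have hJ0 : 0 ≤ J := integral_nonneg fun _ => (Real.exp_pos _).le
  refine ⟨‖c‖ * ((C₁ + M) * C₂ * J), by positivity, fun p hp t ht => ?_⟩
  set P := t • p with hP
  have hb' : ∀ q, ‖stft hs φ u q * starRingEnd ℂ (gsStft hs φ (tfShift hs P ψ) q)‖ ≤
      (C₁ + M) * C₂ * Real.exp (-(A * ‖P‖ ^ (1 / s))) *
        Real.exp (-(1 * ‖q - P‖ ^ (1 / s))) := by
    intro q
    have hX : 0 ≤ ‖q - P‖ ^ (1 / s) := by positivity
    have hPn : 0 ≤ ‖P‖ ^ (1 / s) := by positivity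
    have hqP := norm_add_rpow_le hr (q - P) P
    have hPq := norm_add_rpow_le hr q (P - q)
    rw [sub_add_cancel] at hqP
    rw [add_sub_cancel, norm_sub_rev P q] at hPq
    rw [norm_mul, RCLike.norm_conj, norm_gsStft_tfShift]
    -- Inside the cone `V_φ u` decays. Outside, it may grow, but `q` is so far from `P` that the
    -- decay of `V_φ ψ(q - P)` compensates.
    by_cases hq : t⁻¹ • q ∈ Metric.ball z₀ δ
    · have h1 := H₁ _ hq t ht
      rw [smul_inv_smul₀ ht.ne'] at h1
      have h3 : Real.exp (-(A * a * ‖q‖ ^ (1 / s))) * Real.exp (-(B * ‖q - P‖ ^ (1 / s))) ≤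
          Real.exp (-(A * ‖P‖ ^ (1 / s))) * Real.exp (-(1 * ‖q - P‖ ^ (1 / s))) := by
        rw [← Real.exp_add, ← Real.exp_add, Real.exp_le_exp]
        have h4 := mul_le_mul_of_nonneg_left hPq hA.le
        have h5 : 0 ≤ ((A + b * a) * κ + b * a) * ‖q - P‖ ^ (1 / s) := by positivity
        rw [hB]
        linarith
      calc _ ≤ C₁ * Real.exp (-(A * a * ‖q‖ ^ (1 / s))) *
            (C₂ * Real.exp (-(B * ‖q - P‖ ^ (1 / s)))) := by
            gcongr
            exact H₂ _
        _ = C₁ * C₂ * (Real.exp (-(A * a * ‖q‖ ^ (1 / s))) *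
            Real.exp (-(B * ‖q - P‖ ^ (1 / s)))) := by ring
        _ ≤ (C₁ + M) * C₂ * (Real.exp (-(A * ‖P‖ ^ (1 / s))) *
            Real.exp (-(1 * ‖q - P‖ ^ (1 / s)))) := by
            gcongr
            linarith
        _ = _ := by ring
    · have hfar : δ / 2 * t ≤ ‖q - P‖ := by
        rw [mem_ball_iff_norm, not_lt] at hq
        rw [mem_ball_iff_norm] at hp
        have h1 : ‖t⁻¹ • q - z₀‖ ≤ ‖t⁻¹ • q - p‖ + ‖p - z₀‖ := norm_sub_le_norm_sub_add_norm_sub _ _ _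
        have h2 : q - P = t • (t⁻¹ • q - p) := by rw [smul_sub, smul_inv_smul₀ ht.ne']
        rw [h2, norm_smul, Real.norm_of_nonneg ht.le, mul_comm]
        gcongr
        linarith
      have hPle : ‖P‖ ^ (1 / s) ≤ κ * ‖q - P‖ ^ (1 / s) := by
        rw [hκ, ← Real.mul_rpow (by positivity) (norm_nonneg _)]
        refine Real.rpow_le_rpow (norm_nonneg _) ?_ hr
        rw [mem_ball_iff_norm] at hp
        have h1 : ‖p‖ ≤ ‖z₀‖ + δ / 2 := by
          have := norm_le_norm_add_norm_sub' p z₀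
          linarith
        calc ‖P‖ = t * ‖p‖ := by rw [hP, norm_smul, Real.norm_of_nonneg ht.le]
          _ ≤ t * (‖z₀‖ + δ / 2) := by gcongr
          _ = 2 * (‖z₀‖ + δ / 2) / δ * (δ / 2 * t) := by field_simp
          _ ≤ _ := by gcongr
      have h3 : Real.exp (b * ‖q‖ ^ (1 / s)) * Real.exp (-(B * ‖q - P‖ ^ (1 / s))) ≤
          Real.exp (-(A * ‖P‖ ^ (1 / s))) * Real.exp (-(1 * ‖q - P‖ ^ (1 / s))) := by
        rw [← Real.exp_add, ← Real.exp_add, Real.exp_le_exp]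
        have h4 := mul_le_mul_of_nonneg_left hqP hb
        have h5 := mul_le_mul_of_nonneg_left hPle (by positivity : 0 ≤ A + b * a)
        have h6 : 0 ≤ A * a * ‖q - P‖ ^ (1 / s) := by positivity
        rw [hB]
        linarith
      calc _ ≤ M * Real.exp (b * ‖q‖ ^ (1 / s)) *
            (C₂ * Real.exp (-(B * ‖q - P‖ ^ (1 / s)))) := by
            gcongr
            · exact Hu q
            · exact H₂ _
        _ = M * C₂ * (Real.exp (b * ‖q‖ ^ (1 / s)) *
            Real.exp (-(B * ‖q - P‖ ^ (1 / s)))) := by ring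
        _ ≤ (C₁ + M) * C₂ * (Real.exp (-(A * ‖P‖ ^ (1 / s))) *
            Real.exp (-(1 * ‖q - P‖ ^ (1 / s)))) := by
            gcongr
            linarith
        _ = _ := by ring
  rw [stft_apply, dual_inversion hs hφ hc, norm_mul, RCLike.norm_conj]
  have : (volume : Measure (PhaseSpace d)).IsAddHaarMeasure :=
    Measure.prod.instIsAddHaarMeasure _ _
  have hint : Integrable fun q : PhaseSpace d => Real.exp (-(1 * ‖q - P‖ ^ (1 / s))) :=
    hJi.comp_sub_right P
  have hJP : ∫ q : PhaseSpace d, Real.exp (-(1 * ‖q - P‖ ^ (1 / s))) = J :=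
    integral_sub_right_eq_self (fun q : PhaseSpace d => Real.exp (-(1 * ‖q‖ ^ (1 / s)))) P
  have h7 := norm_integral_le_of_norm_le (hint.const_mul _) (Filter.Eventually.of_forall hb')
  rw [integral_const_mul, hJP] at h7
  calc _ ≤ ‖c‖ * _ := mul_le_mul_of_nonneg_left h7 (norm_nonneg c)
    _ = _ := by ring

end GSSpace

/-! ### Phase space of the kernel -/

theorem joinPt_smul {m n : ℕ} (t : ℝ) (x : RSpace m) (y : RSpace n) :
    joinPt (t • x) (t • y) = t • joinPt x y := by
  ext i
  refine Fin.addCases (fun j => ?_) (fun j => ?_) i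
  · change Fin.append (t • x) (t • y) (Fin.castAdd n j) = t * Fin.append x y (Fin.castAdd n j)
    simp
  · change Fin.append (t • x) (t • y) (Fin.natAdd m j) = t * Fin.append x y (Fin.natAdd m j)
    simp

theorem joinPt_sub {m n : ℕ} (x x' : RSpace m) (y y' : RSpace n) :
    joinPt (x - x') (y - y') = joinPt x y - joinPt x' y' := by
  ext i
  refine Fin.addCases (fun j => ?_) (fun j => ?_) i
  · change Fin.append (x - x') (y - y') (Fin.castAdd n j) =
      Fin.append x y (Fin.castAdd n j) - Fin.append x' y' (Fin.castAdd n j)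
    simp
  · change Fin.append (x - x') (y - y') (Fin.natAdd m j) =
      Fin.append x y (Fin.natAdd m j) - Fin.append x' y' (Fin.natAdd m j)
    simp

theorem norm_sq_joinPt {m n : ℕ} (x : RSpace m) (y : RSpace n) :
    ‖joinPt x y‖ ^ 2 = ‖x‖ ^ 2 + ‖y‖ ^ 2 := by
  rw [norm_sq_proj, projFst_joinPt, projSnd_joinPt]

theorem norm_joinPt_le {m n : ℕ} (x : RSpace m) (y : RSpace n) :
    ‖joinPt x y‖ ≤ ‖x‖ + ‖y‖ := by
  have h := norm_sq_joinPt x y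
  have h1 := norm_nonneg x
  have h2 := norm_nonneg y
  exact abs_le_of_sq_le_sq' (by nlinarith) (by positivity) |>.2

theorem norm_fst_le_joinPt {m n : ℕ} (x : RSpace m) (y : RSpace n) : ‖x‖ ≤ ‖joinPt x y‖ := by
  have h := norm_sq_joinPt x y
  exact abs_le_of_sq_le_sq' (by nlinarith [sq_nonneg ‖y‖]) (norm_nonneg _) |>.2

theorem norm_snd_le_joinPt {m n : ℕ} (x : RSpace m) (y : RSpace n) : ‖y‖ ≤ ‖joinPt x y‖ := by
  have h := norm_sq_joinPt x y
  exact abs_le_of_sq_le_sq' (by nlinarith [sq_nonneg ‖x‖]) (norm_nonneg _) |>.2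

/-- The identification of pairs `((x, ξ), (y, η))` with points `(x, y, ξ, -η)`. -/
def kernelPair {d : ℕ} (P : PhaseSpace d × PhaseSpace d) : PhaseSpace (d + d) :=
  kernelPt P.1.1 P.2.1 P.1.2 (-P.2.2)

theorem kernelPair_smul {d : ℕ} (t : ℝ) (P : PhaseSpace d × PhaseSpace d) :
    kernelPair (t • P) = t • kernelPair P := by
  simp only [kernelPair, kernelPt, Prod.smul_fst, Prod.smul_snd, Prod.smul_mk, ← smul_neg,
    joinPt_smul]

theorem kernelPair_sub {d : ℕ} (P Q : PhaseSpace d × PhaseSpace d) :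
    kernelPair (P - Q) = kernelPair P - kernelPair Q := by
  simp only [kernelPair, kernelPt, Prod.fst_sub, Prod.snd_sub, Prod.mk_sub_mk, ← joinPt_sub,
    neg_sub_neg, neg_sub]

theorem norm_kernelPair_le {d : ℕ} (P : PhaseSpace d × PhaseSpace d) :
    ‖kernelPair P‖ ≤ 2 * ‖P‖ := by
  have h1 := (norm_fst_le P.1).trans (norm_fst_le P)
  have h2 := (norm_snd_le P.1).trans (norm_fst_le P)
  have h3 := (norm_fst_le P.2).trans (norm_snd_le P)
  have h4 := (norm_snd_le P.2).trans (norm_snd_le P)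
  refine max_le ((norm_joinPt_le _ _).trans (by linarith)) ((norm_joinPt_le _ _).trans ?_)
  rw [norm_neg]
  linarith

theorem norm_le_norm_kernelPair {d : ℕ} (P : PhaseSpace d × PhaseSpace d) :
    ‖P‖ ≤ ‖kernelPair P‖ := by
  have h1 : ‖joinPt P.1.1 P.2.1‖ ≤ ‖kernelPair P‖ := norm_fst_le (kernelPair P)
  have h2 : ‖joinPt P.1.2 (-P.2.2)‖ ≤ ‖kernelPair P‖ := norm_snd_le (kernelPair P)
  have h3 := norm_snd_le_joinPt P.1.2 (-P.2.2)
  rw [norm_neg] at h3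
  exact max_le (max_le ((norm_fst_le_joinPt _ _).trans h1) ((norm_fst_le_joinPt _ _).trans h2))
    (max_le ((norm_snd_le_joinPt _ _).trans h1) (h3.trans h2))

theorem kernelPair_ne_zero {d : ℕ} {P : PhaseSpace d × PhaseSpace d} (hP : P ≠ 0) :
    kernelPair P ≠ 0 := by
  rw [← norm_pos_iff] at hP ⊢
  exact hP.trans_le (norm_le_norm_kernelPair P)

theorem RapidNear.comp_kernelPair {s : ℝ} (hs : 0 < s) {d : ℕ} {f : PhaseSpace (d + d) → ℂ}
    {P : PhaseSpace d × PhaseSpace d} (hf : RapidNear s f (kernelPair P)) :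
    RapidNear s (fun Q => f (kernelPair Q)) P := by
  obtain ⟨δ, hδ, H⟩ := hf
  refine ⟨δ / 2, by positivity, fun A hA => ?_⟩
  obtain ⟨C, hC, HC⟩ := H A hA
  refine ⟨C, hC, fun Q hQ t ht => ?_⟩
  have h1 : kernelPair Q ∈ Metric.ball (kernelPair P) δ := by
    rw [mem_ball_iff_norm] at hQ ⊢
    rw [← kernelPair_sub]
    have := norm_kernelPair_le (Q - P)
    linarith
  have h2 := HC _ h1 t ht
  rw [← kernelPair_smul] at h2
  refine h2.trans ?_
  have := norm_le_norm_kernelPair (t • Q)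
  gcongr

/-! ### Propagation of wave front sets -/

theorem RapidNear.mul_of_growth {E : Type*} [SeminormedAddCommGroup E] [Module ℝ E] {s : ℝ}
    {f g : E → ℂ} {z₀ : E} (hf : RapidNear s f z₀) {M b : ℝ} (hM : 0 ≤ M) (hb : 0 ≤ b)
    (hg : ∀ z, ‖g z‖ ≤ M * Real.exp (b * ‖z‖ ^ (1 / s))) :
    RapidNear s (fun z => g z * f z) z₀ := by
  obtain ⟨δ, hδ, H⟩ := hf
  refine ⟨δ, hδ, fun A hA => ?_⟩
  obtain ⟨C, hC, HC⟩ := H (A + b) (by positivity)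
  refine ⟨M * C, by positivity, fun p hp t ht => ?_⟩
  rw [norm_mul]
  calc _ ≤ (M * Real.exp (b * ‖t • p‖ ^ (1 / s))) *
        (C * Real.exp (-((A + b) * ‖t • p‖ ^ (1 / s)))) := by
        gcongr
        · exact hg _
        · exact HC p hp t ht
    _ = M * C * (Real.exp (b * ‖t • p‖ ^ (1 / s)) *
        Real.exp (-((A + b) * ‖t • p‖ ^ (1 / s)))) := by ring
    _ = _ := by
        rw [← Real.exp_add]
        ring_nf

/-- Near a point with nonzero second component, `‖Q‖` and `‖Q.2‖` are comparable on the whole cone,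
so decay in `Q.2` is decay in `Q`. -/
theorem RapidNear.comp_snd {E F : Type*} [NormedAddCommGroup E] [NormedSpace ℝ E]
    [NormedAddCommGroup F] [NormedSpace ℝ F] {s : ℝ} (hs : 0 < s) {f : F → ℂ} {P : E × F}
    (hP : P.2 ≠ 0) (hf : RapidNear s f P.2) : RapidNear s (fun Q : E × F => f Q.2) P := by
  have hr : 0 ≤ 1 / s := by positivity
  obtain ⟨δ, hδ, H⟩ := hf
  have hP0 : 0 < ‖P.2‖ := norm_pos_iff.2 hP
  set ε := min δ (‖P.2‖ / 2) with hε
  have hε0 : 0 < ε := lt_min hδ (by positivity)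
  set κ := (‖P‖ + ε) / (‖P.2‖ / 2) with hκ
  have hκ0 : 0 < κ := by positivity
  refine ⟨ε, hε0, fun A hA => ?_⟩
  obtain ⟨C, hC, HC⟩ := H (A * κ ^ (1 / s)) (by positivity)
  refine ⟨C, hC, fun Q hQ t ht => ?_⟩
  rw [mem_ball_iff_norm] at hQ
  have h1 : ‖Q.2 - P.2‖ < ε := (norm_snd_le (Q - P)).trans_lt hQ
  refine (HC Q.2 (mem_ball_iff_norm.2 (h1.trans_le (min_le_left _ _))) t ht).trans ?_
  have h2 : ‖P.2‖ / 2 ≤ ‖Q.2‖ := by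
    have h3 := norm_sub_norm_le P.2 Q.2
    rw [norm_sub_rev] at h3
    have h4 : ε ≤ ‖P.2‖ / 2 := min_le_right _ _
    linarith
  have h5 : ‖Q‖ ≤ κ * ‖Q.2‖ := by
    have h6 := norm_le_norm_add_norm_sub' Q P
    calc ‖Q‖ ≤ ‖P‖ + ε := by linarith
      _ = κ * (‖P.2‖ / 2) := by rw [hκ]; field_simp
      _ ≤ _ := by gcongr
  have h7 : ‖t • Q‖ ^ (1 / s) ≤ κ ^ (1 / s) * ‖t • Q.2‖ ^ (1 / s) := by
    rw [← Real.mul_rpow (by positivity) (norm_nonneg _)]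
    refine Real.rpow_le_rpow (norm_nonneg _) ?_ hr
    rw [norm_smul, norm_smul, mul_left_comm]
    gcongr
  refine mul_le_mul_of_nonneg_left (Real.exp_le_exp.2 ?_) hC
  have h8 := mul_le_mul_of_nonneg_left h7 hA.le
  linarith

theorem isCompact_ray_sphere {E F : Type*} [NormedAddCommGroup E] [NormedSpace ℝ E]
    [NormedAddCommGroup F] [NormedSpace ℝ F] [FiniteDimensional ℝ F] (z₀ : E) (R : ℝ) :
    IsCompact {P : E × F | ‖P‖ = 1 ∧ ∃ a ∈ Set.Icc (0 : ℝ) R, P.1 = a • z₀} := by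
  have : ProperSpace F := FiniteDimensional.proper ℝ F
  have h1 : IsCompact ((fun q : ℝ × F => (q.1 • z₀, q.2)) ''
      (Set.Icc (0 : ℝ) R ×ˢ Metric.closedBall 0 1)) :=
    (isCompact_Icc.prod (isCompact_closedBall 0 1)).image (by fun_prop)
  convert h1.inter_right (isClosed_eq continuous_norm continuous_const :
    IsClosed {P : E × F | ‖P‖ = 1}) using 1
  ext P
  constructor
  · rintro ⟨hP, a, ha, hPa⟩
    refine ⟨⟨(a, P.2), ⟨ha, ?_⟩, Prod.ext hPa.symm rfl⟩, hP⟩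
    rw [mem_closedBall_zero_iff, ← hP]
    exact norm_snd_le P
  · rintro ⟨⟨⟨a, w⟩, ⟨ha, -⟩, rfl⟩, hP⟩
    exact ⟨hP, a, ha, rfl⟩

theorem theorem6p3 (d : ℕ) (s : ℝ) (hs : 1 / 2 < s)
    (K : GSDual s (d + d))
    (T : GSSpace s d →L[ℂ] GSSpace s d) (hTK : HasKernel hs K T)
    (T' : GSDual s d →L[ℂ] GSDual s d)
    (hT' : ∀ f : GSSpace s d, T' (f.toDual hs) = (T f).toDual hs)
    (Φ : GSSpace s (d + d)) (hΦ : Φ ≠ 0)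
    (φ : GSSpace s d) (hφ : φ ≠ 0) (ψ : GSSpace s d) (hψ : ψ ≠ 0)
    (hWF₁ : waveFrontFst (gsWaveFront hs Φ K) = ∅)
    (hWF₂ : waveFrontSnd (gsWaveFront hs Φ K) = ∅)
    (u : GSDual s d) :
    gsWaveFront hs ψ (T' u) ⊆ twistedComp (gsWaveFront hs Φ K) (gsWaveFront hs φ u) := by
  have hs0 : 0 < s := by linarith
  have hr : 0 ≤ 1 / s := by positivity
  intro z₀ hz₀
  by_contra hcomp
  have hz0 : z₀ ≠ 0 := hz₀.1
  have hz0n : 0 < ‖z₀‖ := norm_pos_iff.2 hz0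
  refine notMem_gsWaveFront_of_rapidNear hs hz0 ?_ hz₀
  set Ψ := ψ.tensor hs (φ.conj hs) with hΨ
  set k : PhaseSpace d × PhaseSpace d → ℂ := fun P => stft hs Ψ K (kernelPair P) with hk
  set v : PhaseSpace d × PhaseSpace d → ℂ := fun P => stft hs φ u P.2 with hv
  obtain ⟨M, b, hM, hb, Hu⟩ := GSSpace.exists_norm_stft_le hs φ u
  obtain ⟨N, e, hN, he, HK⟩ := GSSpace.exists_norm_stft_le hs Ψ K
  have hvg : ∀ P, ‖v P‖ ≤ M * Real.exp (b * ‖P‖ ^ (1 / s)) := fun P => by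
    refine (Hu P.2).trans ?_
    have := norm_snd_le P
    gcongr
  have hkg : ∀ P, ‖k P‖ ≤ N * Real.exp (e * 2 ^ (1 / s) * ‖P‖ ^ (1 / s)) := fun P => by
    refine (HK _).trans ?_
    rw [mul_assoc, ← Real.mul_rpow (by norm_num) (norm_nonneg _)]
    have := norm_kernelPair_le P
    gcongr
  -- decay of the integrand near a point outside of the wave front set of the kernel
  have hgoodK : ∀ P : PhaseSpace d × PhaseSpace d, P ≠ 0 →
      kernelPair P ∉ gsWaveFront hs Φ K → RapidNear s (fun P => v P * k P) P := by
    intro P hP hPK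
    have h1 := rapidNear_of_notMem_gsWaveFront hs (kernelPair_ne_zero hP) hPK
    exact ((GSSpace.rapidNear_stft_of_window hs hΦ Ψ h1).comp_kernelPair hs0).mul_of_growth
      hM hb hvg
  have hgood : ∀ (a : ℝ) (w : PhaseSpace d), 0 ≤ a → ((a • z₀, w) : _ × PhaseSpace d) ≠ 0 →
      RapidNear s (fun P => v P * k P) (a • z₀, w) := by
    intro a w ha hne
    -- For `a = 0` the direction is governed by `WF₂(K)`. Otherwise scale to `a = 1`: `w' = 0` is
    -- governed by `WF₁(K)`, `w' ∈ WF(u)` by `hcomp`, and any other `w'` by the decay of `V_φ u`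
    -- against the growth of the kernel.
    rcases ha.eq_or_lt with rfl | ha
    · refine hgoodK _ hne fun h => ?_
      have h1 : w ∈ waveFrontSnd (gsWaveFront hs Φ K) := by
        simpa [kernelPair, waveFrontSnd] using h
      simp [hWF₂] at h1
    · have h1 : RapidNear s (fun P => v P * k P) (z₀, a⁻¹ • w) := by
        set w' := a⁻¹ • w
        by_cases hw : w' = 0
        · refine hgoodK _ (by simp [hz0]) fun h => ?_
          have h1 : z₀ ∈ waveFrontFst (gsWaveFront hs Φ K) := by
            simpa [kernelPair, waveFrontFst, hw] using h
          simp [hWF₁] at h1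
        · by_cases hwu : w' ∈ gsWaveFront hs φ u
          · exact hgoodK _ (by simp [hz0]) fun h => hcomp ⟨w', hwu, h⟩
          · have h2 : RapidNear s v (z₀, w') :=
              RapidNear.comp_snd hs0 hw (rapidNear_of_notMem_gsWaveFront hs hw hwu)
            have h3 := h2.mul_of_growth hN (by positivity) hkg
            simpa only [mul_comm] using h3
      have h2 := h1.smul ha
      rwa [Prod.smul_mk, smul_inv_smul₀ ha.ne'] at h2
  have hQ : ∀ P ∈ {P : PhaseSpace d × PhaseSpace d | ‖P‖ = 1 ∧
      ∃ a ∈ Set.Icc (0 : ℝ) (1 / ‖z₀‖), P.1 = a • z₀}, RapidNear s (fun P => v P * k P) P := by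
    rintro ⟨z, w⟩ ⟨hn, a, ha, hza⟩
    dsimp only at hza
    rw [hza] at hn ⊢
    refine hgood a w ha.1 fun h0 => ?_
    rw [h0, norm_zero] at hn
    exact zero_ne_one hn
  obtain ⟨δ, hδ, H⟩ := (isCompact_ray_sphere z₀ (1 / ‖z₀‖)).exists_uniform_of_rapidNear hQ
  obtain ⟨c, hc⟩ := GSSpace.exists_inversion hs hφ
  have hJi := GSSpace.integrable_exp_neg_phaseSpace hs d one_pos
  set J := ∫ q : PhaseSpace d, Real.exp (-(1 * ‖q‖ ^ (1 / s))) with hJ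
  have hJ0 : 0 ≤ J := integral_nonneg fun _ => (Real.exp_pos _).le
  -- Since `n ≥ t ‖z₀‖` below, moving `z₀` by less than `δ ‖z₀‖` moves the normalized pair by less
  -- than `δ`, uniformly in `w`.
  refine ⟨δ * ‖z₀‖, by positivity, fun A hA => ?_⟩
  -- Rate `A` is spent on `t • p`, the extra 1 on integrability in `w`.
  obtain ⟨C, hC, HC⟩ := H (A + 1) (by positivity)
  refine ⟨‖c‖ * (C * J), by positivity, fun p hp t ht => ?_⟩
  have hbound : ∀ w : PhaseSpace d, ‖v (t • p, w) * k (t • p, w)‖ ≤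
      C * Real.exp (-(A * ‖t • p‖ ^ (1 / s))) * Real.exp (-(1 * ‖w‖ ^ (1 / s))) := by
    intro w
    -- Normalizing by `n` puts the unperturbed pair `(t z₀, w)` in the compact set, for every `w`.
    set n := ‖((t • z₀, w) : PhaseSpace d × PhaseSpace d)‖ with hn
    have htn : t * ‖z₀‖ ≤ n := by
      rw [← Real.norm_of_nonneg ht.le, ← norm_smul]
      exact norm_fst_le ((t • z₀, w) : PhaseSpace d × PhaseSpace d)
    have hn0 : 0 < n := lt_of_lt_of_le (by positivity) htn
    have hmem : n⁻¹ • ((t • z₀, w) : PhaseSpace d × PhaseSpace d) ∈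
        {P : PhaseSpace d × PhaseSpace d | ‖P‖ = 1 ∧
          ∃ a ∈ Set.Icc (0 : ℝ) (1 / ‖z₀‖), P.1 = a • z₀} := by
      refine ⟨?_, n⁻¹ * t, ⟨by positivity, ?_⟩, ?_⟩
      · rw [norm_smul, norm_inv, Real.norm_of_nonneg hn0.le, ← hn, inv_mul_cancel₀ hn0.ne']
      · rw [inv_mul_le_iff₀ hn0, mul_one_div, le_div_iff₀ hz0n]
        exact htn
      · rw [Prod.smul_mk, smul_smul]
    have hclose : ‖n⁻¹ • ((t • p, w) : PhaseSpace d × PhaseSpace d) - n⁻¹ • (t • z₀, w)‖ < δ := by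
      rw [mem_ball_iff_norm] at hp
      rw [← smul_sub, Prod.mk_sub_mk, sub_self, ← smul_sub, norm_smul, Prod.norm_mk, norm_zero,
        max_eq_left (norm_nonneg _), norm_smul, norm_inv, Real.norm_of_nonneg hn0.le,
        Real.norm_of_nonneg ht.le, inv_mul_lt_iff₀ hn0]
      calc t * ‖p - z₀‖ < t * (δ * ‖z₀‖) := by gcongr
        _ = δ * (t * ‖z₀‖) := by ring
        _ ≤ δ * n := by gcongr
        _ = n * δ := mul_comm _ _
    have h1 := HC _ hmem _ hclose n hn0
    rw [smul_inv_smul₀ hn0.ne'] at h1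
    refine h1.trans ?_
    rw [mul_assoc, ← Real.exp_add]
    have h2 : ‖t • p‖ ^ (1 / s) ≤ ‖((t • p, w) : PhaseSpace d × PhaseSpace d)‖ ^ (1 / s) :=
      Real.rpow_le_rpow (norm_nonneg _) (norm_fst_le ((t • p, w) : PhaseSpace d × PhaseSpace d)) hr
    have h3 : ‖w‖ ^ (1 / s) ≤ ‖((t • p, w) : PhaseSpace d × PhaseSpace d)‖ ^ (1 / s) :=
      Real.rpow_le_rpow (norm_nonneg _) (norm_snd_le ((t • p, w) : PhaseSpace d × PhaseSpace d)) hr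
    refine mul_le_mul_of_nonneg_left (Real.exp_le_exp.2 ?_) hC
    have h4 := mul_le_mul_of_nonneg_left h2 hA.le
    linarith
  rw [GSSpace.stft_operator hs hφ hc hTK T' hT' ψ u, norm_mul, RCLike.norm_conj]
  have h7 := norm_integral_le_of_norm_le (hJi.const_mul _) (Filter.Eventually.of_forall hbound)
  rw [integral_const_mul] at h7
  calc _ ≤ ‖c‖ * _ := mul_le_mul_of_nonneg_left h7 (norm_nonneg c)
    _ = _ := by ring
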